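/- Let $\mathbf k$ be a field of characteristic $0$, let $g_2,g_3\in\mathbf k$ with $g_2^3-27g_3^2\neq 0$, and let $E$ be the elliptic curve $y^2=4x^3-g_2x-g_3$ with origin $0$ the point at infinity and $\omega=dx/y$. Let $E^\#$ be the group of isomorphism classes of line bundles of degree $0$ on $E$ with connection, and $\pi:E^\#\to E$ the projection. Let $$\mathcal A=\mathbf k[x,y,\tilde c]/(y^2-4x^3+g_2x+g_3)$$ be the ring of regular functions on $E^\#\smallsetminus\pi^{-1}(0)\simeq(E\smallsetminus 0)\times\mathbb A^1$, where the point $(P,\tilde c)$ with $P=(x_P,y_P)$ corresponds to the bundle $\mathcal O(P-0)$ with the connection which in the rational section $1$ is given by the differential $\big(\frac12\frac{y+y_P}{x-x_P}+\tilde c\big)\frac{dx}{y}$. Let $\partial$ be the $\mathbf k$-derivation of $\mathcal A$ with $\partial x=y$, $\partial y=6x^2-\frac12g_2$, $\partial\tilde c=x$. Let $\wp(p)=p^{-2}+\sum_{n\ge0}a_np^n\in\mathbf k((p))$ be the solution of $(\wp')^2=4\wp^3-g_2\wp-g_3$ (so $a_0=a_1=a_3=0$, $a_2=g_2/20$, $a_4=g_3/28$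 and $(n^2-n-12)a_n=6\sum_{r+s=n-2}a_ra_s$ for $n\ge5$), let $\tilde\theta(z)=z\exp\big(-\sum_{n\ge0}\frac{a_nz^{n+2}}{(n+1)(n+2)}\big)$, and let $\mathbf f(z)=\frac1z+\sum_{\alpha\ge0}f_\alpha z^\alpha$, where $f_\alpha\in\mathcal A$ is the coefficient of $z^\alpha$ in $\frac1{\tilde\theta(z)}\exp\big(-\tilde cz-\sum_{m\ge2}\frac1{m!}\partial^{m-2}(x)z^m\big)$. For $a\in\mathcal A$ write $a^{(1)}=a\otimes1$, $a^{(2)}=1\otimes a$, and let $\lambda=\frac{y^{(1)}-y^{(2)}}{x^{(1)}-x^{(2)}}$. Let $\Delta:\mathcal A\to(\mathcal A\otimes\mathcal A)[\lambda]$ be the morphism $$x\mapsto-x^{(1)}-x^{(2)}+\tfrac14\lambda^2,\quad y\mapsto-\tfrac12(y^{(1)}+y^{(2)})+\tfrac32(x^{(1)}+x^{(2)})\lambda-\tfrac14\lambda^3,\quad \tilde c\mapsto\tilde c^{(1)}+\tilde c^{(2)}-\tfrac12\lambda .$$ (1) $\Delta$ is the coproduct given by the group law of $E^\#$: for every field extension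 $K$ of $\mathbf k$, it is dual to the addition of those pairs $(e,e')$ of $K$-points of $E^\#$ for which $\pi(e),\pi(e'),\pi(e)+\pi(e')\neq0$ (that is, of the $K$-points of $(\mathcal A\otimes\mathcal A)[\lambda]$). (2) (Algebraic Fay identity.) In $\frac1{zz'(z+z')}(\mathcal A\otimes\mathcal A)[\lambda][[z,z']]$, $$(\mathbf f(z)\otimes1)\,\Delta(\mathbf f(z'))-\mathbf f(z+z')\otimes\mathbf f(z')+(1\otimes\mathbf f(-z))\,\Delta(\mathbf f(z+z'))=0 .$$ (3) Let $n\ge0$ and $1\le i<j<k\le n$. Let $S$ be the automorphism $x\mapsto x$, $y\mapsto-y$, $\tilde c\mapsto-\tilde c$ of $\mathcal A$. For $r<s$ in $\{i,j,k\}$ let $D_{rs}=S^{(s)}\Delta^{(rs)}:\mathcal A\to\mathcal A^{\otimes n}\big[\frac{y^{(r)}+y^{(s)}}{x^{(r)}-x^{(s)}}\big]$ be $\Delta$ with its two factors placed in positions $r$ and $s$, followed by $S$ in position $s$. Then $D_{rs}$ is dual to $(e_1,\dots,e_n)\mapsto e_r-e_s$ (on $K$-points as in (1)), and $$D_{ij}(\mathbf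 f(z))D_{ik}(\mathbf f(z'))-D_{ij}(\mathbf f(z+z'))D_{jk}(\mathbf f(z'))+D_{jk}(\mathbf f(-z))D_{ik}(\mathbf f(z+z'))=0$$ in $\frac1{zz'(z+z')}\mathcal A^{\otimes n}\big[\frac{y^{(i)}+y^{(j)}}{x^{(i)}-x^{(j)}},\frac{y^{(i)}+y^{(k)}}{x^{(i)}-x^{(k)}},\frac{y^{(j)}+y^{(k)}}{x^{(j)}-x^{(k)}}\big][[z,z']]$. -/

import Mathlib

open scoped TensorProduct

universe u v

noncomputable section

namespace FayAlg

/-! ### The ring of regular functions on `E^♯ ∖ π⁻¹(0)` -/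

section Ring

variable {𝕜 : Type u} [Field 𝕜]

/-- The equation `y² - 4x³ + g₂x + g₃` in `𝕜[x, y, c]`
(the variables `x, y, c` have the indices `0, 1, 2`). -/
def curveRel (g₂ g₃ : 𝕜) : MvPolynomial (Fin 3) 𝕜 :=
  MvPolynomial.X 1 ^ 2 - 4 * MvPolynomial.X 0 ^ 3 + MvPolynomial.C g₂ * MvPolynomial.X 0
    + MvPolynomial.C g₃

/-- `𝒜 = 𝕜[x, y, c] / (y² - 4x³ + g₂x + g₃)`, the ring of regular functions on
`E^♯ ∖ π⁻¹(0) ≃ (E ∖ {0}) × 𝔸¹`. -/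
def CalA (g₂ g₃ : 𝕜) : Type u :=
  MvPolynomial (Fin 3) 𝕜 ⧸ Ideal.span {curveRel g₂ g₃}

instance (g₂ g₃ : 𝕜) : CommRing (CalA g₂ g₃) :=
  Ideal.Quotient.commRing (Ideal.span {curveRel g₂ g₃})

instance (g₂ g₃ : 𝕜) : Algebra 𝕜 (CalA g₂ g₃) :=
  Ideal.Quotient.algebra 𝕜 (I := Ideal.span {curveRel g₂ g₃})

variable (g₂ g₃ : 𝕜)

/-- The projection `𝕜[x, y, c] → 𝒜`. -/
def mkA : MvPolynomial (Fin 3) 𝕜 →ₐ[𝕜] CalA g₂ g₃ :=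
  Ideal.Quotient.mkₐ 𝕜 (Ideal.span {curveRel g₂ g₃})

theorem mkA_surjective : Function.Surjective (mkA g₂ g₃) :=
  Ideal.Quotient.mkₐ_surjective _ _

theorem mkA_eq_zero {p : MvPolynomial (Fin 3) 𝕜} :
    mkA g₂ g₃ p = 0 ↔ p ∈ Ideal.span {curveRel g₂ g₃} :=
  Ideal.Quotient.eq_zero_iff_mem

def xA : CalA g₂ g₃ := mkA g₂ g₃ (MvPolynomial.X 0)
def yA : CalA g₂ g₃ := mkA g₂ g₃ (MvPolynomial.X 1)
/-- The coordinate `c̃` on `E^♯ ∖ π⁻¹(0)`. -/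
def cA : CalA g₂ g₃ := mkA g₂ g₃ (MvPolynomial.X 2)

theorem curve_eq : yA g₂ g₃ ^ 2 = 4 * xA g₂ g₃ ^ 3 - algebraMap 𝕜 _ g₂ * xA g₂ g₃
    - algebraMap 𝕜 _ g₃ := by
  have h : mkA g₂ g₃ (curveRel g₂ g₃) = 0 := (mkA_eq_zero g₂ g₃).2 (Ideal.subset_span rfl)
  have h' : yA g₂ g₃ ^ 2 - 4 * xA g₂ g₃ ^ 3 + algebraMap 𝕜 _ g₂ * xA g₂ g₃
    + algebraMap 𝕜 _ g₃ = 0 := by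
    rw [← h]
    simp only [curveRel, map_add, map_sub, map_mul, map_pow, map_ofNat, MvPolynomial.algHom_C,
      xA, yA]
  linear_combination h'

variable {g₂ g₃}

/-- The morphism `𝒜 → R` with `x ↦ a`, `y ↦ b`, `c ↦ c`. -/
def liftA {R : Type*} [CommRing R] [Algebra 𝕜 R] (a b c : R)
    (h : b ^ 2 = 4 * a ^ 3 - algebraMap 𝕜 R g₂ * a - algebraMap 𝕜 R g₃) :
    CalA g₂ g₃ →ₐ[𝕜] R :=
  Ideal.Quotient.liftₐ _ (MvPolynomial.aeval ![a, b, c]) (by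
    intro p hp
    have : Ideal.span {curveRel g₂ g₃} ≤ RingHom.ker (MvPolynomial.aeval (R := 𝕜) ![a, b, c]) := by
      rw [Ideal.span_le, Set.singleton_subset_iff, SetLike.mem_coe, RingHom.mem_ker]
      simp only [curveRel, map_add, map_sub, map_mul, map_pow, map_ofNat, MvPolynomial.aeval_X,
        MvPolynomial.algHom_C, Matrix.cons_val]
      rw [h]; ring
    exact this hp)

theorem hom_curve_eq {R : Type*} [CommRing R] [Algebra 𝕜 R] (φ : CalA g₂ g₃ →ₐ[𝕜] R) :
    φ (yA g₂ g₃) ^ 2 = 4 * φ (xA g₂ g₃) ^ 3 - algebraMap 𝕜 R g₂ * φ (xA g₂ g₃)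
      - algebraMap 𝕜 R g₃ := by
  simpa only [map_sub, map_mul, map_pow, map_ofNat, AlgHom.commutes] using
    congrArg φ (curve_eq g₂ g₃)

variable (g₂ g₃)

/-- The automorphism `S` of `𝒜` dual to the inversion of `E^♯`: `x ↦ x`, `y ↦ -y`, `c ↦ -c`. -/
def antipode : CalA g₂ g₃ →ₐ[𝕜] CalA g₂ g₃ :=
  liftA (xA g₂ g₃) (-yA g₂ g₃) (-cA g₂ g₃) (by rw [neg_sq, curve_eq])

/-- The derivation `x ↦ y`, `y ↦ 6x² - g₂/2`, `c ↦ x` of `𝕜[x, y, c]`. -/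
def polyDer : Derivation 𝕜 (MvPolynomial (Fin 3) 𝕜) (MvPolynomial (Fin 3) 𝕜) :=
  MvPolynomial.mkDerivation 𝕜
    ![MvPolynomial.X 1, 6 * MvPolynomial.X 0 ^ 2 - MvPolynomial.C (g₂ / 2), MvPolynomial.X 0]

theorem polyDer_curveRel [CharZero 𝕜] : polyDer g₂ (curveRel g₂ g₃) = 0 := by
  have h4 : polyDer g₂ (4 : MvPolynomial (Fin 3) 𝕜) = 0 := (polyDer g₂).map_natCast 4
  have hC : ∀ a : 𝕜, polyDer g₂ (MvPolynomial.C a) = 0 := fun a => (polyDer g₂).map_algebraMap a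
  have h0 : polyDer g₂ (MvPolynomial.X 0) = MvPolynomial.X 1 := by simp [polyDer]
  have h1 : polyDer g₂ (MvPolynomial.X 1) = 6 * MvPolynomial.X 0 ^ 2 - MvPolynomial.C (g₂ / 2) := by
    simp [polyDer]
  have h2 : (MvPolynomial.C g₂ : MvPolynomial (Fin 3) 𝕜) = 2 * MvPolynomial.C (g₂ / 2) := by
    rw [show (2 : MvPolynomial (Fin 3) 𝕜) = MvPolynomial.C 2 from (map_ofNat _ 2).symm, ← map_mul]
    congr 1; field_simp
  simp only [curveRel, map_add, map_sub, Derivation.leibniz, Derivation.leibniz_pow, h4, hC, h0, h1,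
    smul_eq_mul, nsmul_eq_mul]
  rw [h2]; push_cast; ring

/-- The derivation `∂` of `𝒜`: `x ↦ y`, `y ↦ 6x² - g₂/2`, `c ↦ x`. -/
def der [CharZero 𝕜] : Derivation 𝕜 (CalA g₂ g₃) (CalA g₂ g₃) :=
  Derivation.liftOfSurjective (d := polyDer g₂)
    (f := mkA g₂ g₃) (mkA_surjective g₂ g₃)
    (by
      intro p hp
      rw [mkA_eq_zero] at hp ⊢
      obtain ⟨q, rfl⟩ := Ideal.mem_span_singleton'.1 hp
      rw [Derivation.leibniz, polyDer_curveRel, smul_zero, zero_add, smul_eq_mul]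
      exact Ideal.mul_mem_right _ _ (Ideal.subset_span rfl))

/-! ### The theta series and the generating series `f` -/

/-- The coefficients `a_n` of the expansion `℘(p) = p⁻² + ∑_{n ≥ 0} a_n pⁿ` of the solution of
`℘'² = 4℘³ - g₂℘ - g₃`: `a_2 = g₂/20`, `a_4 = g₃/28`, and, by `℘'' = 6℘² - g₂/2`,
`(n² - n - 12) a_n = 6 ∑_{r + s = n - 2} a_r a_s` for `n ≥ 5`. -/
def wpCoeff : ℕ → 𝕜
  | 0 => 0
  | 1 => 0
  | 2 => g₂ / 20
  | 3 => 0
  | 4 => g₃ / 28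
  | n + 5 => 6 / (((n : 𝕜) + 1) * ((n : 𝕜) + 8)) *
      ∑ r : Fin (n + 4), wpCoeff r * wpCoeff (n + 3 - r)
  termination_by n => n
  decreasing_by all_goals omega

/-- The series `∑_{n ≥ 0} a_n p^{n+2} / ((n+1)(n+2))`, so that
`θ(p) = p · exp(- thetaLog(p))` and `℘ = - ∂² log θ`. -/
def thetaLog : PowerSeries 𝕜 :=
  PowerSeries.mk fun m => match m with
    | 0 => 0
    | 1 => 0
    | n + 2 => wpCoeff g₂ g₃ n / (((n : 𝕜) + 1) * ((n : 𝕜) + 2))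

/-- The power series `θ(z) / z`, where `θ(z) = z · exp(- ∑ a_n z^{n+2} / ((n+1)(n+2)))`. -/
def thetaUnit [CharZero 𝕜] : PowerSeries 𝕜 :=
  (PowerSeries.exp 𝕜).subst (-thetaLog g₂ g₃)

/-- The exponent `- c z - ∑_{m ≥ 2} ∂^{m-2}(x) z^m / m!` in `𝒜[[z]]`. -/
def fExponent [CharZero 𝕜] : PowerSeries (CalA g₂ g₃) :=
  PowerSeries.mk fun m => match m with
    | 0 => 0
    | 1 => -cA g₂ g₃
    | n + 2 => -((1 / (Nat.factorial (n + 2) : 𝕜)) • ((der g₂ g₃)^[n] (xA g₂ g₃)))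

/-- `f_α` for `α ≥ 0`: the coefficient of `z^α` in
`θ(z)⁻¹ · exp(- c z - ∑_{m ≥ 2} ∂^{m-2}(x) z^m / m!)`, that is, the coefficient of `z^{α+1}` in
`(θ(z)/z)⁻¹ · exp(...)`. -/
def fCoeff [CharZero 𝕜] (α : ℕ) : CalA g₂ g₃ :=
  PowerSeries.coeff (α + 1)
    (PowerSeries.map (algebraMap 𝕜 (CalA g₂ g₃)) (thetaUnit g₂ g₃)⁻¹ *
      (PowerSeries.exp 𝕜).subst (fExponent g₂ g₃))

end Ring

section Polar

variable (B : Type*) [CommRing B]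

def zVar : MvPowerSeries (Fin 2) B := MvPowerSeries.X 0
def zVar' : MvPowerSeries (Fin 2) B := MvPowerSeries.X 1

/-- The ring `B[[z, z']][1/(z z' (z + z'))]`. -/
abbrev PolarSeries : Type _ :=
  Localization.Away (zVar B * zVar' B * (zVar B + zVar' B))

variable {B} {𝕜 : Type u} [Field 𝕜] [CharZero 𝕜] [Algebra 𝕜 B] {g₂ g₃ : 𝕜}

/-- The series `ρ(f)(w) = 1/w + ∑_{α ≥ 0} ρ(f_α) w^α`, for a morphism `ρ : 𝒜 → B`
and `w = z, z', z + z', -z`. -/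
def fAt (ρ : CalA g₂ g₃ →ₐ[𝕜] B) (w : MvPowerSeries (Fin 2) B) : PolarSeries B :=
  Ring.inverse (algebraMap _ (PolarSeries B) w) +
    algebraMap _ (PolarSeries B) (PowerSeries.subst w (PowerSeries.mk fun α => ρ (fCoeff g₂ g₃ α)))

end Polar

/-! ### Addition of points of `E^♯` in coordinates -/

section Coproduct

variable {𝕜 : Type u} [Field 𝕜] {g₂ g₃ : 𝕜}

theorem add_curve_eq {R : Type*} [CommRing R] {x₁ y₁ x₂ y₂ l a b G₂ G₃ : R}
    (h2 : IsUnit (2 : R))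
    (e₁ : y₁ ^ 2 = 4 * x₁ ^ 3 - G₂ * x₁ - G₃) (e₂ : y₂ ^ 2 = 4 * x₂ ^ 3 - G₂ * x₂ - G₃)
    (h₁ : l * (x₁ - x₂) = y₁ - y₂)
    (h₂ : l * (y₁ + y₂) = 4 * (x₁ ^ 2 + x₁ * x₂ + x₂ ^ 2) - G₂)
    (ha : 4 * a = -4 * x₁ - 4 * x₂ + l ^ 2)
    (hb : 4 * b = -2 * (y₁ + y₂) + 6 * (x₁ + x₂) * l - l ^ 3) :
    b ^ 2 = 4 * a ^ 3 - G₂ * a - G₃ := by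
  have h16 : IsUnit (16 : R) := by
    have := h2.pow 4; norm_num at this; exact this
  apply h16.mul_left_cancel
  have e : (4 * b) ^ 2 = (4 * a) ^ 3 - 4 * G₂ * (4 * a) - 16 * G₃ := by
    rw [ha, hb]
    linear_combination (4 * l * (x₁ - x₂) + 4 * (y₁ - y₂)) * h₁
      + (-24 * (x₁ + x₂) + 4 * l ^ 2) * h₂ + 8 * e₁ + 8 * e₂
  linear_combination e

theorem isUnit_two (𝕜 : Type u) [Field 𝕜] [CharZero 𝕜] (R : Type*) [CommRing R] [Algebra 𝕜 R] :
    IsUnit (2 : R) := by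
  have := (IsUnit.mk0 (2 : 𝕜) two_ne_zero).map (algebraMap 𝕜 R)
  simpa only [map_ofNat] using this

theorem slope_rel {R : Type*} [CommRing R] {x₁ y₁ x₂ y₂ l G₂ G₃ : R}
    (e₁ : y₁ ^ 2 = 4 * x₁ ^ 3 - G₂ * x₁ - G₃) (e₂ : y₂ ^ 2 = 4 * x₂ ^ 3 - G₂ * x₂ - G₃)
    (hu : IsUnit (x₁ - x₂)) (h₁ : l * (x₁ - x₂) = y₁ - y₂) :
    l * (y₁ + y₂) = 4 * (x₁ ^ 2 + x₁ * x₂ + x₂ ^ 2) - G₂ := by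
  apply hu.mul_left_cancel
  linear_combination e₁ - e₂ + (y₁ + y₂) * h₁

/-- For two points `φ₁, φ₂ : 𝒜 → R` and their slope `l = (y₁ - y₂)/(x₁ - x₂)`, the morphism
`x ↦ -x₁ - x₂ + l²/4`, `y ↦ -(y₁ + y₂)/2 + 3(x₁ + x₂)l/2 - l³/4`, `c ↦ c₁ + c₂ - l/2`
giving the sum of the two points in `E^♯`. -/
def addHom [CharZero 𝕜] {R : Type*} [CommRing R] [Algebra 𝕜 R] (φ₁ φ₂ : CalA g₂ g₃ →ₐ[𝕜] R) (l : R)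
    (h₁ : l * (φ₁ (xA g₂ g₃) - φ₂ (xA g₂ g₃)) = φ₁ (yA g₂ g₃) - φ₂ (yA g₂ g₃))
    (h₂ : l * (φ₁ (yA g₂ g₃) + φ₂ (yA g₂ g₃)) =
      4 * (φ₁ (xA g₂ g₃) ^ 2 + φ₁ (xA g₂ g₃) * φ₂ (xA g₂ g₃) + φ₂ (xA g₂ g₃) ^ 2)
        - algebraMap 𝕜 R g₂) :
    CalA g₂ g₃ →ₐ[𝕜] R :=
  liftA
    (-φ₁ (xA g₂ g₃) - φ₂ (xA g₂ g₃) + (1 / 4 : 𝕜) • l ^ 2)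
    (-((1 / 2 : 𝕜) • (φ₁ (yA g₂ g₃) + φ₂ (yA g₂ g₃)))
      + (3 / 2 : 𝕜) • ((φ₁ (xA g₂ g₃) + φ₂ (xA g₂ g₃)) * l) - (1 / 4 : 𝕜) • l ^ 3)
    (φ₁ (cA g₂ g₃) + φ₂ (cA g₂ g₃) - (1 / 2 : 𝕜) • l)
    (by
      have q1 : (4 : R) * algebraMap 𝕜 R (1 / 4) = 1 := by
        rw [← map_ofNat (algebraMap 𝕜 R) 4, ← map_mul]; norm_num
      have q2 : (4 : R) * algebraMap 𝕜 R (1 / 2) = 2 := by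
        rw [← map_ofNat (algebraMap 𝕜 R) 4, ← map_ofNat (algebraMap 𝕜 R) 2, ← map_mul]; norm_num
      have q3 : (4 : R) * algebraMap 𝕜 R (3 / 2) = 6 := by
        rw [← map_ofNat (algebraMap 𝕜 R) 4, ← map_ofNat (algebraMap 𝕜 R) 6, ← map_mul]; norm_num
      refine add_curve_eq (isUnit_two 𝕜 R) (hom_curve_eq φ₁) (hom_curve_eq φ₂) h₁ h₂ ?_ ?_
      · simp only [Algebra.smul_def]
        linear_combination l ^ 2 * q1
      · simp only [Algebra.smul_def]
        linear_combination -(φ₁ (yA g₂ g₃) + φ₂ (yA g₂ g₃)) * q2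
          + (φ₁ (xA g₂ g₃) + φ₂ (xA g₂ g₃)) * l * q3 - l ^ 3 * q1)

/-- The slope `(y₁ - y₂)/(x₁ - x₂)` of two points `φ₁, φ₂ : 𝒜 → R` for which `x₁ - x₂` is
invertible in `R`. -/
def slopeOf {R : Type*} [CommRing R] [Algebra 𝕜 R] (φ₁ φ₂ : CalA g₂ g₃ →ₐ[𝕜] R) : R :=
  (φ₁ (yA g₂ g₃) - φ₂ (yA g₂ g₃)) * Ring.inverse (φ₁ (xA g₂ g₃) - φ₂ (xA g₂ g₃))

theorem slopeOf_mul {R : Type*} [CommRing R] [Algebra 𝕜 R] {φ₁ φ₂ : CalA g₂ g₃ →ₐ[𝕜] R}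
    (h : IsUnit (φ₁ (xA g₂ g₃) - φ₂ (xA g₂ g₃))) :
    slopeOf φ₁ φ₂ * (φ₁ (xA g₂ g₃) - φ₂ (xA g₂ g₃)) = φ₁ (yA g₂ g₃) - φ₂ (yA g₂ g₃) := by
  rw [slopeOf, mul_assoc, Ring.inverse_mul_cancel _ h, mul_one]

/-- The sum of two points `φ₁, φ₂ : 𝒜 → T` with values in a subring `T` of a ring `L`, such that
`x₁ - x₂` is invertible in `L` and the slope `(y₁ - y₂)/(x₁ - x₂) ∈ L` belongs to `T`. -/
def addIn [CharZero 𝕜] {A L : Type*} [CommRing A] [CommRing L] [Algebra 𝕜 A] [Algebra A L]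
    [Algebra 𝕜 L] [IsScalarTower 𝕜 A L] (T : Subalgebra A L) (φ₁ φ₂ : CalA g₂ g₃ →ₐ[𝕜] A)
    (hu : IsUnit (algebraMap A L (φ₁ (xA g₂ g₃)) - algebraMap A L (φ₂ (xA g₂ g₃))))
    (hl : slopeOf ((IsScalarTower.toAlgHom 𝕜 A L).comp φ₁)
      ((IsScalarTower.toAlgHom 𝕜 A L).comp φ₂) ∈ T) :
    CalA g₂ g₃ →ₐ[𝕜] T :=
  addHom ((IsScalarTower.toAlgHom 𝕜 A T).comp φ₁) ((IsScalarTower.toAlgHom 𝕜 A T).comp φ₂)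
    ⟨_, hl⟩
    (Subtype.ext (slopeOf_mul (φ₁ := (IsScalarTower.toAlgHom 𝕜 A L).comp φ₁)
      (φ₂ := (IsScalarTower.toAlgHom 𝕜 A L).comp φ₂) hu))
    (Subtype.ext (by
      exact slope_rel (hom_curve_eq ((IsScalarTower.toAlgHom 𝕜 A L).comp φ₁))
        (hom_curve_eq ((IsScalarTower.toAlgHom 𝕜 A L).comp φ₂)) hu (slopeOf_mul hu)))

end Coproduct


/-! ### The rings of functions on the open subsets of `(E^♯)²` and `(E^♯)ⁿ` -/

section Rings

variable {𝕜 : Type u} [Field 𝕜] (g₂ g₃ : 𝕜)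

/-- The ring `(𝒜 ⊗ 𝒜)[1/(x⁽¹⁾ - x⁽²⁾)]`. -/
abbrev PairLoc : Type u :=
  Localization.Away ((xA g₂ g₃ ⊗ₜ[𝕜] 1 - 1 ⊗ₜ[𝕜] xA g₂ g₃ : CalA g₂ g₃ ⊗[𝕜] CalA g₂ g₃))

/-- The first and second projection as morphisms `𝒜 → 𝒜 ⊗ 𝒜`. -/
def fstA : CalA g₂ g₃ →ₐ[𝕜] CalA g₂ g₃ ⊗[𝕜] CalA g₂ g₃ := Algebra.TensorProduct.includeLeft
def sndA : CalA g₂ g₃ →ₐ[𝕜] CalA g₂ g₃ ⊗[𝕜] CalA g₂ g₃ := Algebra.TensorProduct.includeRight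

/-- The element `(y⁽¹⁾ - y⁽²⁾)/(x⁽¹⁾ - x⁽²⁾)`. -/
def pairSlope : PairLoc g₂ g₃ :=
  slopeOf ((IsScalarTower.toAlgHom 𝕜 _ (PairLoc g₂ g₃)).comp (fstA g₂ g₃))
    ((IsScalarTower.toAlgHom 𝕜 _ (PairLoc g₂ g₃)).comp (sndA g₂ g₃))

/-- The ring `(𝒜 ⊗ 𝒜)[(y⁽¹⁾ - y⁽²⁾)/(x⁽¹⁾ - x⁽²⁾)]` of regular functions on the set of pairs
`(e, e')` in `(E^♯)²` with `π(e), π(e'), π(e) + π(e') ≠ 0`. -/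
abbrev PairRing : Subalgebra (CalA g₂ g₃ ⊗[𝕜] CalA g₂ g₃) (PairLoc g₂ g₃) :=
  Algebra.adjoin _ {pairSlope g₂ g₃}

/-- `a ↦ a ⊗ 1` and `a ↦ 1 ⊗ a`. -/
def inl : CalA g₂ g₃ →ₐ[𝕜] PairRing g₂ g₃ := (IsScalarTower.toAlgHom 𝕜 _ _).comp (fstA g₂ g₃)
def inr : CalA g₂ g₃ →ₐ[𝕜] PairRing g₂ g₃ := (IsScalarTower.toAlgHom 𝕜 _ _).comp (sndA g₂ g₃)

/-- The coproduct `Δ : 𝒜 → (𝒜 ⊗ 𝒜)[(y⁽¹⁾ - y⁽²⁾)/(x⁽¹⁾ - x⁽²⁾)]`. -/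
def comul [CharZero 𝕜] : CalA g₂ g₃ →ₐ[𝕜] PairRing g₂ g₃ :=
  addIn (PairRing g₂ g₃) (fstA g₂ g₃) (sndA g₂ g₃)
    (by
      rw [← map_sub]
      exact IsLocalization.Away.algebraMap_isUnit
        (xA g₂ g₃ ⊗ₜ[𝕜] 1 - 1 ⊗ₜ[𝕜] xA g₂ g₃ : CalA g₂ g₃ ⊗[𝕜] CalA g₂ g₃))
    (Algebra.subset_adjoin rfl)

/-- The ring `𝒜^{⊗ n}`. -/
abbrev PowA (n : ℕ) : Type u := ⨂[𝕜] _ : Fin n, CalA g₂ g₃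

/-- `a ↦ a⁽ⁱ⁾ = 1^{⊗ i-1} ⊗ a ⊗ 1^{⊗ n-i}`. -/
def proj {n : ℕ} (i : Fin n) : CalA g₂ g₃ →ₐ[𝕜] PowA g₂ g₃ n :=
  PiTensorProduct.singleAlgHom (R := 𝕜) (A := fun _ : Fin n => CalA g₂ g₃) i

/-- The product `(x⁽ⁱ⁾ - x⁽ʲ⁾)(x⁽ⁱ⁾ - x⁽ᵏ⁾)(x⁽ʲ⁾ - x⁽ᵏ⁾)`. -/
def tripleDenom {n : ℕ} (i j k : Fin n) : PowA g₂ g₃ n :=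
  (proj g₂ g₃ i (xA g₂ g₃) - proj g₂ g₃ j (xA g₂ g₃)) *
    (proj g₂ g₃ i (xA g₂ g₃) - proj g₂ g₃ k (xA g₂ g₃)) *
    (proj g₂ g₃ j (xA g₂ g₃) - proj g₂ g₃ k (xA g₂ g₃))

abbrev TripleLoc {n : ℕ} (i j k : Fin n) : Type u :=
  Localization.Away (tripleDenom g₂ g₃ i j k)

/-- The element `(y⁽ʳ⁾ + y⁽ˢ⁾)/(x⁽ʳ⁾ - x⁽ˢ⁾)`, the slope of the `r`-th point and of the inverse
of the `s`-th point. -/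
def tripleSlope {n : ℕ} (i j k r s : Fin n) : TripleLoc g₂ g₃ i j k :=
  slopeOf ((IsScalarTower.toAlgHom 𝕜 _ (TripleLoc g₂ g₃ i j k)).comp (proj g₂ g₃ r))
    ((IsScalarTower.toAlgHom 𝕜 _ (TripleLoc g₂ g₃ i j k)).comp
      ((proj g₂ g₃ s).comp (antipode g₂ g₃)))

/-- The subring of `𝒜^{⊗ n}[1/((x⁽ⁱ⁾ - x⁽ʲ⁾)(x⁽ⁱ⁾ - x⁽ᵏ⁾)(x⁽ʲ⁾ - x⁽ᵏ⁾))]` generated over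
`𝒜^{⊗ n}` by the `(y⁽ʳ⁾ + y⁽ˢ⁾)/(x⁽ʳ⁾ - x⁽ˢ⁾)` for `(r, s) = (i, j), (i, k), (j, k)`: the ring of
regular functions on the set of the `(e_1, …, e_n)` in `(E^♯)ⁿ` such that no `π(e_r)` is `0`
and `π(e_i), π(e_j), π(e_k)` are distinct. -/
abbrev TripleRing {n : ℕ} (i j k : Fin n) : Subalgebra (PowA g₂ g₃ n) (TripleLoc g₂ g₃ i j k) :=
  Algebra.adjoin _ {tripleSlope g₂ g₃ i j k i j, tripleSlope g₂ g₃ i j k i k,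
    tripleSlope g₂ g₃ i j k j k}

/-- `a ↦ a⁽ʳ⁾`. -/
def tripleProj {n : ℕ} (i j k r : Fin n) : CalA g₂ g₃ →ₐ[𝕜] TripleRing g₂ g₃ i j k :=
  (IsScalarTower.toAlgHom 𝕜 _ _).comp (proj g₂ g₃ r)

theorem antipode_x : antipode g₂ g₃ (xA g₂ g₃) = xA g₂ g₃ := by
  change antipode g₂ g₃ (mkA g₂ g₃ (MvPolynomial.X 0)) = _
  have : antipode g₂ g₃ (mkA g₂ g₃ (MvPolynomial.X 0)) =
      MvPolynomial.aeval ![xA g₂ g₃, -yA g₂ g₃, -cA g₂ g₃] (MvPolynomial.X (R := 𝕜) (0 : Fin 3)) :=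
    rfl
  rw [this, MvPolynomial.aeval_X]; rfl

theorem isUnit_of_dvd_tripleDenom {n : ℕ} (i j k r s : Fin n)
    (h : proj g₂ g₃ r (xA g₂ g₃) - proj g₂ g₃ s (xA g₂ g₃) ∣ tripleDenom g₂ g₃ i j k) :
    IsUnit (algebraMap _ (TripleLoc g₂ g₃ i j k) (proj g₂ g₃ r (xA g₂ g₃)) -
      algebraMap _ (TripleLoc g₂ g₃ i j k)
        (((proj g₂ g₃ s).comp (antipode g₂ g₃)) (xA g₂ g₃))) := by
  rw [AlgHom.comp_apply, antipode_x, ← map_sub]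
  exact isUnit_of_dvd_unit (map_dvd _ h)
    (IsLocalization.Away.algebraMap_isUnit (tripleDenom g₂ g₃ i j k))

variable [CharZero 𝕜]

/-- The morphism `S⁽ʲ⁾Δ⁽ⁱʲ⁾` dual to `(e_1, …, e_n) ↦ e_i - e_j`: the coproduct `Δ` with its two
factors put in positions `i` and `j`, followed by `S` in position `j`. -/
def diffIJ {n : ℕ} (i j k : Fin n) : CalA g₂ g₃ →ₐ[𝕜] TripleRing g₂ g₃ i j k :=
  addIn (TripleRing g₂ g₃ i j k) (proj g₂ g₃ i) ((proj g₂ g₃ j).comp (antipode g₂ g₃))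
    (isUnit_of_dvd_tripleDenom g₂ g₃ i j k i j ⟨_, mul_assoc _ _ _⟩)
    (Algebra.subset_adjoin (Or.inl rfl))

/-- The morphism `S⁽ᵏ⁾Δ⁽ⁱᵏ⁾` dual to `(e_1, …, e_n) ↦ e_i - e_k`. -/
def diffIK {n : ℕ} (i j k : Fin n) : CalA g₂ g₃ →ₐ[𝕜] TripleRing g₂ g₃ i j k :=
  addIn (TripleRing g₂ g₃ i j k) (proj g₂ g₃ i) ((proj g₂ g₃ k).comp (antipode g₂ g₃))
    (isUnit_of_dvd_tripleDenom g₂ g₃ i j k i k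
      (Dvd.dvd.mul_right (Dvd.intro_left _ rfl) _))
    (Algebra.subset_adjoin (Or.inr (Or.inl rfl)))

/-- The morphism `S⁽ᵏ⁾Δ⁽ʲᵏ⁾` dual to `(e_1, …, e_n) ↦ e_j - e_k`. -/
def diffJK {n : ℕ} (i j k : Fin n) : CalA g₂ g₃ →ₐ[𝕜] TripleRing g₂ g₃ i j k :=
  addIn (TripleRing g₂ g₃ i j k) (proj g₂ g₃ j) ((proj g₂ g₃ k).comp (antipode g₂ g₃))
    (isUnit_of_dvd_tripleDenom g₂ g₃ i j k j k (Dvd.intro_left _ rfl))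
    (Algebra.subset_adjoin (Or.inr (Or.inr rfl)))

end Rings

/-! ### The group `E^♯(K)`

A line bundle with connection on a complete nonsingular curve with function field `F`, together
with a nonzero rational section `s`, is determined by the rational differential `ψ = ∇(s)s⁻¹`;
another section `g s` changes `ψ` into `ψ + g⁻¹dg`, and tensor product is the addition of the `ψ`.
A rational differential arises from a line bundle with connection if and only if at each place `v`
there is a rational function `g` for which `ψ - g⁻¹dg` is regular. In characteristic zero such
a line bundle has degree zero. -/

section Moduli

variable (K : Type*) (F : Type*) [Field K] [Field F] [Algebra K F]

/-- `g ↦ g⁻¹ dg`. -/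
def dlog : Additive Fˣ →+ Ω[F⁄K] where
  toFun g := ((g.toMul⁻¹ : Fˣ) : F) • KaehlerDifferential.D K F (g.toMul : F)
  map_zero' := by simp
  map_add' g h := by
    simp only [toMul_add, mul_inv, Units.val_mul, Derivation.leibniz, smul_add, smul_smul]
    rw [add_comm]
    congr 2 <;> field_simp <;> exact Units.inv_mul _

variable {F} in
/-- Regularity of a rational differential at a place: it lies in the module `∑ 𝒪_v d𝒪_v`. -/
def IsRegularAt (v : ValuationSubring F) (η : Ω[F⁄K]) : Prop :=
  η ∈ AddSubgroup.closure {θ | ∃ a ∈ v, ∃ b ∈ v, θ = a • KaehlerDifferential.D K F b}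

variable {F} in
/-- The rank one connection `d + ψ` on the generic point extends to a line bundle
with connection on the whole complete curve. -/
def Extends (ψ : Ω[F⁄K]) : Prop :=
  ∀ v : ValuationSubring F, (∀ a : K, algebraMap K F a ∈ v) →
    ∃ g : Additive Fˣ, IsRegularAt K v (ψ - dlog K F g)

/-- The group of isomorphism classes of line bundles with connection on the complete nonsingular
curve over `K` with function field `F`, under tensor product. -/
def LineConn : AddSubgroup (Ω[F⁄K] ⧸ (dlog K F).range) where
  carrier := {q | ∃ ψ : Ω[F⁄K], Extends K ψ ∧ (ψ : Ω[F⁄K] ⧸ (dlog K F).range) = q}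
  zero_mem' := ⟨0, fun v _ => ⟨0, by
    simp [IsRegularAt]⟩, rfl⟩
  add_mem' := by
    rintro _ _ ⟨ψ, hψ, rfl⟩ ⟨φ, hφ, rfl⟩
    refine ⟨ψ + φ, fun v hv => ?_, rfl⟩
    obtain ⟨g, hg⟩ := hψ v hv
    obtain ⟨h, hh⟩ := hφ v hv
    refine ⟨g + h, ?_⟩
    have := AddSubgroup.add_mem _ hg hh
    rwa [sub_add_sub_comm, ← map_add] at this
  neg_mem' := by
    rintro _ ⟨ψ, hψ, rfl⟩
    refine ⟨-ψ, fun v hv => ?_, rfl⟩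
    obtain ⟨g, hg⟩ := hψ v hv
    refine ⟨-g, ?_⟩
    have := AddSubgroup.neg_mem _ hg
    rwa [neg_sub, sub_eq_neg_add, ← neg_neg (dlog K F g), ← map_neg, ← sub_eq_add_neg] at this

end Moduli

section Point

variable {K : Type*} [Field K]

/-- The curve `y² = 4x³ - g₂x - g₃`, in the coordinates `X = x`, `Y = y/2`. -/
def curve (g₂ g₃ : K) : WeierstrassCurve.Affine K := ⟨0, 0, 0, -g₂ / 4, -g₃ / 4⟩

/-- The function field of `E`, with its functions `x` and `y`. -/
abbrev FunF (g₂ g₃ : K) : Type _ := (curve g₂ g₃).FunctionField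

def xF (g₂ g₃ : K) : FunF g₂ g₃ :=
  algebraMap (curve g₂ g₃).CoordinateRing _
    (WeierstrassCurve.Affine.CoordinateRing.mk (curve g₂ g₃) (Polynomial.C Polynomial.X))

def yF (g₂ g₃ : K) : FunF g₂ g₃ :=
  2 * algebraMap (curve g₂ g₃).CoordinateRing _
    (WeierstrassCurve.Affine.CoordinateRing.mk (curve g₂ g₃) Polynomial.X)

/-- The group `E^♯(K)` of isomorphism classes of line bundles of degree zero with connection
on the elliptic curve `E : y² = 4x³ - g₂x - g₃` over `K`. -/
abbrev ESharp (g₂ g₃ : K) := LineConn K (FunF g₂ g₃)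

/-- The connection on `𝒪(P - 0)` attached to `P = (a, b)` and `c`, expressed in the rational
section `1`: the differential `σ(-, P) + c ω = ((y + b)/(x - a) · 1/2 + c) dx/y`. -/
def connForm {F : Type*} [Field F] [Algebra K F] (x y : F) (a b c : K) : Ω[F⁄K] :=
  (((y + algebraMap K F b) / (2 * (x - algebraMap K F a)) + algebraMap K F c) * y⁻¹) •
    KaehlerDifferential.D K F x

end Point

section Membership

variable {K F : Type*} [Field K] [Field F] [Algebra K F]

theorem IsRegularAt.smul {v : ValuationSubring F} {η : Ω[F⁄K]} (h : IsRegularAt K v η) {a : F}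
    (ha : a ∈ v) : IsRegularAt K v (a • η) := by
  refine AddSubgroup.closure_induction (p := fun η _ => IsRegularAt K v (a • η)) ?_ ?_ ?_ ?_ h
  · rintro _ ⟨b, hb, t, ht, rfl⟩
    exact AddSubgroup.subset_closure ⟨a * b, mul_mem ha hb, t, ht, smul_smul _ _ _⟩
  · rw [smul_zero]; exact AddSubgroup.zero_mem _
  · intro p q _ _ hp hq
    rw [smul_add]; exact AddSubgroup.add_mem _ hp hq
  · intro p _ hp
    rw [smul_neg]; exact AddSubgroup.neg_mem _ hp

theorem isRegularAt_smul_D {v : ValuationSubring F} {a b : F} (ha : a ∈ v) (hb : b ∈ v) :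
    IsRegularAt K v (a • KaehlerDifferential.D K F b) :=
  AddSubgroup.subset_closure ⟨a, ha, b, hb, rfl⟩

theorem val_const {v : ValuationSubring F} (hv : ∀ a : K, algebraMap K F a ∈ v) {a : K}
    (ha : a ≠ 0) : v.valuation (algebraMap K F a) = 1 := by
  apply le_antisymm ((v.valuation_le_one_iff _).2 (hv a))
  have h := (v.valuation_le_one_iff _).2 (hv a⁻¹)
  rw [map_inv₀, map_inv₀] at h
  exact (inv_le_one₀ (by
    rw [zero_lt_iff, Valuation.ne_zero_iff]; simpa using ha)).1 h

theorem inv_mem_of_val {v : ValuationSubring F} {t : F} (h : v.valuation t = 1) : t⁻¹ ∈ v := by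
  rw [← v.valuation_le_one_iff, map_inv₀, h, inv_one]

theorem val_mul_lt {v : ValuationSubring F} {s t : F} (hs : v.valuation s < 1) (ht : t ∈ v) :
    v.valuation (s * t) < 1 := by
  rw [map_mul]
  exact mul_lt_one_of_lt_of_le hs ((v.valuation_le_one_iff _).2 ht)

theorem val_add_unit {v : ValuationSubring F} {s t : F} (hs : v.valuation s = 1)
    (ht : v.valuation t < 1) : v.valuation (s + t) = 1 := by
  rw [Valuation.map_add_eq_of_lt_left _ (hs ▸ ht), hs]

theorem mem_of_sq_mem {v : ValuationSubring F} {t : F} (h : t ^ 2 ∈ v) : t ∈ v := by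
  rw [← v.valuation_le_one_iff] at h ⊢
  rw [map_pow] at h
  exact (pow_le_one_iff two_ne_zero).1 h

theorem extends_connForm [CharZero K] {x y : F} {a b : K} (c : K) {g₂ g₃ : K}
    (hxy : y ^ 2 = 4 * x ^ 3 - algebraMap K F g₂ * x - algebraMap K F g₃)
    (hab : b ^ 2 = 4 * a ^ 3 - g₂ * a - g₃) (hΔ : g₂ ^ 3 - 27 * g₃ ^ 2 ≠ 0)
    (hxa : x ≠ algebraMap K F a) (hy : y ≠ 0) : Extends K (connForm x y a b c) := by
  have : CharZero F := charZero_of_injective_algebraMap (algebraMap K F).injective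
  intro v hv
  set A := algebraMap K F a with hA
  set B := algebraMap K F b with hB
  set C := algebraMap K F c with hC
  set G₂ := algebraMap K F g₂ with hG₂
  set G₃ := algebraMap K F g₃ with hG₃
  have hAv : A ∈ v := hv a
  have hBv : B ∈ v := hv b
  have hCv : C ∈ v := hv c
  have hG₂v : G₂ ∈ v := hv g₂
  have hG₃v : G₃ ∈ v := hv g₃
  have hn : ∀ n : ℕ, (n : F) ∈ v := fun n => natCast_mem v n
  have h2i : (2 : F)⁻¹ ∈ v := by
    have := hv (2⁻¹); rwa [map_inv₀, map_ofNat] at this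
  have h2 : (2 : F) ∈ v := hn 2
  have h4 : (4 : F) ∈ v := hn 4
  have hAB : B ^ 2 = 4 * A ^ 3 - G₂ * A - G₃ := by
    have := congrArg (algebraMap K F) hab
    simpa only [map_sub, map_mul, map_pow, map_ofNat] using this
  have hxA : x - A ≠ 0 := sub_ne_zero.2 hxa
  set q : F := 6 * x ^ 2 - G₂ / 2 with hq
  set ω : Ω[F⁄K] := y⁻¹ • KaehlerDifferential.D K F x with hω
  have hDx : KaehlerDifferential.D K F x = y • ω := by
    rw [hω, smul_smul, mul_inv_cancel₀ hy, one_smul]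
  have hDy : KaehlerDifferential.D K F y = q • ω := by
    have h := congrArg (KaehlerDifferential.D K F) hxy
    have d4 : KaehlerDifferential.D K F (4 : F) = 0 := (KaehlerDifferential.D K F).map_natCast 4
    simp only [map_sub, Derivation.leibniz, Derivation.leibniz_pow, d4, hG₂, hG₃,
      Derivation.map_algebraMap, smul_zero, add_zero, sub_zero] at h
    rw [hDx] at h
    have h' : (2 * y) • KaehlerDifferential.D K F y = (2 * y) • (q • ω) := by
      have e1 : (2 * y) • KaehlerDifferential.D K F y
          = 2 • y ^ (2 - 1) • KaehlerDifferential.D K F y := by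
        rw [← Nat.cast_smul_eq_nsmul F, smul_smul]; norm_num
      rw [e1, h]
      simp only [← Nat.cast_smul_eq_nsmul F, smul_smul, ← sub_smul]
      congr 1
      rw [hq]; push_cast; ring
    exact smul_right_injective _ (mul_ne_zero two_ne_zero hy) h'
  have hψ : connForm x y a b c = ((y + B) / (2 * (x - A)) + C) • ω := by
    rw [connForm, hω, smul_smul]
  have hdisc : v.valuation (G₂ ^ 3 - 27 * G₃ ^ 2) = 1 := by
    have := val_const hv hΔ
    simpa only [map_sub, map_mul, map_pow, map_ofNat] using this
  -- it suffices to exhibit the coefficient of `ω`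
  have key : IsRegularAt K v ω → ∀ (g : Fˣ) (r h : F), KaehlerDifferential.D K F (g : F) = r • ω →
      h ∈ v → (y + B) / (2 * (x - A)) + C - (g : F)⁻¹ * r = h →
      ∃ g : Additive Fˣ, IsRegularAt K v (connForm x y a b c - dlog K F g) := by
    intro hreg g r h hg hh e
    refine ⟨Additive.ofMul g, ?_⟩
    have : connForm x y a b c - dlog K F (Additive.ofMul g) = h • ω := by
      rw [hψ, ← e, sub_smul]
      congr 1
      change ((g⁻¹ : Fˣ) : F) • KaehlerDifferential.D K F (g : F) = _
      rw [hg, smul_smul, Units.val_inv_eq_inv_val]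
    rw [this]
    exact hreg.smul hh
  have D1 : KaehlerDifferential.D K F ((1 : Fˣ) : F) = (0 : F) • ω := by simp
  by_cases hxv : x ∈ v
  · have hyv : y ∈ v := mem_of_sq_mem (by
      rw [hxy]
      exact sub_mem (sub_mem (mul_mem h4 (pow_mem hxv 3)) (mul_mem hG₂v hxv)) hG₃v)
    have hqv : q ∈ v := by
      rw [hq, div_eq_mul_inv]
      exact sub_mem (mul_mem (hn 6) (pow_mem hxv 2)) (mul_mem hG₂v h2i)
    have hreg : IsRegularAt K v ω := by
      rcases ((v.valuation_le_one_iff _).2 hyv).eq_or_lt with h1 | h1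
      · exact isRegularAt_smul_D (inv_mem_of_val h1) hxv
      rcases ((v.valuation_le_one_iff _).2 hqv).eq_or_lt with h3 | h3
      · have hq0 : q ≠ 0 := by
          rintro h0; rw [h0, map_zero] at h3; exact zero_ne_one h3
        have : ω = q⁻¹ • KaehlerDifferential.D K F y := by
          rw [hDy, smul_smul, inv_mul_cancel₀ hq0, one_smul]
        rw [this]
        exact isRegularAt_smul_D (inv_mem_of_val h3) hyv
      · exfalso
        have e : G₂ ^ 3 - 27 * G₃ ^ 2 = q * (2 * (3 * (2 * G₂ * x - 3 * G₃) * x - G₂ ^ 2))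
            + y * (-(9 * (2 * G₂ * x - 3 * G₃) * y)) := by
          rw [hq]; linear_combination 9 * (2 * G₂ * x - 3 * G₃) * hxy
        have hl : 2 * G₂ * x - 3 * G₃ ∈ v :=
          sub_mem (mul_mem (mul_mem h2 hG₂v) hxv) (mul_mem (hn 3) hG₃v)
        have := v.valuation.map_add_lt
          (val_mul_lt h3 (mul_mem h2 (sub_mem (mul_mem (mul_mem (hn 3) hl) hxv) (pow_mem hG₂v 2))))
          (val_mul_lt h1 (neg_mem (mul_mem (mul_mem (hn 9) hl) hyv)))
        push_cast at this
        rw [← e, hdisc] at this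
        exact lt_irrefl _ this
    set R : F := 4 * (x ^ 2 + x * A + A ^ 2) - G₂ with hR
    have hRv : R ∈ v := sub_mem (mul_mem h4
      (add_mem (add_mem (pow_mem hxv 2) (mul_mem hxv hAv)) (pow_mem hAv 2))) hG₂v
    have hprod : (y - B) * (y + B) = (x - A) * R := by
      rw [hR]; linear_combination hxy - hAB
    rcases ((v.valuation_le_one_iff _).2 (sub_mem hxv hAv)).eq_or_lt with h1 | h1
    · refine key hreg 1 0 ((y + B) * (2⁻¹ * (x - A)⁻¹) + C) D1 ?_ ?_
      · exact add_mem (mul_mem (add_mem hyv hBv) (mul_mem h2i (inv_mem_of_val h1))) hCv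
      · rw [div_eq_mul_inv, mul_inv]; ring
    by_cases hb : b = 0
    · have hB0 : B = 0 := by rw [hB, hb, map_zero]
      have hRval : v.valuation R = 1 := by
        have h0 : 12 * a ^ 2 - g₂ ≠ 0 := by
          intro h0
          apply hΔ
          rw [hb] at hab
          linear_combination (3 * (2 * g₂ * a - 3 * g₃) * a - g₂ ^ 2) * h0
            + 9 * (2 * g₂ * a - 3 * g₃) * hab
        have h5 := val_const hv h0
        have e : R = algebraMap K F (12 * a ^ 2 - g₂) + (x - A) * (4 * (x + 2 * A)) := by
          simp only [map_sub, map_mul, map_pow, map_ofNat]; rw [hR]; ring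
        rw [e]
        exact val_add_unit h5 (val_mul_lt h1 (mul_mem h4 (add_mem hxv (mul_mem h2 hAv))))
      have hR0 : R ≠ 0 := by
        rintro h0; rw [h0, map_zero] at hRval; exact zero_ne_one hRval
      refine key hreg (Units.mk0 y hy) q (-(2 * (2 * x + A) * y * R⁻¹) + C) hDy ?_ ?_
      · exact add_mem (neg_mem (mul_mem (mul_mem (mul_mem h2 (add_mem (mul_mem h2 hxv) hAv)) hyv)
          (inv_mem_of_val hRval))) hCv
      · rw [hB0] at hprod ⊢
        have hp : y ^ 2 = (x - A) * R := by linear_combination hprod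
        have hqR : q = R / 2 + 2 * (x - A) * (2 * x + A) := by rw [hq, hR]; ring
        rw [Units.val_mk0]
        have e1 : (y + 0) / (2 * (x - A)) = R / (2 * y) := by
          rw [div_eq_div_iff (by simp [hxA]) (by simp [hy])]; linear_combination 2 * hp
        have e2 : (x - A) * y⁻¹ = y * R⁻¹ := by
          field_simp; linear_combination -hp
        rw [e1, hqR]
        have e3 : R / (2 * y) = R / 2 * y⁻¹ := by field_simp
        rw [e3]
        linear_combination (-2 * (2 * x + A)) * e2
    · have hBval : v.valuation (2 * B) = 1 := by
        have := val_const hv (mul_ne_zero two_ne_zero hb : 2 * b ≠ 0)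
        simpa only [map_mul, map_ofNat] using this
      rcases ((v.valuation_le_one_iff _).2 (sub_mem hyv hBv)).eq_or_lt with h3 | h3
      · have hyB : y - B ≠ 0 := by
          rintro h0; rw [h0, map_zero] at h3; exact zero_ne_one h3
        refine key hreg 1 0 (R * (2⁻¹ * (y - B)⁻¹) + C) D1 ?_ ?_
        · exact add_mem (mul_mem hRv (mul_mem h2i (inv_mem_of_val h3))) hCv
        · have e1 : (y + B) / (2 * (x - A)) = R * (2⁻¹ * (y - B)⁻¹) := by
            rw [← mul_inv, ← div_eq_mul_inv, div_eq_div_iff (by simp [hxA]) (by simp [hyB])]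
            linear_combination 2 * hprod
          rw [e1]; ring
      · have h4' : v.valuation (y + B) = 1 := by
          have : y + B = 2 * B + (y - B) := by ring
          rw [this]; exact val_add_unit hBval h3
        have hyB : y + B ≠ 0 := by
          rintro h0; rw [h0, map_zero] at h4'; exact zero_ne_one h4'
        refine key hreg (Units.mk0 (x - A) hxA) y (-(R * (2⁻¹ * (y + B)⁻¹)) + C) ?_ ?_ ?_
        · rw [Units.val_mk0, map_sub, hA, Derivation.map_algebraMap, sub_zero, hDx]
        · exact add_mem (neg_mem (mul_mem hRv (mul_mem h2i (inv_mem_of_val h4')))) hCv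
        · rw [Units.val_mk0]
          have e1 : (y - B) / (2 * (x - A)) = R * (2⁻¹ * (y + B)⁻¹) := by
            rw [← mul_inv, ← div_eq_mul_inv, div_eq_div_iff (by simp [hxA]) (by simp [hyB])]
            linear_combination 2 * hprod
          rw [← e1]
          field_simp; ring
  · have hx0 : x ≠ 0 := by rintro rfl; exact hxv (zero_mem v)
    set s : F := x⁻¹ with hs
    have hxs : x * s = 1 := mul_inv_cancel₀ hx0
    have hsx : s ≠ 0 := inv_ne_zero hx0
    have hsval : v.valuation s < 1 := by
      rw [hs, map_inv₀]
      apply inv_lt_one_of_one_lt₀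
      rw [← not_le, v.valuation_le_one_iff]; exact hxv
    have hsv : s ∈ v := (v.valuation_le_one_iff _).1 hsval.le
    set M : F := 4 - G₂ * s ^ 2 - G₃ * s ^ 3 with hM
    set N : F := 2 + G₂ / 2 * s ^ 2 + G₃ * s ^ 3 with hN
    set T : F := 1 - A * s with hT
    have hG₂2 : G₂ / 2 ∈ v := by rw [div_eq_mul_inv]; exact mul_mem hG₂v h2i
    have hMval : v.valuation M = 1 := by
      have e : M = algebraMap K F 4 + s * (-(G₂ * s) - G₃ * s ^ 2) := by
        rw [hM, map_ofNat]; ring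
      rw [e]
      exact val_add_unit (val_const hv (by norm_num : (4 : K) ≠ 0)) (val_mul_lt hsval
        (sub_mem (neg_mem (mul_mem hG₂v hsv)) (mul_mem hG₃v (pow_mem hsv 2))))
    have hNval : v.valuation N = 1 := by
      have e : N = algebraMap K F 2 + s * (G₂ / 2 * s + G₃ * s ^ 2) := by
        rw [hN, map_ofNat]; ring
      rw [e]
      exact val_add_unit (val_const hv two_ne_zero) (val_mul_lt hsval
        (add_mem (mul_mem hG₂2 hsv) (mul_mem hG₃v (pow_mem hsv 2))))
    have hTval : v.valuation T = 1 := by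
      have e : T = 1 + s * (-A) := by rw [hT]; ring
      rw [e]
      exact val_add_unit (map_one _) (val_mul_lt hsval (neg_mem hAv))
    have hM0 : M ≠ 0 := by rintro h0; rw [h0, map_zero] at hMval; exact zero_ne_one hMval
    have hN0 : N ≠ 0 := by rintro h0; rw [h0, map_zero] at hNval; exact zero_ne_one hNval
    have hT0 : T ≠ 0 := by rintro h0; rw [h0, map_zero] at hTval; exact zero_ne_one hTval
    have hyM : y ^ 2 * s ^ 3 = M := by
      rw [hxy, hM]
      linear_combination (4 * (x ^ 2 * s ^ 2 + x * s + 1) - G₂ * s ^ 2) * hxs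
    have huv : x * y⁻¹ ∈ v := mem_of_sq_mem (by
      have e : (x * y⁻¹) ^ 2 = s * M⁻¹ := by
        rw [← hyM, hs]; field_simp
      rw [e]; exact mul_mem hsv (inv_mem_of_val hMval))
    have hysv : y * s ^ 2 ∈ v := mem_of_sq_mem (by
      have e : (y * s ^ 2) ^ 2 = s * M := by rw [← hyM]; ring
      rw [e]; exact mul_mem hsv ((v.valuation_le_one_iff _).1 hMval.le))
    have hqN : (y ^ 2 - x * q) * s ^ 3 = -N := by
      rw [hxy, hq, hN]
      linear_combination (-2 * (x ^ 2 * s ^ 2 + x * s + 1) - G₂ / 2 * s ^ 2) * hxs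
    have hqN' : y ^ 2 - x * q = -N * M⁻¹ * y ^ 2 := by
      have h3 : s ^ 3 ≠ 0 := pow_ne_zero 3 hsx
      apply mul_right_cancel₀ h3
      rw [hqN, mul_assoc _ (y ^ 2), hyM]; field_simp
    have hDu : KaehlerDifferential.D K F (x * y⁻¹) = (-N * M⁻¹) • ω := by
      rw [Derivation.leibniz, Derivation.leibniz_inv, hDx, hDy]
      simp only [smul_smul, ← add_smul]
      congr 1
      field_simp
      have := hqN'
      field_simp at this
      linear_combination this
    have hDg : KaehlerDifferential.D K F (y * x⁻¹) = (y ^ 2 * s ^ 2 * N * M⁻¹) • ω := by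
      rw [Derivation.leibniz, Derivation.leibniz_inv, hDx, hDy]
      simp only [smul_smul, ← add_smul]
      congr 1
      rw [← hs]
      have e : s * q = x * q * s ^ 2 := by linear_combination -(s * q) * hxs
      linear_combination e - s ^ 2 * hqN'
    have hreg : IsRegularAt K v ω := by
      have : ω = (-(N⁻¹ * M)) • KaehlerDifferential.D K F (x * y⁻¹) := by
        rw [hDu, smul_smul]
        rw [show -(N⁻¹ * M) * (-N * M⁻¹) = 1 by field_simp, one_smul]
      rw [this]
      exact isRegularAt_smul_D (neg_mem (mul_mem (inv_mem_of_val hNval)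
        ((v.valuation_le_one_iff _).1 hMval.le))) huv
    have hTi := inv_mem_of_val hTval
    have hMi := inv_mem_of_val hMval
    refine key hreg (Units.mk0 (y * x⁻¹) (mul_ne_zero hy hsx)) _
      (B * s * (2⁻¹ * T⁻¹) + C + y * s ^ 2 *
        (4 * A - 2 * G₂ * s - (3 * G₃ - A * G₂) * s ^ 2 + 2 * A * G₃ * s ^ 3) *
          (2⁻¹ * T⁻¹ * M⁻¹)) hDg ?_ ?_
    · refine add_mem (add_mem (mul_mem (mul_mem hBv hsv) (mul_mem h2i hTi)) hCv)
        (mul_mem (mul_mem hysv ?_) (mul_mem (mul_mem h2i hTi) hMi))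
      refine add_mem (sub_mem (sub_mem (mul_mem h4 hAv) (mul_mem (mul_mem h2 hG₂v) hsv))
        (mul_mem (sub_mem (mul_mem (hn 3) hG₃v) (mul_mem hAv hG₂v)) (pow_mem hsv 2)))
        (mul_mem (mul_mem (mul_mem h2 hAv) hG₃v) (pow_mem hsv 3))
    · rw [Units.val_mk0, ← hs]
      have e1 : (y + B) / (2 * (x - A)) = (y + B) * s * (2⁻¹ * T⁻¹) := by
        rw [← mul_inv, ← div_eq_mul_inv, div_eq_div_iff (by simp [hxA]) (by simp [hT0]), hT]
        linear_combination -2 * (y + B) * hxs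
      have e2 : (y * s)⁻¹ * (y ^ 2 * s ^ 2 * N * M⁻¹) = y * s * (N * M⁻¹) := by
        field_simp
      have e3 : s * (4 * A - 2 * G₂ * s - (3 * G₃ - A * G₂) * s ^ 2 + 2 * A * G₃ * s ^ 3)
          = M - 2 * T * N := by rw [hM, hT, hN]; ring
      have e4 : 2⁻¹ * T⁻¹ - N * M⁻¹ = (M - 2 * T * N) * (2⁻¹ * T⁻¹ * M⁻¹) := by field_simp
      rw [e1, e2]
      linear_combination y * s * e4 - y * s * (2⁻¹ * T⁻¹ * M⁻¹) * e3

end Membership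

section STilde

open Polynomial in
theorem xF_aeval_ne {K : Type*} [Field K] (g₂ g₃ : K) {p : K[X]} (hp : p ≠ 0) :
    aeval (xF g₂ g₃) p ≠ 0 := by
  have h : aeval (xF g₂ g₃) p = algebraMap (curve g₂ g₃).CoordinateRing _
      (algebraMap K[X] (curve g₂ g₃).CoordinateRing p) := by
    have hx : xF g₂ g₃ = algebraMap (curve g₂ g₃).CoordinateRing (FunF g₂ g₃)
      (algebraMap K[X] (curve g₂ g₃).CoordinateRing X) := rfl
    rw [hx, Polynomial.aeval_algebraMap_apply, Polynomial.aeval_algebraMap_apply, aeval_X_left_apply]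
  rw [h]
  intro h0
  have h1 := (FaithfulSMul.algebraMap_injective (curve g₂ g₃).CoordinateRing (FunF g₂ g₃))
    (h0.trans (map_zero _).symm)
  exact hp ((FaithfulSMul.algebraMap_injective K[X] (curve g₂ g₃).CoordinateRing)
    (h1.trans (map_zero _).symm))

theorem xF_ne {K : Type*} [Field K] (g₂ g₃ a : K) : xF g₂ g₃ ≠ algebraMap K _ a := by
  have h := xF_aeval_ne g₂ g₃ (Polynomial.X_sub_C_ne_zero a)
  simpa [sub_eq_zero] using h

theorem xyF_eq {K : Type*} [Field K] [CharZero K] (g₂ g₃ : K) :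
    yF g₂ g₃ ^ 2 = 4 * xF g₂ g₃ ^ 3 - algebraMap K _ g₂ * xF g₂ g₃ - algebraMap K _ g₃ := by
  have key : ∀ ρ : Polynomial (Polynomial K) →+* FunF g₂ g₃, ρ (curve g₂ g₃).polynomial = 0 →
      (2 * ρ Polynomial.X) ^ 2 = 4 * ρ (Polynomial.C Polynomial.X) ^ 3
        - ρ (Polynomial.C (Polynomial.C g₂)) * ρ (Polynomial.C Polynomial.X)
        - ρ (Polynomial.C (Polynomial.C g₃)) := by
    intro ρ h
    have e : (curve g₂ g₃).polynomial * 4 = (2 * Polynomial.X) ^ 2 -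
        (4 * Polynomial.C Polynomial.X ^ 3
          - Polynomial.C (Polynomial.C g₂) * Polynomial.C Polynomial.X
          - Polynomial.C (Polynomial.C g₃)) := by
      have c4 : ∀ t : K, (Polynomial.C (Polynomial.C (-t / 4)) : Polynomial (Polynomial K)) * 4
          = - Polynomial.C (Polynomial.C t) := by
        intro t
        rw [show (4 : Polynomial (Polynomial K)) = Polynomial.C (Polynomial.C 4) by
          simp only [map_ofNat], ← map_mul, ← map_mul, ← map_neg, ← map_neg]
        congr 2; field_simp
      have e0 : (curve g₂ g₃).polynomial = Polynomial.X ^ 2 - (Polynomial.C Polynomial.X ^ 3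
          + Polynomial.C (Polynomial.C (-g₂ / 4)) * Polynomial.C Polynomial.X
          + Polynomial.C (Polynomial.C (-g₃ / 4))) := by
        simp [WeierstrassCurve.Affine.polynomial, curve]
      rw [e0]
      linear_combination -Polynomial.C Polynomial.X * c4 g₂ - c4 g₃
    have e' := congrArg ρ e
    rw [map_mul, h, zero_mul] at e'
    simp only [map_sub, map_mul, map_pow, map_ofNat] at e'
    linear_combination -e'
  exact key ((algebraMap (curve g₂ g₃).CoordinateRing (FunF g₂ g₃)).comp
    (WeierstrassCurve.Affine.CoordinateRing.mk (curve g₂ g₃)))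
    (by rw [RingHom.comp_apply, WeierstrassCurve.Affine.CoordinateRing.mk, AdjoinRoot.mk_self,
      map_zero])

theorem yF_ne {K : Type*} [Field K] [CharZero K] (g₂ g₃ : K) : yF g₂ g₃ ≠ 0 := by
  intro h0
  have h := xyF_eq g₂ g₃
  have hp : (4 * Polynomial.X ^ 3 - Polynomial.C g₂ * Polynomial.X - Polynomial.C g₃ :
      Polynomial K) ≠ 0 := by
    intro h
    have := congrArg (fun p => Polynomial.coeff p 3) h
    simp [Polynomial.coeff_ofNat_mul] at this
  apply xF_aeval_ne g₂ g₃ hp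
  rw [h0] at h
  simp only [map_sub, map_mul, map_pow, map_ofNat, Polynomial.aeval_X, Polynomial.aeval_C]
  rw [← h]; ring

variable {𝕜 : Type u} [Field 𝕜] [CharZero 𝕜] {g₂ g₃ : 𝕜}

/-- The map `(E^♯ ∖ π⁻¹(0))(K) → E^♯(K)`: a `K`-point `φ` of `Spec 𝒜`, given by `P = (a, b)` and
`c`, is sent to the class of `𝒪(P - 0)` with the connection given by `σ(-, P) + c ω`. -/
def sTilde (hE : g₂ ^ 3 - 27 * g₃ ^ 2 ≠ 0) {K : Type*} [Field K] [Algebra 𝕜 K]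
    (φ : CalA g₂ g₃ →ₐ[𝕜] K) : ESharp (algebraMap 𝕜 K g₂) (algebraMap 𝕜 K g₃) :=
  ⟨(connForm (xF (algebraMap 𝕜 K g₂) (algebraMap 𝕜 K g₃))
      (yF (algebraMap 𝕜 K g₂) (algebraMap 𝕜 K g₃))
      (φ (xA g₂ g₃)) (φ (yA g₂ g₃)) (φ (cA g₂ g₃)) :
      Ω[FunF (algebraMap 𝕜 K g₂) (algebraMap 𝕜 K g₃)⁄K]),
    ⟨_, by
      have : CharZero K := charZero_of_injective_algebraMap (algebraMap 𝕜 K).injective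
      refine extends_connForm _ (xyF_eq _ _) (hom_curve_eq φ) ?_ (xF_ne _ _ _) (yF_ne _ _)
      have h := (map_ne_zero (algebraMap 𝕜 K)).2 hE
      simpa only [map_sub, map_mul, map_pow, map_ofNat] using h, rfl⟩⟩

end STilde

end FayAlg
end

/-!
The Fay identity is a statement about three points `P₁`, `P₂`, `P₃ = P₁ + P₂` of `E^♯` with values
in a `𝕜`-algebra `B`. `IsSum` records such a triple by the equations of a chord, the half slope `b`
of which need not be a quotient in `B`; so one theorem, `fay_polar`, covers `(E^♯)²` and `(E^♯)ⁿ`.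

Write `f_P` for the value of the generating series at `P`, and `Λ_P(w)` for the logarithmic
derivative of `exp(c w) f_P(w)`. The series `Λ` satisfies `(∂/∂w - ∂) Λ = ℘(w) - x`, and this
transport equation shows that it is the half slope
`Λ_P(w) = (℘'(w) - y) / (2 (℘(w) - x))` (`slopeSeries_mul`): with `(℘, ℘')(w)` as tautological
point, the series `f_P` is the solution of a first order linear equation with algebraic coefficients.
As solutions of such equations are unique, the chord relations give the two product formulas
`f_{P₁}(w) f_{P₂}(w) = -(Λ_{P₃}(w) + b) f_{P₃}(w)` (`genAt_mul_genAt_of_isSum`) and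
`f_P(z) f_P(z') = -(Λ(z, z') + Λ_P(z + z')) f_P(z + z')` (`genAt_mul_genAt_of_isChord`), where
`Λ(z, z')` is the half slope of the tautological points at `z` and `z'`; the latter uses the addition
theorem for `℘` (`exists_isChord_wp`). If the three products in the Fay identity are expressed by
these formulas, there remains the relation `three_term_slopes` between half slopes of points on a
cubic.

All series in two variables are handled by restriction to the lines `z = n z'`, with integers
`n ≥ 2`: in characteristic zero a power series that vanishes on these lines is zero
(`eq_zero_of_lineEval`), and on a line everything is a power series in one variable, where `z d/dz`
is the Euler derivation `euler`.

For the group law, the sum of the connection forms of `P₁` and `P₂` minus that of `P₃` is the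
logarithmic derivative of the quotient of the equation of the chord by that of the vertical line
through `P₃` (`connForm_add_connForm`), and the bundles of `P` and `-P` are inverse to each other by
`x - x_P` (`connForm_add_connForm_neg`). On `(E^♯)ⁿ`, the point `e_i - e_k` is the sum of
`e_i - e_j` and `e_j - e_k` already over the ring generated by the three slopes, since the slope of
the latter two is a combination of these slopes (`isSum_of_differences`).
-/

noncomputable section

namespace FayAlg

/-! ### The Euler derivation on power series -/

section Euler

variable {B : Type*} [CommRing B]

/-- The derivation `w d/dw` of `B⟦w⟧`; it multiplies the coefficient of `wⁿ` by `n`. -/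
def euler (B : Type*) [CommRing B] : Derivation B (PowerSeries B) (PowerSeries B) :=
  (PowerSeries.X : PowerSeries B) • PowerSeries.derivative B

theorem euler_apply (f : PowerSeries B) :
    euler B f = PowerSeries.X * PowerSeries.derivative B f := rfl

@[simp]
theorem coeff_euler (f : PowerSeries B) (n : ℕ) :
    PowerSeries.coeff n (euler B f) = n * PowerSeries.coeff n f := by
  rw [euler_apply]
  cases n with
  | zero => simp
  | succ n =>
    rw [PowerSeries.coeff_succ_X_mul, PowerSeries.coeff_derivative]
    push_cast; ring

theorem euler_X : euler B PowerSeries.X = PowerSeries.X := by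
  rw [euler_apply, PowerSeries.derivative_X, mul_one]

theorem euler_C (b : B) : euler B (PowerSeries.C b) = 0 := by
  rw [euler_apply, PowerSeries.derivative_C, mul_zero]

theorem euler_C_mul (b : B) (f : PowerSeries B) :
    euler B (PowerSeries.C b * f) = PowerSeries.C b * euler B f := by
  rw [Derivation.leibniz, euler_C, smul_zero, add_zero, smul_eq_mul]

theorem euler_C_mul_X_pow (b : B) (n : ℕ) :
    euler B (PowerSeries.C b * PowerSeries.X ^ n) =
      (n : PowerSeries B) * (PowerSeries.C b * PowerSeries.X ^ n) := by
  rw [euler_C_mul, Derivation.leibniz_pow, euler_X, nsmul_eq_mul, smul_eq_mul]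
  cases n with
  | zero => simp
  | succ n => rw [Nat.add_sub_cancel]; ring

theorem euler_map {A : Type*} [CommRing A] (φ : A →+* B) (f : PowerSeries A) :
    euler B (PowerSeries.map φ f) = PowerSeries.map φ (euler A f) := by
  ext n; simp

theorem euler_rescale (e : B) (f : PowerSeries B) :
    euler B (PowerSeries.rescale e f) = PowerSeries.rescale e (euler B f) := by
  ext n; simp only [coeff_euler, PowerSeries.coeff_rescale]; ring

theorem isUnit_of_constantCoeff_algebraMap {𝕜 : Type*} [Field 𝕜] [Algebra 𝕜 B]
    {f : PowerSeries B} {a : 𝕜} (ha : a ≠ 0)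
    (h : PowerSeries.constantCoeff f = algebraMap 𝕜 B a) : IsUnit f := by
  rw [PowerSeries.isUnit_iff_constantCoeff, h]
  exact (IsUnit.mk0 a ha).map _

theorem isUnit_natCast (𝕜 : Type*) [Field 𝕜] [CharZero 𝕜] [Algebra 𝕜 B] {n : ℕ} (hn : n ≠ 0) :
    IsUnit (n : B) := by
  have := (IsUnit.mk0 (n : 𝕜) (Nat.cast_ne_zero.2 hn)).map (algebraMap 𝕜 B)
  simpa only [map_natCast] using this

/-- A solution of the linear equation `w f' = h f` with `h(0) = 0` is determined by `f(0)`. -/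
theorem eq_zero_of_euler_eq (𝕜 : Type*) [Field 𝕜] [CharZero 𝕜] [Algebra 𝕜 B]
    {f h : PowerSeries B} (hf : euler B f = h * f)
    (h0 : PowerSeries.constantCoeff h = 0) (f0 : PowerSeries.constantCoeff f = 0) : f = 0 := by
  ext n
  rw [map_zero]
  induction n using Nat.strong_induction_on with
  | _ n ih =>
    rcases Nat.eq_zero_or_pos n with rfl | hn
    · rwa [PowerSeries.coeff_zero_eq_constantCoeff_apply]
    have e := congrArg (PowerSeries.coeff n) hf
    rw [coeff_euler, PowerSeries.coeff_mul, Finset.sum_eq_zero] at e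
    · exact (isUnit_natCast 𝕜 hn.ne').mul_left_cancel (by rw [e, mul_zero])
    · rintro ⟨i, j⟩ hij
      replace hij : i + j = n := Finset.HasAntidiagonal.mem_antidiagonal.1 hij
      rcases Nat.eq_zero_or_pos i with rfl | hi
      · simp [PowerSeries.coeff_zero_eq_constantCoeff_apply, h0]
      · rw [ih j (by omega), mul_zero]

/-- The equation `w f' = h f` has only the zero solution if `h(0) = -1`. -/
theorem eq_zero_of_euler_eq_of_neg_one (𝕜 : Type*) [Field 𝕜] [CharZero 𝕜] [Algebra 𝕜 B]
    {f h : PowerSeries B} (hf : euler B f = h * f)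
    (h0 : PowerSeries.constantCoeff h = -1) : f = 0 := by
  have key : PowerSeries.X * f = 0 := by
    refine eq_zero_of_euler_eq 𝕜 (h := h + 1) ?_ (by simp [h0]) (by simp)
    rw [Derivation.leibniz, euler_X, hf, smul_eq_mul, smul_eq_mul]; ring
  ext n
  have := congrArg (PowerSeries.coeff (n + 1)) key
  simpa only [PowerSeries.coeff_succ_X_mul, map_zero] using this

end Euler

/-! ### The Weierstrass function -/

section Weierstrass

variable {𝕜 : Type u} [Field 𝕜] (g₂ g₃ : 𝕜)

/-- The power series `w² ℘(w)`. -/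
def wpSeries : PowerSeries 𝕜 := 1 + PowerSeries.X ^ 2 * PowerSeries.mk (wpCoeff g₂ g₃)

/-- The power series `w³ ℘'(w)`. -/
def wpSeries' : PowerSeries 𝕜 := euler 𝕜 (wpSeries g₂ g₃) - 2 * wpSeries g₂ g₃

theorem euler_wpSeries :
    euler 𝕜 (wpSeries g₂ g₃) = 2 * wpSeries g₂ g₃ + wpSeries' g₂ g₃ := by
  rw [wpSeries']; ring

theorem coeff_zero_wpSeries : PowerSeries.coeff 0 (wpSeries g₂ g₃) = 1 := by
  simp [wpSeries]

theorem coeff_one_wpSeries : PowerSeries.coeff 1 (wpSeries g₂ g₃) = 0 := by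
  simp [wpSeries, PowerSeries.coeff_one, PowerSeries.coeff_X_pow_mul']

theorem coeff_add_two_wpSeries (n : ℕ) :
    PowerSeries.coeff (n + 2) (wpSeries g₂ g₃) = wpCoeff g₂ g₃ n := by
  simp [wpSeries, PowerSeries.coeff_one, PowerSeries.coeff_X_pow_mul]

theorem coeff_wpSeries' (n : ℕ) : PowerSeries.coeff n (wpSeries' g₂ g₃) =
    (n - 2) * PowerSeries.coeff n (wpSeries g₂ g₃) := by
  rw [wpSeries', map_sub, coeff_euler,
    show (2 : PowerSeries 𝕜) = PowerSeries.C 2 from (map_ofNat _ 2).symm, PowerSeries.coeff_C_mul]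
  ring

theorem wpCoeff_zero : wpCoeff g₂ g₃ 0 = 0 := by rw [wpCoeff]
theorem wpCoeff_one : wpCoeff g₂ g₃ 1 = 0 := by rw [wpCoeff]
theorem wpCoeff_two : wpCoeff g₂ g₃ 2 = g₂ / 20 := by rw [wpCoeff]
theorem wpCoeff_three : wpCoeff g₂ g₃ 3 = 0 := by rw [wpCoeff]
theorem wpCoeff_four : wpCoeff g₂ g₃ 4 = g₃ / 28 := by rw [wpCoeff]

theorem wpCoeff_rec [CharZero 𝕜] (n : ℕ) :
    ((n : 𝕜) + 1) * (n + 8) * wpCoeff g₂ g₃ (n + 5) =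
      6 * PowerSeries.coeff (n + 3) (PowerSeries.mk (wpCoeff g₂ g₃) ^ 2) := by
  have h1 : ((n : 𝕜) + 1) ≠ 0 := by exact_mod_cast n.succ_ne_zero
  have h8 : ((n : 𝕜) + 8) ≠ 0 := by exact_mod_cast (n + 7).succ_ne_zero
  rw [wpCoeff, sq, PowerSeries.coeff_mul, Finset.Nat.sum_antidiagonal_eq_sum_range_succ_mk,
    Finset.sum_range]
  simp only [PowerSeries.coeff_mk]
  field_simp

/-- The differential equation `℘'' = 6 ℘² - g₂ / 2`. -/
theorem euler_wpSeries' [CharZero 𝕜] : 2 * euler 𝕜 (wpSeries' g₂ g₃) =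
    6 * wpSeries' g₂ g₃ + 12 * wpSeries g₂ g₃ ^ 2 - PowerSeries.C g₂ * PowerSeries.X ^ 4 := by
  have c : ∀ (n m : ℕ) [m.AtLeastTwo] (f : PowerSeries 𝕜),
      PowerSeries.coeff n ((OfNat.ofNat m : PowerSeries 𝕜) * f) =
        OfNat.ofNat m * PowerSeries.coeff n f := by
    intro n m _ f
    rw [← map_ofNat (PowerSeries.C (R := 𝕜)) m, PowerSeries.coeff_C_mul]
  have hsq : wpSeries g₂ g₃ ^ 2 = 2 * wpSeries g₂ g₃ - 1 +
      PowerSeries.X ^ 4 * PowerSeries.mk (wpCoeff g₂ g₃) ^ 2 := by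
    rw [wpSeries]; ring
  rw [hsq]
  ext n
  simp only [map_sub, map_add, c, coeff_euler, coeff_wpSeries', PowerSeries.coeff_one,
    PowerSeries.coeff_C_mul, PowerSeries.coeff_X_pow, PowerSeries.coeff_X_pow_mul']
  match n with
  | 0 => simp [coeff_zero_wpSeries, -PowerSeries.coeff_zero_eq_constantCoeff]; norm_num
  | 1 => simp [coeff_one_wpSeries]
  | 2 => simp [coeff_add_two_wpSeries, wpCoeff_zero]
  | 3 => simp [coeff_add_two_wpSeries, wpCoeff_one]
  | 4 =>
    simp [coeff_add_two_wpSeries, wpCoeff_two, wpCoeff_zero]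
    ring
  | 5 =>
    simp [coeff_add_two_wpSeries, wpCoeff_three, wpCoeff_zero, wpCoeff_one, sq,
      PowerSeries.coeff_mul, Finset.Nat.antidiagonal_succ]
  | 6 =>
    simp [coeff_add_two_wpSeries, wpCoeff_four, wpCoeff_zero, wpCoeff_one, sq,
      PowerSeries.coeff_mul, Finset.Nat.antidiagonal_succ]
    ring
  | n + 7 =>
    have h := wpCoeff_rec g₂ g₃ n
    rw [show n + 7 = n + 5 + 2 from rfl, coeff_add_two_wpSeries]
    rw [if_neg (by omega), if_pos (by omega), if_neg (by omega),
      show n + 5 + 2 - 4 = n + 3 by omega]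
    push_cast
    linear_combination 2 * h

/-- The differential equation `℘'² = 4 ℘³ - g₂ ℘ - g₃`. -/
theorem wpSeries'_sq [CharZero 𝕜] : wpSeries' g₂ g₃ ^ 2 = 4 * wpSeries g₂ g₃ ^ 3 -
    PowerSeries.C g₂ * PowerSeries.X ^ 4 * wpSeries g₂ g₃ -
      PowerSeries.C g₃ * PowerSeries.X ^ 6 := by
  set Q := wpSeries g₂ g₃ with hQ
  set Q' := wpSeries' g₂ g₃ with hQ'
  set W := Q' ^ 2 - 4 * Q ^ 3 + PowerSeries.C g₂ * PowerSeries.X ^ 4 * Q +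
    PowerSeries.C g₃ * PowerSeries.X ^ 6 with hW
  suffices W = 0 by linear_combination this
  have hE : euler 𝕜 W = 6 * W := by
    have h1 : euler 𝕜 Q = 2 * Q + Q' := euler_wpSeries g₂ g₃
    have h2 : 2 * euler 𝕜 Q' = _ := euler_wpSeries' g₂ g₃
    have h4 : euler 𝕜 (4 : PowerSeries 𝕜) = 0 := (euler 𝕜).map_natCast 4
    rw [hW, map_add, map_add, map_sub, Derivation.leibniz_pow, Derivation.leibniz,
      Derivation.leibniz_pow, Derivation.leibniz, euler_C_mul_X_pow, euler_C_mul_X_pow, h1, h4]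
    simp only [smul_eq_mul, nsmul_eq_mul]
    push_cast
    linear_combination Q' * h2
  ext n
  rw [map_zero]
  have hn := congrArg (PowerSeries.coeff n) hE
  rw [coeff_euler, show (6 : PowerSeries 𝕜) = PowerSeries.C 6 from (map_ofNat _ 6).symm,
    PowerSeries.coeff_C_mul] at hn
  -- `W` is homogeneous of weight six, so that only its coefficient of `w⁶` needs to be computed
  by_cases h6 : n = 6
  · subst h6
    obtain ⟨R, hR⟩ : ∃ R, Q = 1 + PowerSeries.C (g₂ / 20) * PowerSeries.X ^ 4 +
        PowerSeries.C (g₃ / 28) * PowerSeries.X ^ 6 + PowerSeries.X ^ 7 * R := by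
      refine ⟨PowerSeries.mk fun n => wpCoeff g₂ g₃ (n + 5), ?_⟩
      ext n
      simp only [map_add, PowerSeries.coeff_one, PowerSeries.coeff_C_mul, PowerSeries.coeff_X_pow,
        PowerSeries.coeff_X_pow_mul']
      match n with
      | 0 => simp [hQ, coeff_zero_wpSeries, -PowerSeries.coeff_zero_eq_constantCoeff]
      | 1 => simp [hQ, coeff_one_wpSeries]
      | 2 => simp [hQ, coeff_add_two_wpSeries, wpCoeff_zero]
      | 3 => simp [hQ, coeff_add_two_wpSeries, wpCoeff_one]
      | 4 => simp [hQ, coeff_add_two_wpSeries, wpCoeff_two]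
      | 5 => simp [hQ, coeff_add_two_wpSeries, wpCoeff_three]
      | 6 => simp [hQ, coeff_add_two_wpSeries, wpCoeff_four]
      | n + 7 =>
        rw [hQ, show n + 7 = n + 5 + 2 from rfl, coeff_add_two_wpSeries]
        simp [show n + 5 + 2 - 7 = n by omega]
    obtain ⟨R', hR'⟩ : ∃ R', Q' = -2 + 2 * PowerSeries.C (g₂ / 20) * PowerSeries.X ^ 4 +
        4 * PowerSeries.C (g₃ / 28) * PowerSeries.X ^ 6 + PowerSeries.X ^ 7 * R' := by
      refine ⟨5 * R + euler 𝕜 R, ?_⟩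
      rw [hQ', wpSeries', ← hQ, hR, map_add, map_add, map_add, euler_C_mul_X_pow,
        euler_C_mul_X_pow, Derivation.leibniz, Derivation.leibniz_pow, euler_X,
        Derivation.map_one_eq_zero]
      simp only [smul_eq_mul, nsmul_eq_mul]
      push_cast; ring
    have c3 : PowerSeries.C g₂ = 20 * PowerSeries.C (g₂ / 20) := by
      rw [← map_ofNat (PowerSeries.C (R := 𝕜)) 20, ← map_mul]; congr 1; ring
    have c4 : PowerSeries.C g₃ = 28 * PowerSeries.C (g₃ / 28) := by
      rw [← map_ofNat (PowerSeries.C (R := 𝕜)) 28, ← map_mul]; congr 1; ring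
    obtain ⟨V, hV⟩ : ∃ V, W = PowerSeries.X ^ 7 * V := by
      rw [hW, hR, hR', c3, c4]
      generalize PowerSeries.C (g₂ / 20) = G
      generalize PowerSeries.C (g₃ / 28) = H
      generalize (PowerSeries.X : PowerSeries 𝕜) = T
      exact ⟨-4 * R' - 12 * R + T * ((2 * G + 4 * H * T ^ 2 + T ^ 3 * R') ^ 2 -
        12 * (G + H * T ^ 2 + T ^ 3 * R) ^ 2 - 4 * T ^ 4 * (G + H * T ^ 2 + T ^ 3 * R) ^ 3 +
        20 * G * (G + H * T ^ 2 + T ^ 3 * R)), by ring⟩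
    rw [hV, PowerSeries.coeff_X_pow_mul', if_neg (by omega)]
  · have h7 : ((n : 𝕜) - 6) ≠ 0 := sub_ne_zero.2 (by exact_mod_cast h6)
    exact (mul_eq_zero.1 (by linear_combination hn : ((n : 𝕜) - 6) * _ = 0)).resolve_left h7

end Weierstrass

/-! ### The generating series as solution of a differential equation -/

section Expansion

/-- The derivation of `A⟦w⟧` that applies a derivation of `A` to each coefficient. -/
def coeffwiseDer {𝕜 A : Type*} [CommRing 𝕜] [CommRing A] [Algebra 𝕜 A] (D : Derivation 𝕜 A A) :
    Derivation 𝕜 (PowerSeries A) (PowerSeries A) :=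
  Derivation.mk'
    { toFun := fun f => PowerSeries.mk fun n => D (PowerSeries.coeff n f)
      map_add' := fun f g => by ext n; simp
      map_smul' := fun a f => by ext n; simp }
    (by
      intro f g
      ext n
      simp only [LinearMap.coe_mk, AddHom.coe_mk, PowerSeries.coeff_mk, smul_eq_mul, map_add,
        PowerSeries.coeff_mul, map_sum, Derivation.leibniz, Finset.sum_add_distrib]
      congr 1
      exact Finset.sum_nbij' Prod.swap Prod.swap (by simp [add_comm]) (by simp [add_comm])
        (by simp) (by simp) (by simp))

@[simp]
theorem coeff_coeffwiseDer {𝕜 A : Type*} [CommRing 𝕜] [CommRing A] [Algebra 𝕜 A]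
    (D : Derivation 𝕜 A A) (f : PowerSeries A) (n : ℕ) :
    PowerSeries.coeff n (coeffwiseDer D f) = D (PowerSeries.coeff n f) :=
  PowerSeries.coeff_mk n fun n => D (PowerSeries.coeff n f)

/-- The substitution into a series over `𝕜` agrees with that into the series over `A`; the chain
rule is available for the latter. -/
theorem exp_subst_eq {𝕜 A : Type*} [Field 𝕜] [CharZero 𝕜] [CommRing A] [Algebra 𝕜 A]
    {g : PowerSeries A} (hg : PowerSeries.HasSubst g) : (PowerSeries.exp 𝕜).subst g =
      (PowerSeries.map (algebraMap 𝕜 A) (PowerSeries.exp 𝕜)).subst g := by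
  rw [PowerSeries.map_algebraMap_eq_subst_X, PowerSeries.subst_comp_subst_apply
    PowerSeries.HasSubst.X' hg, PowerSeries.subst_X hg]

theorem euler_exp_subst {𝕜 A : Type*} [Field 𝕜] [CharZero 𝕜] [CommRing A] [Algebra 𝕜 A]
    {g : PowerSeries A} (hg : PowerSeries.HasSubst g) : euler A ((PowerSeries.exp 𝕜).subst g) =
      (PowerSeries.exp 𝕜).subst g * euler A g := by
  have hd : PowerSeries.derivative A (PowerSeries.map (algebraMap 𝕜 A) (PowerSeries.exp 𝕜)) =
      PowerSeries.map (algebraMap 𝕜 A) (PowerSeries.exp 𝕜) := by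
    ext n
    have := congrArg (algebraMap 𝕜 A) (congrArg (PowerSeries.coeff n)
      (PowerSeries.derivative_exp 𝕜))
    rw [PowerSeries.coeff_derivative] at this ⊢
    simpa only [PowerSeries.coeff_map, map_mul, map_add, map_natCast, map_one] using this
  rw [exp_subst_eq hg, euler_apply, PowerSeries.derivative_subst hg, hd, euler_apply]
  ring

theorem constantCoeff_exp_subst {𝕜 A : Type*} [Field 𝕜] [CharZero 𝕜] [CommRing A] [Algebra 𝕜 A]
    {g : PowerSeries A} (hg : PowerSeries.constantCoeff g = 0) :
    PowerSeries.constantCoeff ((PowerSeries.exp 𝕜).subst g) = 1 := by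
  have hs := PowerSeries.HasSubst.of_constantCoeff_zero' hg
  have h : (PowerSeries.exp 𝕜).subst g =
      (PowerSeries.exp 𝕜 - 1).subst g + (1 : PowerSeries 𝕜).subst g := by
    rw [← PowerSeries.subst_add hs, sub_add_cancel]
  have h1 : (1 : PowerSeries 𝕜).subst g = 1 := by
    rw [← PowerSeries.coe_substAlgHom hs, map_one]
  have h2 : PowerSeries.constantCoeff ((PowerSeries.exp 𝕜 - 1).subst g) = 0 :=
    PowerSeries.constantCoeff_subst_eq_zero hg _ (by simp)
  rw [h, map_add, h2, h1, map_one, zero_add]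

variable {𝕜 : Type u} [Field 𝕜] [CharZero 𝕜] (g₂ g₃ : 𝕜)

theorem constantCoeff_thetaUnit : PowerSeries.constantCoeff (thetaUnit g₂ g₃) = 1 :=
  constantCoeff_exp_subst (by
    rw [map_neg, ← PowerSeries.coeff_zero_eq_constantCoeff_apply, thetaLog, PowerSeries.coeff_mk,
      neg_zero])

theorem euler_inv_thetaUnit : euler 𝕜 (thetaUnit g₂ g₃)⁻¹ =
    (thetaUnit g₂ g₃)⁻¹ * euler 𝕜 (thetaLog g₂ g₃) := by
  have hs : PowerSeries.HasSubst (-thetaLog g₂ g₃) :=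
    PowerSeries.HasSubst.of_constantCoeff_zero' (by
      rw [map_neg, ← PowerSeries.coeff_zero_eq_constantCoeff_apply, thetaLog,
        PowerSeries.coeff_mk, neg_zero])
  have h1 : (thetaUnit g₂ g₃)⁻¹ * thetaUnit g₂ g₃ = 1 :=
    PowerSeries.inv_mul_cancel _ (by rw [constantCoeff_thetaUnit]; exact one_ne_zero)
  have h2 : euler 𝕜 (thetaUnit g₂ g₃) = thetaUnit g₂ g₃ * euler 𝕜 (-thetaLog g₂ g₃) :=
    euler_exp_subst hs
  rw [euler_apply, PowerSeries.derivative_inv']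
  rw [map_neg, euler_apply] at h2
  linear_combination (-(thetaUnit g₂ g₃)⁻¹ ^ 2) * h2 +
    ((thetaUnit g₂ g₃)⁻¹ * euler 𝕜 (thetaLog g₂ g₃)) * h1

/-- The power series `w f(w)` over `𝒜`. -/
def genSeries : PowerSeries (CalA g₂ g₃) :=
  PowerSeries.map (algebraMap 𝕜 (CalA g₂ g₃)) (thetaUnit g₂ g₃)⁻¹ *
    (PowerSeries.exp 𝕜).subst (fExponent g₂ g₃)

theorem constantCoeff_fExponent : PowerSeries.constantCoeff (fExponent g₂ g₃) = 0 := by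
  rw [← PowerSeries.coeff_zero_eq_constantCoeff_apply, fExponent, PowerSeries.coeff_mk]

theorem constantCoeff_genSeries : PowerSeries.constantCoeff (genSeries g₂ g₃) = 1 := by
  rw [genSeries, map_mul, constantCoeff_exp_subst (constantCoeff_fExponent g₂ g₃), mul_one,
    ← PowerSeries.coeff_zero_eq_constantCoeff_apply, PowerSeries.coeff_map,
    PowerSeries.coeff_zero_eq_constantCoeff_apply, PowerSeries.constantCoeff_inv,
    constantCoeff_thetaUnit, inv_one, map_one]

/-- The power series `w Λ(w)` over `𝒜`, where
`Λ = -1/w + ∑ a_n w^{n+1} / (n+1) - ∑ ∂ⁿ(x) w^{n+1} / (n+1)!` is the logarithmic derivative of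
`exp(c w) f(w)`. -/
def slopeSeries : PowerSeries (CalA g₂ g₃) :=
  euler (CalA g₂ g₃) (fExponent g₂ g₃ + PowerSeries.map (algebraMap 𝕜 _) (thetaLog g₂ g₃)) +
    PowerSeries.C (cA g₂ g₃) * PowerSeries.X - 1

theorem euler_genSeries : euler _ (genSeries g₂ g₃) =
    (1 + slopeSeries g₂ g₃ - PowerSeries.C (cA g₂ g₃) * PowerSeries.X) * genSeries g₂ g₃ := by
  rw [genSeries, Derivation.leibniz, euler_exp_subst (PowerSeries.HasSubst.of_constantCoeff_zero'
    (constantCoeff_fExponent g₂ g₃)), euler_map, euler_inv_thetaUnit, slopeSeries, map_add,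
    euler_map, map_mul]
  simp only [smul_eq_mul]
  ring

theorem coeff_zero_slopeSeries : PowerSeries.coeff 0 (slopeSeries g₂ g₃) = -1 := by
  rw [slopeSeries, map_sub, map_add, coeff_euler]
  simp

theorem coeff_one_slopeSeries : PowerSeries.coeff 1 (slopeSeries g₂ g₃) = 0 := by
  rw [slopeSeries, map_sub, map_add, coeff_euler, map_add, PowerSeries.coeff_map, fExponent,
    thetaLog, PowerSeries.coeff_mk, PowerSeries.coeff_mk]
  simp [PowerSeries.coeff_one]

theorem coeff_add_two_slopeSeries (n : ℕ) : PowerSeries.coeff (n + 2) (slopeSeries g₂ g₃) =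
    (1 / ((n : 𝕜) + 1)) • algebraMap 𝕜 (CalA g₂ g₃) (wpCoeff g₂ g₃ n) -
      (1 / ((n + 1).factorial : 𝕜)) • ((der g₂ g₃)^[n] (xA g₂ g₃)) := by
  rw [slopeSeries, map_sub, map_add, coeff_euler, map_add, PowerSeries.coeff_map, fExponent,
    thetaLog, PowerSeries.coeff_mk, PowerSeries.coeff_mk, PowerSeries.coeff_C_mul,
    PowerSeries.coeff_X, PowerSeries.coeff_one, if_neg (by omega), if_neg (by omega)]
  have h1 : ((n : 𝕜) + 1) ≠ 0 := by exact_mod_cast n.succ_ne_zero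
  have h2 : ((n : 𝕜) + 2) ≠ 0 := by exact_mod_cast (n + 1).succ_ne_zero
  have h3 : ((n + 1).factorial : 𝕜) ≠ 0 := by exact_mod_cast (n + 1).factorial_ne_zero
  rw [mul_zero, add_zero, sub_zero, mul_add, ← map_natCast (algebraMap 𝕜 (CalA g₂ g₃)),
    ← Algebra.smul_def, ← Algebra.smul_def, smul_neg, smul_smul, neg_add_eq_sub,
    Algebra.smul_def, ← map_mul, Algebra.smul_def (1 / ((n : 𝕜) + 1)), ← map_mul]
  congr 2
  · change ((n + 2 : ℕ) : 𝕜) * (wpCoeff g₂ g₃ n / (((n : 𝕜) + 1) * ((n : 𝕜) + 2))) = _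
    push_cast; field_simp
  · rw [Nat.factorial_succ (n + 1)]
    push_cast
    rw [add_assoc, one_add_one_eq_two]
    field_simp

theorem der_mkA (p : MvPolynomial (Fin 3) 𝕜) :
    der g₂ g₃ (mkA g₂ g₃ p) = mkA g₂ g₃ (polyDer g₂ p) := by
  rw [der]
  exact Derivation.liftOfSurjective_apply (mkA_surjective g₂ g₃) _ p

theorem der_xA : der g₂ g₃ (xA g₂ g₃) = yA g₂ g₃ := by
  have h : polyDer g₂ (MvPolynomial.X 0) = MvPolynomial.X 1 := by simp [polyDer]
  rw [xA, der_mkA, h, yA]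

theorem der_yA : 2 * der g₂ g₃ (yA g₂ g₃) = 12 * xA g₂ g₃ ^ 2 - algebraMap 𝕜 _ g₂ := by
  have h : polyDer g₂ (MvPolynomial.X 1) = 6 * MvPolynomial.X 0 ^ 2 - MvPolynomial.C (g₂ / 2) := by
    simp [polyDer]
  have h' : der g₂ g₃ (yA g₂ g₃) = 6 * xA g₂ g₃ ^ 2 - algebraMap 𝕜 _ (g₂ / 2) := by
    rw [yA, der_mkA, h]
    simp only [map_sub, map_mul, map_pow, map_ofNat, MvPolynomial.algHom_C, xA]
  have h2 : algebraMap 𝕜 (CalA g₂ g₃) g₂ = 2 * algebraMap 𝕜 _ (g₂ / 2) := by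
    rw [← map_ofNat (algebraMap 𝕜 (CalA g₂ g₃)) 2, ← map_mul]; congr 1; ring
  rw [h', h2]; ring

/-- `(∂/∂w - ∂) Λ = ℘(w) - x`, multiplied by `w²`. -/
theorem transport_slopeSeries :
    euler _ (slopeSeries g₂ g₃) - slopeSeries g₂ g₃ -
      PowerSeries.X * coeffwiseDer (der g₂ g₃) (slopeSeries g₂ g₃) =
    PowerSeries.map (algebraMap 𝕜 _) (wpSeries g₂ g₃) -
      PowerSeries.C (xA g₂ g₃) * PowerSeries.X ^ 2 := by
  ext n
  match n with
  | 0 =>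
    rw [map_sub, map_sub, map_sub, coeff_euler, coeff_zero_slopeSeries, PowerSeries.coeff_map,
      coeff_zero_wpSeries]
    simp
  | 1 =>
    rw [map_sub, map_sub, map_sub, coeff_euler, coeff_one_slopeSeries, PowerSeries.coeff_map,
      coeff_one_wpSeries, show (1 : ℕ) = 0 + 1 from rfl, PowerSeries.coeff_succ_X_mul,
      coeff_coeffwiseDer, coeff_zero_slopeSeries]
    simp [PowerSeries.coeff_X_pow]
  | n + 2 =>
    rw [map_sub, map_sub, map_sub, coeff_euler, PowerSeries.coeff_map, coeff_add_two_wpSeries,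
      coeff_add_two_slopeSeries, PowerSeries.coeff_C_mul, PowerSeries.coeff_X_pow,
      show n + 2 = n + 1 + 1 from rfl, PowerSeries.coeff_succ_X_mul, coeff_coeffwiseDer]
    have h1 : ((n : 𝕜) + 1) ≠ 0 := by exact_mod_cast n.succ_ne_zero
    have q1 : ((n : CalA g₂ g₃) + 1) * algebraMap 𝕜 _ (1 / ((n : 𝕜) + 1)) = 1 := by
      rw [← map_natCast (algebraMap 𝕜 (CalA g₂ g₃)), ← map_one (algebraMap 𝕜 (CalA g₂ g₃)),
        ← map_add, ← map_mul]
      congr 1; field_simp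
    have q2 : ((n : CalA g₂ g₃) + 1) * algebraMap 𝕜 _ (1 / ((n + 1).factorial : 𝕜)) =
        algebraMap 𝕜 _ (1 / (n.factorial : 𝕜)) := by
      have h3 : (n.factorial : 𝕜) ≠ 0 := by exact_mod_cast n.factorial_ne_zero
      rw [← map_natCast (algebraMap 𝕜 (CalA g₂ g₃)), ← map_one (algebraMap 𝕜 (CalA g₂ g₃)),
        ← map_add, ← map_mul, Nat.factorial_succ]
      congr 1; push_cast; field_simp
    cases n with
    | zero =>
      rw [coeff_one_slopeSeries, map_zero]
      simp [wpCoeff_zero]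
      ring
    | succ n =>
      rw [coeff_add_two_slopeSeries, map_sub, Derivation.map_smul, Derivation.map_smul,
        Derivation.map_algebraMap, ← Function.iterate_succ_apply' (der g₂ g₃)]
      simp only [Algebra.smul_def, if_neg (show ¬ n + 1 + 1 + 1 = 2 by omega)]
      push_cast at q1 q2 ⊢
      simp only [mul_zero, zero_sub, sub_zero]
      linear_combination algebraMap 𝕜 _ (wpCoeff g₂ g₃ (n + 1)) * q1 -
        ((der g₂ g₃)^[n + 1] (xA g₂ g₃)) * q2

/-- If `δ` is a derivation for which `(Q, Q')` and `(x T², y T³)` are solutions of weight `2, 3` of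
the Weierstrass equation with opposite time directions, and `δ h = h + (Q - x T²)`, then the defect
of `2 h (Q - x T²) = Q' - y T³`, divided by `Q - x T²`, is homogeneous of weight one. -/
theorem transport_defect {k R : Type*} [CommRing k] [CommRing R] [Algebra k R]
    (δ : Derivation k R R) (h2 : IsUnit (2 : R))
    {Q Q' x y T h d G K : R} (hU : IsUnit (Q - x * T ^ 2))
    (hQ : δ Q = 2 * Q + Q') (hQ' : 2 * δ Q' = 6 * Q' + 12 * Q ^ 2 - G * T ^ 4)
    (hx : δ x = -(T * y)) (hy : 2 * δ y = -(T * (12 * x ^ 2 - G))) (hT : δ T = T)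
    (hh : δ h = h + (Q - x * T ^ 2))
    (e₁ : Q' ^ 2 = 4 * Q ^ 3 - G * T ^ 4 * Q - K * T ^ 6)
    (e₂ : y ^ 2 = 4 * x ^ 3 - G * x - K)
    (hd : 2 * h * (Q - x * T ^ 2) - (Q' - y * T ^ 3) = d * (Q - x * T ^ 2)) : δ d = d := by
  have t2 : δ 2 = 0 := δ.map_natCast 2
  have e := congrArg δ hd
  simp only [map_sub, Derivation.leibniz, Derivation.leibniz_pow, hQ, hx, hT, hh, t2,
    smul_eq_mul, nsmul_eq_mul, mul_zero, add_zero] at e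
  push_cast at e
  refine (hU.pow 2).mul_left_cancel (h2.mul_left_cancel ?_)
  linear_combination (-2 * (Q - x * T ^ 2)) * e - (Q - x * T ^ 2) * hQ' +
    (Q - x * T ^ 2) * T ^ 3 * hy + 2 * e₁ - 2 * T ^ 6 * e₂ +
    2 * (2 * Q + Q' - (2 * x * T ^ 2 - T ^ 3 * y) + (Q - x * T ^ 2)) * hd

/-- The identity `2 Λ (℘(w) - x) = ℘'(w) - y`, multiplied by `w³`. -/
theorem slopeSeries_mul : 2 * slopeSeries g₂ g₃ *
      (PowerSeries.map (algebraMap 𝕜 _) (wpSeries g₂ g₃) -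
        PowerSeries.C (xA g₂ g₃) * PowerSeries.X ^ 2) =
    PowerSeries.map (algebraMap 𝕜 _) (wpSeries' g₂ g₃) -
      PowerSeries.C (yA g₂ g₃) * PowerSeries.X ^ 3 := by
  set A := CalA g₂ g₃
  set c := coeffwiseDer (der g₂ g₃) with hc
  set E := 2 * slopeSeries g₂ g₃ * (PowerSeries.map (algebraMap 𝕜 A) (wpSeries g₂ g₃) -
        PowerSeries.C (xA g₂ g₃) * PowerSeries.X ^ 2) -
      (PowerSeries.map (algebraMap 𝕜 A) (wpSeries' g₂ g₃) -
        PowerSeries.C (yA g₂ g₃) * PowerSeries.X ^ 3) with hE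
  have hU : IsUnit (PowerSeries.map (algebraMap 𝕜 A) (wpSeries g₂ g₃) -
      PowerSeries.C (xA g₂ g₃) * PowerSeries.X ^ 2) := by
    refine isUnit_of_constantCoeff_algebraMap (one_ne_zero (α := 𝕜)) ?_
    rw [← PowerSeries.coeff_zero_eq_constantCoeff_apply, map_sub, PowerSeries.coeff_map,
      coeff_zero_wpSeries]
    simp
  obtain ⟨V, hV⟩ := hU.exists_right_inv
  set d := E * V with hd
  have hdU : E = d * (PowerSeries.map (algebraMap 𝕜 A) (wpSeries g₂ g₃) -
      PowerSeries.C (xA g₂ g₃) * PowerSeries.X ^ 2) := by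
    rw [hd, mul_right_comm, mul_assoc, hV, mul_one]
  have hcC : ∀ a, c (PowerSeries.C a) = PowerSeries.C (der g₂ g₃ a) := fun a => by
    ext n; rw [hc, coeff_coeffwiseDer, PowerSeries.coeff_C, PowerSeries.coeff_C]
    split_ifs <;> simp
  have hcX : c PowerSeries.X = 0 := by
    ext n; rw [hc, coeff_coeffwiseDer, PowerSeries.coeff_X]; split_ifs <;> simp
  have hcm : ∀ f : PowerSeries 𝕜, c (PowerSeries.map (algebraMap 𝕜 A) f) = 0 := fun f => by
    ext n; rw [hc, coeff_coeffwiseDer, PowerSeries.coeff_map, Derivation.map_algebraMap, map_zero]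
  -- the derivation `w ∂/∂w - w ∂`
  let δ : Derivation 𝕜 (PowerSeries A) (PowerSeries A) :=
    (euler A).restrictScalars 𝕜 - (PowerSeries.X : PowerSeries A) • c
  have hδ : ∀ f, δ f = euler A f - PowerSeries.X * c f := fun _ => rfl
  have key : δ d = d := by
    refine transport_defect δ (isUnit_two 𝕜 _) (Q' := PowerSeries.map (algebraMap 𝕜 A)
      (wpSeries' g₂ g₃)) (y := PowerSeries.C (yA g₂ g₃)) (h := slopeSeries g₂ g₃)
      (G := PowerSeries.C (algebraMap 𝕜 A g₂)) (K := PowerSeries.C (algebraMap 𝕜 A g₃))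
      hU ?_ ?_ ?_ ?_ ?_ ?_ ?_ ?_ hdU
    · rw [hδ, hcm, euler_map, euler_wpSeries, map_add, map_mul, map_ofNat]; ring
    · have := congrArg (PowerSeries.map (algebraMap 𝕜 A)) (euler_wpSeries' g₂ g₃)
      simp only [map_add, map_sub, map_mul, map_pow, map_ofNat, ← euler_map, PowerSeries.map_C,
        PowerSeries.map_X] at this
      rw [hδ, hcm, mul_zero, sub_zero, this]
    · rw [hδ, euler_C, hcC, der_xA, zero_sub]
    · have := congrArg (PowerSeries.C (R := A)) (der_yA g₂ g₃)
      rw [map_sub, map_mul, map_mul, map_pow, map_ofNat, map_ofNat] at this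
      rw [hδ, euler_C, hcC, ← this]; ring
    · rw [hδ, euler_X, hcX, mul_zero, sub_zero]
    · rw [hδ, ← transport_slopeSeries]; ring
    · have := congrArg (PowerSeries.map (algebraMap 𝕜 A)) (wpSeries'_sq g₂ g₃)
      simpa only [map_sub, map_mul, map_pow, map_ofNat, PowerSeries.map_C,
        PowerSeries.map_X] using this
    · have := congrArg (PowerSeries.C (R := A)) (curve_eq g₂ g₃)
      simpa only [map_sub, map_mul, map_pow, map_ofNat] using this
  -- `δ d = d` determines `d` from its coefficients of order at most one
  have hlow : PowerSeries.X ^ 2 ∣ E := by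
    have hm : ∀ f : PowerSeries 𝕜, ∀ n, PowerSeries.coeff n (PowerSeries.map (algebraMap 𝕜 A) f) =
      algebraMap 𝕜 A (PowerSeries.coeff n f) := fun _ _ => rfl
    have h2 : (2 : PowerSeries A) = PowerSeries.C 2 := (map_ofNat _ 2).symm
    rw [PowerSeries.X_pow_dvd_iff]
    intro m hm'
    interval_cases m
    · rw [hE, h2, mul_assoc]
      simp only [map_sub, PowerSeries.coeff_mul,
        Finset.Nat.antidiagonal_zero, Finset.sum_singleton, PowerSeries.coeff_X_pow, hm,
        coeff_zero_slopeSeries, coeff_zero_wpSeries, coeff_wpSeries']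
      norm_num [map_ofNat (algebraMap 𝕜 A) 2]
    · rw [hE, h2, mul_assoc]
      simp only [map_sub, PowerSeries.coeff_C_mul, PowerSeries.coeff_mul (1),
        Finset.Nat.antidiagonal_succ, Finset.Nat.antidiagonal_zero, Finset.sum_cons,
        Finset.sum_singleton, Finset.map_singleton, PowerSeries.coeff_X_pow, hm,
        coeff_zero_slopeSeries, coeff_wpSeries', coeff_one_wpSeries]
      simp [coeff_one_wpSeries, coeff_one_slopeSeries]
  obtain ⟨R, hR⟩ := hlow
  have hd0 : ∀ n < 2, PowerSeries.coeff n d = 0 := fun n hn => by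
    rw [hd, hR, mul_assoc, PowerSeries.coeff_X_pow_mul', if_neg (by omega)]
  suffices d = 0 by rw [this, zero_mul, hE] at hdU; exact sub_eq_zero.1 hdU
  ext n
  rw [map_zero]
  induction n with
  | zero => exact hd0 0 (by omega)
  | succ n ih =>
    have e := congrArg (PowerSeries.coeff (n + 1)) key
    rw [hδ, map_sub, coeff_euler, PowerSeries.coeff_succ_X_mul, hc, coeff_coeffwiseDer,
      ih, map_zero, sub_zero] at e
    cases n with
    | zero => exact hd0 1 (by omega)
    | succ n =>
      refine (isUnit_natCast 𝕜 n.succ_ne_zero).mul_left_cancel ?_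
      push_cast at e ⊢
      linear_combination e

end Expansion

/-! ### Chords of a Weierstrass cubic -/

section Chord

variable {R : Type*} [CommRing R]

/-- `(x₃, y₃)` is the sum of the points `(x₁, y₁)` and `(x₂, y₂)` of the cubic
`y² = 4x³ - Gx - K`, and `2b` is the slope of the line through the two points. The second equation
for the slope makes this meaningful also where `x₁ - x₂` is not invertible. -/
structure IsChord (G x₁ y₁ x₂ y₂ x₃ y₃ b : R) : Prop where
  slope : 2 * b * (x₁ - x₂) = y₁ - y₂
  slope' : 2 * b * (y₁ + y₂) = 4 * (x₁ ^ 2 + x₁ * x₂ + x₂ ^ 2) - G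
  x_eq : x₃ = b ^ 2 - x₁ - x₂
  y_eq : y₃ = -y₁ - 2 * b * (x₃ - x₁)

theorem half_slope_rel {G K x₁ y₁ x₂ y₂ b : R} (e₁ : y₁ ^ 2 = 4 * x₁ ^ 3 - G * x₁ - K)
    (e₂ : y₂ ^ 2 = 4 * x₂ ^ 3 - G * x₂ - K) (hu : IsUnit (x₁ - x₂))
    (h : 2 * b * (x₁ - x₂) = y₁ - y₂) :
    2 * b * (y₁ + y₂) = 4 * (x₁ ^ 2 + x₁ * x₂ + x₂ ^ 2) - G :=
  slope_rel e₁ e₂ hu h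

namespace IsChord

variable {G K x₁ y₁ x₂ y₂ x₃ y₃ b : R}

theorem symm (h : IsChord G x₁ y₁ x₂ y₂ x₃ y₃ b) : IsChord G x₂ y₂ x₁ y₁ x₃ y₃ b where
  slope := by linear_combination -h.slope
  slope' := by linear_combination h.slope'
  x_eq := by rw [h.x_eq]; ring
  y_eq := by linear_combination h.y_eq + h.slope

theorem map (h : IsChord G x₁ y₁ x₂ y₂ x₃ y₃ b) {S : Type*} [CommRing S] (f : R →+* S) :
    IsChord (f G) (f x₁) (f y₁) (f x₂) (f y₂) (f x₃) (f y₃) (f b) where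
  slope := by simpa only [map_mul, map_sub, map_ofNat] using congrArg f h.slope
  slope' := by
    simpa only [map_mul, map_sub, map_add, map_pow, map_ofNat] using congrArg f h.slope'
  x_eq := by simpa only [map_sub, map_pow] using congrArg f h.x_eq
  y_eq := by simpa only [map_mul, map_sub, map_neg, map_ofNat] using congrArg f h.y_eq

theorem curve (h : IsChord G x₁ y₁ x₂ y₂ x₃ y₃ b)
    (e₁ : y₁ ^ 2 = 4 * x₁ ^ 3 - G * x₁ - K) : y₃ ^ 2 = 4 * x₃ ^ 3 - G * x₃ - K := by
  rw [h.y_eq, h.x_eq]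
  linear_combination (4 * x₁ * b + 2 * x₂ * b - 2 * b ^ 3) * h.slope +
    (b ^ 2 - 2 * x₁ - x₂) * h.slope' + e₁

/-- The product of the line through the two points with its conjugate is the cubic with the roots
`x₁, x₂, x₃`. -/
theorem mul_eq (h : IsChord G x₁ y₁ x₂ y₂ x₃ y₃ b)
    (e₁ : y₁ ^ 2 = 4 * x₁ ^ 3 - G * x₁ - K) {x y : R} (e : y ^ 2 = 4 * x ^ 3 - G * x - K) :
    (y - y₃ + 2 * b * (x - x₃)) * (y - y₁ - 2 * b * (x - x₁)) =
      4 * (x - x₁) * (x - x₂) * (x - x₃) := by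
  rw [h.y_eq, h.x_eq]
  linear_combination e - e₁ + (2 * b * x - 2 * x₁ * b) * h.slope + (x₁ - x) * h.slope'

end IsChord

/-- The derivative of a half slope `α` of two points that move along the cubic with the speeds
`s₁, s₂`, in coordinates in which `x, y, α` have the weights `2, 3, 1`. -/
theorem derivation_half_slope {k : Type*} [CommRing k] [Algebra k R] (δ : Derivation k R R)
    (h2 : IsUnit (2 : R)) {G K x₁ y₁ x₂ y₂ α s₁ s₂ : R} (hu : IsUnit (x₁ - x₂))
    (e₁ : y₁ ^ 2 = 4 * x₁ ^ 3 - G * x₁ - K) (e₂ : y₂ ^ 2 = 4 * x₂ ^ 3 - G * x₂ - K)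
    (hα : 2 * α * (x₁ - x₂) = y₁ - y₂)
    (hx₁ : δ x₁ = 2 * x₁ + s₁ * y₁) (hx₂ : δ x₂ = 2 * x₂ + s₂ * y₂)
    (hy₁ : 2 * δ y₁ = 6 * y₁ + s₁ * (12 * x₁ ^ 2 - G))
    (hy₂ : 2 * δ y₂ = 6 * y₂ + s₂ * (12 * x₂ ^ 2 - G)) :
    δ α = α + s₁ * (2 * x₁ + x₂ - α ^ 2) + s₂ * (2 * x₂ + x₁ - α ^ 2) := by
  have hα' := half_slope_rel e₁ e₂ hu hα
  have t2 : δ 2 = 0 := δ.map_natCast 2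
  have e := congrArg δ hα
  simp only [map_sub, Derivation.leibniz, t2, smul_eq_mul, mul_zero, add_zero, hx₁, hx₂] at e
  refine hu.mul_left_cancel (h2.mul_left_cancel (h2.mul_left_cancel ?_))
  linear_combination 2 * e + hy₁ - hy₂ - 6 * hα + s₁ * (2 * α * hα - hα') + s₂ * (2 * α * hα + hα')

end Chord

/-! ### The tautological points and the addition theorem -/

section Tautological

variable {𝕜 : Type u} [Field 𝕜] (g₂ g₃ : 𝕜)

/-- The power series `T² ℘(eT)`. -/
def wpX (e : 𝕜) : PowerSeries 𝕜 :=
  PowerSeries.C (e⁻¹ ^ 2) * PowerSeries.rescale e (wpSeries g₂ g₃)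

/-- The power series `T³ ℘'(eT)`. -/
def wpY (e : 𝕜) : PowerSeries 𝕜 :=
  PowerSeries.C (e⁻¹ ^ 3) * PowerSeries.rescale e (wpSeries' g₂ g₃)

theorem constantCoeff_wpX (e : 𝕜) : PowerSeries.constantCoeff (wpX g₂ g₃ e) = e⁻¹ ^ 2 := by
  rw [wpX, ← PowerSeries.coeff_zero_eq_constantCoeff_apply, PowerSeries.coeff_C_mul,
    PowerSeries.coeff_rescale, coeff_zero_wpSeries]
  ring

theorem constantCoeff_wpY (e : 𝕜) : PowerSeries.constantCoeff (wpY g₂ g₃ e) = -2 * e⁻¹ ^ 3 := by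
  rw [wpY, ← PowerSeries.coeff_zero_eq_constantCoeff_apply, PowerSeries.coeff_C_mul,
    PowerSeries.coeff_rescale, coeff_wpSeries', coeff_zero_wpSeries]
  push_cast; ring

theorem euler_wpX {e : 𝕜} (he : e ≠ 0) :
    euler 𝕜 (wpX g₂ g₃ e) = 2 * wpX g₂ g₃ e + PowerSeries.C e * wpY g₂ g₃ e := by
  have : PowerSeries.C e * PowerSeries.C (e⁻¹ ^ 3) = PowerSeries.C (e⁻¹ ^ 2) := by
    rw [← map_mul]; congr 1; field_simp
  rw [wpX, wpY, euler_C_mul, euler_rescale, euler_wpSeries, map_add, map_mul, map_ofNat, ← this]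
  ring

theorem wpY_sq [CharZero 𝕜] {e : 𝕜} (he : e ≠ 0) : wpY g₂ g₃ e ^ 2 = 4 * wpX g₂ g₃ e ^ 3 -
    PowerSeries.C g₂ * PowerSeries.X ^ 4 * wpX g₂ g₃ e - PowerSeries.C g₃ * PowerSeries.X ^ 6 := by
  have h := congrArg (PowerSeries.rescale e) (wpSeries'_sq g₂ g₃)
  have hC : ∀ a : 𝕜, PowerSeries.rescale e (PowerSeries.C a) = PowerSeries.C a := fun a => by
    ext n; rw [PowerSeries.coeff_rescale, PowerSeries.coeff_C]; split_ifs with h <;> simp [h]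
  simp only [map_sub, map_mul, map_pow, map_ofNat, hC, PowerSeries.rescale_X] at h
  have e1 : PowerSeries.C e * PowerSeries.C e⁻¹ = 1 := by
    rw [← map_mul, mul_inv_cancel₀ he, map_one]
  rw [wpX, wpY, map_pow, map_pow]
  generalize PowerSeries.C e⁻¹ = v at *
  generalize PowerSeries.C e = w at *
  have e4 : w ^ 4 * v ^ 4 = 1 := by rw [← mul_pow, e1, one_pow]
  have e6 : w ^ 6 * v ^ 6 = 1 := by rw [← mul_pow, e1, one_pow]
  linear_combination v ^ 6 * h - PowerSeries.C g₂ * PowerSeries.X ^ 4 * v ^ 2 *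
    PowerSeries.rescale e (wpSeries g₂ g₃) * e4 - PowerSeries.C g₃ * PowerSeries.X ^ 6 * e6

theorem euler_wpY [CharZero 𝕜] {e : 𝕜} (he : e ≠ 0) : 2 * euler 𝕜 (wpY g₂ g₃ e) =
    6 * wpY g₂ g₃ e + PowerSeries.C e * (12 * wpX g₂ g₃ e ^ 2 -
      PowerSeries.C g₂ * PowerSeries.X ^ 4) := by
  have h := congrArg (PowerSeries.rescale e) (euler_wpSeries' g₂ g₃)
  have hC : ∀ a : 𝕜, PowerSeries.rescale e (PowerSeries.C a) = PowerSeries.C a := fun a => by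
    ext n; rw [PowerSeries.coeff_rescale, PowerSeries.coeff_C]; split_ifs with h <;> simp [h]
  simp only [map_sub, map_add, map_mul, map_pow, map_ofNat, hC, PowerSeries.rescale_X] at h
  have e1 : PowerSeries.C e * PowerSeries.C e⁻¹ = 1 := by
    rw [← map_mul, mul_inv_cancel₀ he, map_one]
  rw [wpX, wpY, euler_C_mul, euler_rescale, map_pow, map_pow]
  generalize PowerSeries.C e⁻¹ = v at *
  generalize PowerSeries.C e = w at *
  have e3 : w ^ 3 * v ^ 3 = 1 := by rw [← mul_pow, e1, one_pow]
  linear_combination v ^ 3 * h - 12 * v ^ 3 * PowerSeries.rescale e (wpSeries g₂ g₃) ^ 2 * e1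
    - w * PowerSeries.C g₂ * PowerSeries.X ^ 4 * e3

theorem isUnit_wpX_sub {a b : 𝕜} (h : a ^ 2 ≠ b ^ 2) :
    IsUnit (wpX g₂ g₃ a - wpX g₂ g₃ b) := by
  refine isUnit_of_constantCoeff_algebraMap (𝕜 := 𝕜) (a := a⁻¹ ^ 2 - b⁻¹ ^ 2) ?_ ?_
  · rw [sub_ne_zero, inv_pow, inv_pow, Ne, inv_inj]; exact h
  · rw [map_sub, constantCoeff_wpX, constantCoeff_wpX]; rfl

/-- The solution of the differential equation of `℘` with a double pole is unique. -/
theorem eq_wp_of_euler [CharZero 𝕜] {e : 𝕜} (he : e ≠ 0) {x y : PowerSeries 𝕜}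
    (hxy : y ^ 2 = 4 * x ^ 3 - PowerSeries.C g₂ * PowerSeries.X ^ 4 * x -
      PowerSeries.C g₃ * PowerSeries.X ^ 6)
    (hdx : euler 𝕜 x = 2 * x + PowerSeries.C e * y)
    (hx0 : PowerSeries.constantCoeff x = e⁻¹ ^ 2) : x = wpX g₂ g₃ e ∧ y = wpY g₂ g₃ e := by
  have hy0 : PowerSeries.constantCoeff y = -2 * e⁻¹ ^ 3 := by
    have h0 := congrArg PowerSeries.constantCoeff hdx
    rw [map_add, map_mul, map_mul, map_ofNat, hx0, euler_apply, map_mul,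
      PowerSeries.constantCoeff_X, PowerSeries.constantCoeff_C, zero_mul] at h0
    refine mul_left_cancel₀ he ?_
    linear_combination -h0 + (-2 * e⁻¹ ^ 2) * (mul_inv_cancel₀ he).symm
  have hYu : IsUnit (y + wpY g₂ g₃ e) := by
    refine isUnit_of_constantCoeff_algebraMap (𝕜 := 𝕜) (a := -4 * e⁻¹ ^ 3) ?_ ?_
    · exact mul_ne_zero (by norm_num) (pow_ne_zero _ (inv_ne_zero he))
    · rw [map_add, hy0, constantCoeff_wpY]; change _ = -4 * e⁻¹ ^ 3; ring
  obtain ⟨W, hW⟩ := hYu.exists_right_inv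
  have hW0 : PowerSeries.constantCoeff W * (-4 * e⁻¹ ^ 3) = 1 := by
    have h0 := congrArg PowerSeries.constantCoeff hW
    rw [map_mul, map_add, hy0, constantCoeff_wpY, map_one] at h0
    linear_combination h0
  have hXsq := wpY_sq g₂ g₃ he
  have hXd := euler_wpX g₂ g₃ he
  have hX0 := constantCoeff_wpX g₂ g₃ e
  generalize wpX g₂ g₃ e = x' at *
  generalize wpY g₂ g₃ e = y' at *
  set D := 4 * (x ^ 2 + x * x' + x' ^ 2) - PowerSeries.C g₂ * PowerSeries.X ^ 4 with hD
  have hyW : y - y' = (x - x') * D * W := by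
    linear_combination W * (hxy - hXsq) - (y - y') * hW
  -- `x - x'` solves a linear equation; as `D(0) W(0) = -3 / e`, its coefficient at `0` is `-1`
  have hx_eq : x = x' := by
    refine sub_eq_zero.1 (eq_zero_of_euler_eq_of_neg_one 𝕜 (h := 2 + PowerSeries.C e * D * W) ?_ ?_)
    · rw [map_sub, hdx, hXd]
      linear_combination PowerSeries.C e * hyW
    · have h0 : PowerSeries.constantCoeff D = 12 * (e⁻¹ ^ 2) ^ 2 := by
        rw [hD]
        simp only [map_sub, map_add, map_mul, map_pow, map_ofNat, hx0, hX0,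
          PowerSeries.constantCoeff_X, PowerSeries.constantCoeff_C]
        ring
      rw [map_add, map_mul, map_mul, h0, PowerSeries.constantCoeff_C, map_ofNat]
      linear_combination -3 * hW0 + 12 * e⁻¹ ^ 3 * PowerSeries.constantCoeff W * mul_inv_cancel₀ he
  refine ⟨hx_eq, ?_⟩
  rw [hx_eq, sub_self, zero_mul, zero_mul] at hyW
  exact sub_eq_zero.1 hyW

/-- The addition theorem for `℘`: half the slope of `(℘, ℘')(aT)` and `(℘, ℘')(bT)`, multiplied by
`T`, and their sum. -/
theorem exists_isChord_wp [CharZero 𝕜] {a b : 𝕜} (ha : a ≠ 0) (hb : b ≠ 0) (hab : a + b ≠ 0)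
    (h : a ^ 2 ≠ b ^ 2) : ∃ α : PowerSeries 𝕜,
      IsChord (PowerSeries.C g₂ * PowerSeries.X ^ 4) (wpX g₂ g₃ a) (wpY g₂ g₃ a)
        (wpX g₂ g₃ b) (wpY g₂ g₃ b) (wpX g₂ g₃ (a + b)) (wpY g₂ g₃ (a + b)) α ∧
      PowerSeries.constantCoeff α = (a + b)⁻¹ - a⁻¹ - b⁻¹ := by
  have hu := isUnit_wpX_sub g₂ g₃ h
  have h2 := isUnit_two 𝕜 (PowerSeries 𝕜)
  obtain ⟨V, hV⟩ := (h2.mul hu).exists_right_inv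
  have ea := wpY_sq g₂ g₃ ha
  have eb := wpY_sq g₂ g₃ hb
  have da := euler_wpX g₂ g₃ ha
  have db := euler_wpX g₂ g₃ hb
  have a0 := constantCoeff_wpX g₂ g₃ a
  have b0 := constantCoeff_wpX g₂ g₃ b
  have a1 := constantCoeff_wpY g₂ g₃ a
  have b1 := constantCoeff_wpY g₂ g₃ b
  have da' := euler_wpY g₂ g₃ ha
  have db' := euler_wpY g₂ g₃ hb
  generalize wpX g₂ g₃ a = xa at *
  generalize wpX g₂ g₃ b = xb at *
  generalize wpY g₂ g₃ a = ya at *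
  generalize wpY g₂ g₃ b = yb at *
  obtain ⟨α, hs⟩ : ∃ α, 2 * α * (xa - xb) = ya - yb :=
    ⟨(ya - yb) * V, by linear_combination (ya - yb) * hV⟩
  have hs' := half_slope_rel ea eb hu hs
  have hdα := derivation_half_slope (euler 𝕜) h2 hu ea eb hs da db da' db'
  have hα0 : PowerSeries.constantCoeff α = (a + b)⁻¹ - a⁻¹ - b⁻¹ := by
    have h0 := congrArg PowerSeries.constantCoeff hs
    simp only [map_mul, map_sub, map_ofNat, a0, b0, a1, b1] at h0
    have h3 : a⁻¹ ^ 2 - b⁻¹ ^ 2 ≠ 0 := by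
      rw [sub_ne_zero, inv_pow, inv_pow, Ne, inv_inj]; exact h
    refine mul_left_cancel₀ (mul_ne_zero two_ne_zero h3) ?_
    rw [mul_right_comm, h0]
    field_simp
    ring
  have hch : IsChord (PowerSeries.C g₂ * PowerSeries.X ^ 4) xa ya xb yb (α ^ 2 - xa - xb)
      (-ya - 2 * α * (α ^ 2 - xa - xb - xa)) α := ⟨hs, hs', rfl, rfl⟩
  obtain ⟨hx, hy⟩ := eq_wp_of_euler g₂ g₃ hab (hch.curve ea) (by
    rw [map_sub, map_sub, Derivation.leibniz_pow, hdα, da, db, map_add]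
    simp only [smul_eq_mul, nsmul_eq_mul]
    push_cast
    linear_combination -PowerSeries.C b * hs) (by
    rw [map_sub, map_sub, map_pow, hα0, a0, b0]
    field_simp; ring)
  rw [hy, hx] at hch
  exact ⟨α, hch, hα0⟩

end Tautological

/-! ### Products of values of the generating series -/

section ChordSlopes

variable {R : Type*} [CommRing R]

/-- If `Λ₁, Λ₃` are the half slopes of a further point `(x, y)` with the first and the third point
of a chord, then `(Λ₃ + b)(Λ₁ - b) = x - x₂`. -/
theorem IsChord.slope_mul_slope {G K x₁ y₁ x₂ y₂ x₃ y₃ b x y Λ₁ Λ₃ : R}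
    (h : IsChord G x₁ y₁ x₂ y₂ x₃ y₃ b) (h2 : IsUnit (2 : R))
    (e₁ : y₁ ^ 2 = 4 * x₁ ^ 3 - G * x₁ - K) (e : y ^ 2 = 4 * x ^ 3 - G * x - K)
    (hu₁ : IsUnit (x - x₁)) (hu₃ : IsUnit (x - x₃))
    (hΛ₁ : 2 * Λ₁ * (x - x₁) = y - y₁) (hΛ₃ : 2 * Λ₃ * (x - x₃) = y - y₃) :
    (Λ₃ + b) * (Λ₁ - b) = x - x₂ := by
  refine hu₁.mul_left_cancel (hu₃.mul_left_cancel (h2.mul_left_cancel (h2.mul_left_cancel ?_)))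
  linear_combination h.mul_eq e₁ e + (2 * (x - x₃) * (Λ₃ + b)) * hΛ₁ +
    (y - y₁ - 2 * b * (x - x₁)) * hΛ₃

/-- The relation between the half slopes `σ, b, τ, α` of consecutive points in the sequence
`(x₀, y₀)`, `(x₁, y₁)`, `(x₂, y₂)`, `(x', y')`, `(x₀, -y₀)` on a Weierstrass cubic. -/
theorem quadrilateral_slopes {G x₀ y₀ x₁ y₁ x₂ y₂ x' y' α σ τ b : R}
    (hα : 2 * α * (x₀ - x') = -(y₀ + y')) (hσ : 2 * σ * (x₀ - x₁) = y₀ - y₁)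
    (hτ : 2 * τ * (x' - x₂) = y' - y₂) (hb : 2 * b * (x₁ - x₂) = y₁ - y₂)
    (hα' : 2 * α * (y₀ - y') = -(4 * (x₀ ^ 2 + x₀ * x' + x' ^ 2) - G))
    (hσ' : 2 * σ * (y₀ + y₁) = 4 * (x₀ ^ 2 + x₀ * x₁ + x₁ ^ 2) - G)
    (hτ' : 2 * τ * (y' + y₂) = 4 * (x' ^ 2 + x' * x₂ + x₂ ^ 2) - G)
    (hb' : 2 * b * (y₁ + y₂) = 4 * (x₁ ^ 2 + x₁ * x₂ + x₂ ^ 2) - G) :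
    4 * ((α + σ) * (τ - b) * (x₀ - x₂) - (α - τ) * (σ - b) * (x' - x₁)) =
      4 * ((x' - x₁) * (x₀ - x₂)) := by
  linear_combination 2 * (σ + τ - b) * hα + 2 * (τ - α - b) * hσ + 2 * (α + σ - b) * hτ +
    2 * (τ - α - σ) * hb - hα' - hσ' - hτ' + hb'

/-- The Fay identity in terms of half slopes on a cubic. Here `α` is the half slope of `(x₀, -y₀)`
and `(x', y')`; the half slopes of `(x₀, y₀)` with the first and the third point of a chord are `σ, ρ`,
and those of `(x', y')` with the second and the third point are `τ, ρ'`. -/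
theorem three_term_slopes {G K x₀ y₀ x₁ y₁ x₂ y₂ x₃ y₃ x' y' α σ τ ρ ρ' b : R}
    (h : IsChord G x₁ y₁ x₂ y₂ x₃ y₃ b) (h2 : IsUnit (2 : R))
    (e₀ : y₀ ^ 2 = 4 * x₀ ^ 3 - G * x₀ - K) (e' : y' ^ 2 = 4 * x' ^ 3 - G * x' - K)
    (e₁ : y₁ ^ 2 = 4 * x₁ ^ 3 - G * x₁ - K) (e₂ : y₂ ^ 2 = 4 * x₂ ^ 3 - G * x₂ - K)
    (hu : IsUnit (x₀ - x')) (hu₁ : IsUnit (x₀ - x₁)) (hu₂ : IsUnit (x' - x₂))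
    (hu₃ : IsUnit (x₀ - x₃)) (hu₃' : IsUnit (x' - x₃))
    (hσu : IsUnit (σ - b)) (hτu : IsUnit (τ - b))
    (hα : 2 * α * (x₀ - x') = -(y₀ + y')) (hσ : 2 * σ * (x₀ - x₁) = y₀ - y₁)
    (hτ : 2 * τ * (x' - x₂) = y' - y₂) (hρ : 2 * ρ * (x₀ - x₃) = y₀ - y₃)
    (hρ' : 2 * ρ' * (x' - x₃) = y' - y₃) :
    (α + σ) * (ρ + b) - (α - τ) * (ρ' + b) = (ρ + b) * (ρ' + b) := by
  have k₁ := h.slope_mul_slope h2 e₁ e₀ hu₁ hu₃ hσ hρ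
  have k₂ := h.symm.slope_mul_slope h2 e₂ e' hu₂ hu₃' hτ hρ'
  have hα' : 2 * α * (y₀ - y') = -(4 * (x₀ ^ 2 + x₀ * x' + x' ^ 2) - G) := by
    refine hu.mul_left_cancel ?_
    linear_combination (y₀ - y') * hα - e₀ + e'
  have k := quadrilateral_slopes hα hσ hτ h.slope hα' (half_slope_rel e₀ e₁ hu₁ hσ)
    (half_slope_rel e' e₂ hu₂ hτ) h.slope'
  have k' := h2.mul_left_cancel (h2.mul_left_cancel (by linear_combination k :
    2 * (2 * ((α + σ) * (τ - b) * (x₀ - x₂) - (α - τ) * (σ - b) * (x' - x₁))) =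
      2 * (2 * ((x' - x₁) * (x₀ - x₂)))))
  refine hσu.mul_left_cancel (hτu.mul_left_cancel ?_)
  linear_combination k' + ((α + σ) * (τ - b) - (ρ' + b) * (τ - b)) * k₁ -
    ((α - τ) * (σ - b) + (x₀ - x₂)) * k₂

end ChordSlopes

section Products

variable {𝕜 : Type u} [Field 𝕜] {g₂ g₃ : 𝕜} {B : Type*} [CommRing B] [Algebra 𝕜 B]
  (φ : CalA g₂ g₃ →ₐ[𝕜] B)

theorem rescale_C (e b : B) : PowerSeries.rescale e (PowerSeries.C b) = PowerSeries.C b := by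
  ext n; rw [PowerSeries.coeff_rescale, PowerSeries.coeff_C]; split_ifs with h <;> simp [h]

theorem C_algebraMap_mul_inv {e : 𝕜} (he : e ≠ 0) :
    PowerSeries.C (algebraMap 𝕜 B e) * PowerSeries.C (algebraMap 𝕜 B e⁻¹) = 1 := by
  rw [← map_mul, ← map_mul, mul_inv_cancel₀ he, map_one, map_one]

/-- The power series `T² ℘(eT)` with coefficients in `B`. -/
def ptX (g₂ g₃ : 𝕜) (B : Type*) [CommRing B] [Algebra 𝕜 B] (e : 𝕜) : PowerSeries B :=
  PowerSeries.map (algebraMap 𝕜 B) (wpX g₂ g₃ e)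

/-- The power series `T³ ℘'(eT)` with coefficients in `B`. -/
def ptY (g₂ g₃ : 𝕜) (B : Type*) [CommRing B] [Algebra 𝕜 B] (e : 𝕜) : PowerSeries B :=
  PowerSeries.map (algebraMap 𝕜 B) (wpY g₂ g₃ e)

/-- The coordinate `x T²` of a point `φ`. -/
def homX : PowerSeries B := PowerSeries.C (φ (xA g₂ g₃)) * PowerSeries.X ^ 2

/-- The coordinate `y T³` of a point `φ`. -/
def homY : PowerSeries B := PowerSeries.C (φ (yA g₂ g₃)) * PowerSeries.X ^ 3

variable (g₂ B) in
/-- The coefficient `g₂ T⁴`. -/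
def homG : PowerSeries B := PowerSeries.C (algebraMap 𝕜 B g₂) * PowerSeries.X ^ 4

variable (g₃ B) in
/-- The coefficient `g₃ T⁶`. -/
def homK : PowerSeries B := PowerSeries.C (algebraMap 𝕜 B g₃) * PowerSeries.X ^ 6

theorem hom_curve : homY φ ^ 2 = 4 * homX φ ^ 3 - homG g₂ B * homX φ - homK g₃ B := by
  have h := congrArg (PowerSeries.C (R := B)) (hom_curve_eq φ)
  simp only [map_sub, map_mul, map_pow, map_ofNat] at h
  rw [homY, homX, homG, homK]
  linear_combination PowerSeries.X ^ 6 * h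

theorem constantCoeff_ptX (e : 𝕜) :
    PowerSeries.constantCoeff (ptX g₂ g₃ B e) = algebraMap 𝕜 B (e⁻¹ ^ 2) := by
  rw [ptX, ← constantCoeff_wpX g₂ g₃, ← PowerSeries.coeff_zero_eq_constantCoeff_apply,
    PowerSeries.coeff_map, PowerSeries.coeff_zero_eq_constantCoeff_apply]

theorem isUnit_ptX_sub_homX {e : 𝕜} (he : e ≠ 0) : IsUnit (ptX g₂ g₃ B e - homX φ) :=
  isUnit_of_constantCoeff_algebraMap (pow_ne_zero 2 (inv_ne_zero he)) (by
    rw [map_sub, constantCoeff_ptX, homX]; simp)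

theorem isUnit_ptX_sub_ptX {a b : 𝕜} (h : a ^ 2 ≠ b ^ 2) :
    IsUnit (ptX g₂ g₃ B a - ptX g₂ g₃ B b) := by
  have := (isUnit_wpX_sub g₂ g₃ h).map (PowerSeries.map (algebraMap 𝕜 B))
  rwa [map_sub] at this

theorem euler_ptX {e : 𝕜} (he : e ≠ 0) : euler B (ptX g₂ g₃ B e) =
    2 * ptX g₂ g₃ B e + PowerSeries.C (algebraMap 𝕜 B e) * ptY g₂ g₃ B e := by
  rw [ptX, euler_map, euler_wpX g₂ g₃ he, map_add, map_mul, map_mul, map_ofNat, PowerSeries.map_C]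
  rfl

variable {φ₁ φ₂ φ₃ : CalA g₂ g₃ →ₐ[𝕜] B} {b : B}

/-- The point `φ₃` of `E^♯` is the sum of `φ₁` and `φ₂`, and `2b` is the slope of the line
through the images of `φ₁` and `φ₂` in `E`. -/
structure IsSum (φ₁ φ₂ φ₃ : CalA g₂ g₃ →ₐ[𝕜] B) (b : B) : Prop where
  chord : IsChord (algebraMap 𝕜 B g₂) (φ₁ (xA g₂ g₃)) (φ₁ (yA g₂ g₃)) (φ₂ (xA g₂ g₃))
    (φ₂ (yA g₂ g₃)) (φ₃ (xA g₂ g₃)) (φ₃ (yA g₂ g₃)) b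
  c_eq : φ₃ (cA g₂ g₃) = φ₁ (cA g₂ g₃) + φ₂ (cA g₂ g₃) - b

theorem IsSum.hom_chord (h : IsSum φ₁ φ₂ φ₃ b) :
    IsChord (homG g₂ B) (homX φ₁) (homY φ₁) (homX φ₂) (homY φ₂) (homX φ₃) (homY φ₃)
      (PowerSeries.C b * PowerSeries.X) := by
  obtain ⟨h1, h2, h3, h4⟩ := h.chord.map (PowerSeries.C (R := B))
  simp only [homG, homX, homY]
  exact ⟨by linear_combination PowerSeries.X ^ 3 * h1, by linear_combination PowerSeries.X ^ 4 * h2,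
    by linear_combination PowerSeries.X ^ 2 * h3, by linear_combination PowerSeries.X ^ 3 * h4⟩

variable [CharZero 𝕜]

/-- The power series `eT f(eT)` at the point `φ`. -/
def genAt (φ : CalA g₂ g₃ →ₐ[𝕜] B) (e : 𝕜) : PowerSeries B :=
  PowerSeries.rescale (algebraMap 𝕜 B e) (PowerSeries.map φ (genSeries g₂ g₃))

/-- The power series `T Λ(eT)` at the point `φ`. -/
def slopeAt (φ : CalA g₂ g₃ →ₐ[𝕜] B) (e : 𝕜) : PowerSeries B :=
  PowerSeries.C (algebraMap 𝕜 B e⁻¹) *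
    PowerSeries.rescale (algebraMap 𝕜 B e) (PowerSeries.map φ (slopeSeries g₂ g₃))

theorem constantCoeff_genAt (e : 𝕜) : PowerSeries.constantCoeff (genAt φ e) = 1 := by
  rw [genAt, ← PowerSeries.coeff_zero_eq_constantCoeff_apply, PowerSeries.coeff_rescale,
    PowerSeries.coeff_map, PowerSeries.coeff_zero_eq_constantCoeff_apply, constantCoeff_genSeries]
  simp

theorem constantCoeff_slopeAt (e : 𝕜) :
    PowerSeries.constantCoeff (slopeAt φ e) = algebraMap 𝕜 B (-e⁻¹) := by
  rw [slopeAt, ← PowerSeries.coeff_zero_eq_constantCoeff_apply, PowerSeries.coeff_C_mul,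
    PowerSeries.coeff_rescale, PowerSeries.coeff_map, coeff_zero_slopeSeries]
  simp

theorem euler_genAt {e : 𝕜} (he : e ≠ 0) : euler B (genAt φ e) =
    (1 + PowerSeries.C (algebraMap 𝕜 B e) * slopeAt φ e -
      PowerSeries.C (algebraMap 𝕜 B e) * (PowerSeries.C (φ (cA g₂ g₃)) * PowerSeries.X)) *
        genAt φ e := by
  have h : euler B (PowerSeries.map (φ : CalA g₂ g₃ →+* B) (genSeries g₂ g₃)) =
    PowerSeries.map (φ : CalA g₂ g₃ →+* B) (euler _ (genSeries g₂ g₃)) := euler_map _ _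
  have h' := congrArg (PowerSeries.rescale (algebraMap 𝕜 B e)) h
  rw [← euler_rescale, euler_genSeries] at h'
  simp only [map_mul, map_add, map_sub, map_one, PowerSeries.map_C, PowerSeries.map_X,
    PowerSeries.rescale_X, rescale_C] at h'
  refine h'.trans ?_
  have h1 : PowerSeries.C (algebraMap 𝕜 B e) * slopeAt φ e = PowerSeries.rescale (algebraMap 𝕜 B e)
      (PowerSeries.map (φ : CalA g₂ g₃ →+* B) (slopeSeries g₂ g₃)) := by
    rw [slopeAt, ← mul_assoc, C_algebraMap_mul_inv he, one_mul]
  rw [h1]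
  change (1 + _ - PowerSeries.C (φ (cA g₂ g₃)) * _) * genAt φ e = _
  ring

theorem pt_curve {e : 𝕜} (he : e ≠ 0) : ptY g₂ g₃ B e ^ 2 =
    4 * ptX g₂ g₃ B e ^ 3 - homG g₂ B * ptX g₂ g₃ B e - homK g₃ B := by
  have h := congrArg (PowerSeries.map (algebraMap 𝕜 B)) (wpY_sq g₂ g₃ he)
  simp only [map_sub, map_mul, map_pow, map_ofNat, PowerSeries.map_C, PowerSeries.map_X] at h
  exact h

theorem slopeAt_mul {e : 𝕜} (he : e ≠ 0) :
    2 * slopeAt φ e * (ptX g₂ g₃ B e - homX φ) = ptY g₂ g₃ B e - homY φ := by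
  have h := congrArg (PowerSeries.rescale (algebraMap 𝕜 B e))
    (congrArg (PowerSeries.map (φ : CalA g₂ g₃ →+* B)) (slopeSeries_mul g₂ g₃))
  have hm : ∀ f : PowerSeries 𝕜, PowerSeries.rescale (algebraMap 𝕜 B e)
      (PowerSeries.map (φ : CalA g₂ g₃ →+* B) (PowerSeries.map (algebraMap 𝕜 (CalA g₂ g₃)) f)) =
      PowerSeries.map (algebraMap 𝕜 B) (PowerSeries.rescale e f) := fun f => by
    ext n
    simp only [PowerSeries.coeff_rescale, PowerSeries.coeff_map, map_mul, map_pow]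
    congr 1
    exact φ.commutes _
  simp only [map_mul, map_sub, map_pow, map_ofNat, PowerSeries.map_C, PowerSeries.map_X,
    PowerSeries.rescale_X, rescale_C, hm] at h
  have e1 := C_algebraMap_mul_inv (B := B) he
  have hX : ptX g₂ g₃ B e = PowerSeries.C (algebraMap 𝕜 B e⁻¹) ^ 2 *
      PowerSeries.map (algebraMap 𝕜 B) (PowerSeries.rescale e (wpSeries g₂ g₃)) := by
    rw [ptX, wpX, map_mul, PowerSeries.map_C, map_pow, map_pow]
  have hY : ptY g₂ g₃ B e = PowerSeries.C (algebraMap 𝕜 B e⁻¹) ^ 3 *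
      PowerSeries.map (algebraMap 𝕜 B) (PowerSeries.rescale e (wpSeries' g₂ g₃)) := by
    rw [ptY, wpY, map_mul, PowerSeries.map_C, map_pow, map_pow]
  have hS : slopeAt φ e = PowerSeries.C (algebraMap 𝕜 B e⁻¹) *
    PowerSeries.rescale (algebraMap 𝕜 B e)
      (PowerSeries.map (φ : CalA g₂ g₃ →+* B) (slopeSeries g₂ g₃)) := rfl
  change _ * (_ - PowerSeries.C (φ (xA g₂ g₃)) * _) = _ - PowerSeries.C (φ (yA g₂ g₃)) * _ at h
  rw [hX, hY, hS, homX, homY]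
  generalize PowerSeries.C (algebraMap 𝕜 B e⁻¹) = v at *
  generalize PowerSeries.C (algebraMap 𝕜 B e) = w at *
  have e2 : w ^ 2 * v ^ 2 = 1 := by rw [← mul_pow, e1, one_pow]
  have e3 : w ^ 3 * v ^ 3 = 1 := by rw [← mul_pow, e1, one_pow]
  generalize PowerSeries.rescale (algebraMap 𝕜 B e)
      (PowerSeries.map (φ : CalA g₂ g₃ →+* B) (slopeSeries g₂ g₃)) = S at *
  linear_combination v ^ 3 * h + 2 * v * S * PowerSeries.C (φ (xA g₂ g₃)) * PowerSeries.X ^ 2 * e2 -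
    PowerSeries.C (φ (yA g₂ g₃)) * PowerSeries.X ^ 3 * e3

theorem euler_ptY {e : 𝕜} (he : e ≠ 0) : 2 * euler B (ptY g₂ g₃ B e) =
    6 * ptY g₂ g₃ B e + PowerSeries.C (algebraMap 𝕜 B e) *
      (12 * ptX g₂ g₃ B e ^ 2 - homG g₂ B) := by
  have h := congrArg (PowerSeries.map (algebraMap 𝕜 B)) (euler_wpY g₂ g₃ he)
  simp only [map_sub, map_add, map_mul, map_pow, map_ofNat, PowerSeries.map_C, PowerSeries.map_X,
    ← euler_map] at h
  exact h

theorem euler_slopeAt {e : 𝕜} (he : e ≠ 0) : euler B (slopeAt φ e) = slopeAt φ e +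
    PowerSeries.C (algebraMap 𝕜 B e) *
      (2 * ptX g₂ g₃ B e + homX φ - slopeAt φ e ^ 2) := by
  have h := derivation_half_slope (euler B) (isUnit_two 𝕜 _) (s₂ := 0)
    (isUnit_ptX_sub_homX φ he) (pt_curve he) (hom_curve φ) (slopeAt_mul φ he) (euler_ptX he)
    (by rw [homX, euler_C_mul_X_pow]; push_cast; ring) (euler_ptY he)
    (by rw [homY, euler_C_mul_X_pow]; push_cast; ring)
  rw [h]; ring

/-- The product of the values of `f` at two points of `E^♯` is a multiple of its value at their
sum: `f_{P₁}(w) f_{P₂}(w) = -(Λ_{P₃}(w) + b) f_{P₃}(w)`, as both sides satisfy the same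
differential equation. -/
theorem genAt_mul_genAt_of_isSum (h : IsSum φ₁ φ₂ φ₃ b) {e : 𝕜} (he : e ≠ 0) :
    genAt φ₁ e * genAt φ₂ e = -(PowerSeries.C (algebraMap 𝕜 B e) *
      (slopeAt φ₃ e + PowerSeries.C b * PowerSeries.X)) * genAt φ₃ e := by
  have hc := congrArg (PowerSeries.C (R := B)) h.c_eq
  rw [map_sub, map_add] at hc
  have hch := h.hom_chord
  have h2 := isUnit_two 𝕜 (PowerSeries B)
  have k₁ := hch.slope_mul_slope h2 (hom_curve φ₁) (pt_curve he) (isUnit_ptX_sub_homX φ₁ he)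
    (isUnit_ptX_sub_homX φ₃ he) (slopeAt_mul φ₁ he) (slopeAt_mul φ₃ he)
  have k₂ := hch.symm.slope_mul_slope h2 (hom_curve φ₂) (pt_curve he) (isUnit_ptX_sub_homX φ₂ he)
    (isUnit_ptX_sub_homX φ₃ he) (slopeAt_mul φ₂ he) (slopeAt_mul φ₃ he)
  have hx := hch.x_eq
  refine sub_eq_zero.1 (eq_zero_of_euler_eq 𝕜
    (h := 2 + PowerSeries.C (algebraMap 𝕜 B e) * (slopeAt φ₁ e + slopeAt φ₂ e -
      (PowerSeries.C (φ₁ (cA g₂ g₃)) + PowerSeries.C (φ₂ (cA g₂ g₃))) * PowerSeries.X)) ?_ ?_ ?_)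
  · rw [map_sub, Derivation.leibniz, Derivation.leibniz, map_neg, euler_C_mul, map_add,
      euler_C_mul b, euler_X, euler_genAt φ₁ he, euler_genAt φ₂ he, euler_genAt φ₃ he,
      euler_slopeAt φ₃ he, hc]
    simp only [smul_eq_mul]
    rw [hx]
    generalize PowerSeries.C (algebraMap 𝕜 B e) = w at *
    linear_combination (-w ^ 2 * genAt φ₃ e) * (k₁ + k₂)
  · simp only [map_add, map_sub, map_mul, map_ofNat, constantCoeff_slopeAt,
      PowerSeries.constantCoeff_C, PowerSeries.constantCoeff_X, map_neg]
    have := congrArg (algebraMap 𝕜 B) (mul_inv_cancel₀ he)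
    rw [map_mul, map_one] at this
    linear_combination -2 * this
  · simp only [map_sub, map_neg, map_add, map_mul, constantCoeff_genAt, constantCoeff_slopeAt,
      PowerSeries.constantCoeff_C, PowerSeries.constantCoeff_X]
    have := congrArg (algebraMap 𝕜 B) (mul_inv_cancel₀ he)
    rw [map_mul, map_one] at this
    linear_combination -this

end Products

/-! ### The Fay identity along a line through the origin -/

section OneVariable

variable {𝕜 : Type u} [Field 𝕜] [CharZero 𝕜] {g₂ g₃ : 𝕜} {B : Type*} [CommRing B] [Algebra 𝕜 B]
  {φ₁ φ₂ φ₃ : CalA g₂ g₃ →ₐ[𝕜] B} {b : B}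

theorem C_algebraMap_add {𝕜 B : Type*} [CommRing 𝕜] [CommRing B] [Algebra 𝕜 B] (a b : 𝕜) :
    PowerSeries.C (algebraMap 𝕜 B (a + b)) =
      PowerSeries.C (algebraMap 𝕜 B a) + PowerSeries.C (algebraMap 𝕜 B b) := by
  rw [map_add, map_add]

/-- The product of the values of `f` at two arguments is a multiple of its value at their sum:
`f_P(z) f_P(z') = -(Λ(z, z') + Λ_P(z + z')) f_P(z + z')` for `z = aT`, `z' = bT`, where
`α = T Λ(z, z')` is half the slope of the points `(℘, ℘')(z)` and `(℘, ℘')(z')`. -/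
theorem genAt_mul_genAt_of_isChord (φ : CalA g₂ g₃ →ₐ[𝕜] B) {a b : 𝕜} (ha : a ≠ 0) (hb : b ≠ 0)
    (hab : a + b ≠ 0) (h : a ^ 2 ≠ b ^ 2) {α : PowerSeries B}
    (hch : IsChord (homG g₂ B) (ptX g₂ g₃ B a) (ptY g₂ g₃ B a) (ptX g₂ g₃ B b) (ptY g₂ g₃ B b)
      (ptX g₂ g₃ B (a + b)) (ptY g₂ g₃ B (a + b)) α)
    (hα : PowerSeries.constantCoeff α = algebraMap 𝕜 B ((a + b)⁻¹ - a⁻¹ - b⁻¹)) :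
    PowerSeries.C (algebraMap 𝕜 B (a + b)) * (genAt φ a * genAt φ b) =
      -(PowerSeries.C (algebraMap 𝕜 B (a * b)) * (slopeAt φ (a + b) + α)) * genAt φ (a + b) := by
  have h2 := isUnit_two 𝕜 (PowerSeries B)
  have hu : ∀ {e : 𝕜}, e ≠ 0 → IsUnit (homX φ - ptX g₂ g₃ B e) := fun he => by
    rw [← neg_sub]; exact (isUnit_ptX_sub_homX φ he).neg
  have hs : ∀ {e : 𝕜}, e ≠ 0 →
      2 * slopeAt φ e * (homX φ - ptX g₂ g₃ B e) = homY φ - ptY g₂ g₃ B e := fun he => by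
    linear_combination -slopeAt_mul φ he
  have k₁ := hch.slope_mul_slope h2 (pt_curve ha) (hom_curve φ) (hu ha) (hu hab) (hs ha) (hs hab)
  have k₂ := hch.symm.slope_mul_slope h2 (pt_curve hb) (hom_curve φ) (hu hb) (hu hab) (hs hb)
    (hs hab)
  have hx := hch.x_eq
  have huab : IsUnit (ptX g₂ g₃ B a - ptX g₂ g₃ B b) := isUnit_ptX_sub_ptX h
  have dα := derivation_half_slope (euler B) h2 huab (pt_curve ha) (pt_curve hb) hch.slope
    (euler_ptX ha) (euler_ptX hb) (euler_ptY ha) (euler_ptY hb)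
  refine sub_eq_zero.1 (eq_zero_of_euler_eq 𝕜
    (h := 2 + PowerSeries.C (algebraMap 𝕜 B a) * slopeAt φ a +
      PowerSeries.C (algebraMap 𝕜 B b) * slopeAt φ b - PowerSeries.C (algebraMap 𝕜 B (a + b)) *
        (PowerSeries.C (φ (cA g₂ g₃)) * PowerSeries.X)) ?_ ?_ ?_)
  · rw [map_sub, euler_C_mul, Derivation.leibniz, Derivation.leibniz, map_neg, euler_C_mul,
      map_add (euler B), dα, euler_genAt φ ha, euler_genAt φ hb, euler_genAt φ hab,
      euler_slopeAt φ hab]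
    simp only [smul_eq_mul]
    rw [hx, C_algebraMap_add, map_mul, map_mul]
    generalize PowerSeries.C (algebraMap 𝕜 B a) = v at *
    generalize PowerSeries.C (algebraMap 𝕜 B b) = w at *
    linear_combination (-(v * w) * genAt φ (a + b)) * (v * k₁ + w * k₂)
  · simp only [map_add, map_sub, map_mul, map_ofNat, constantCoeff_slopeAt,
      PowerSeries.constantCoeff_C, PowerSeries.constantCoeff_X, map_neg]
    have h1 := congrArg (algebraMap 𝕜 B) (mul_inv_cancel₀ ha)
    have h2 := congrArg (algebraMap 𝕜 B) (mul_inv_cancel₀ hb)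
    rw [map_mul, map_one] at h1 h2
    linear_combination -h1 - h2
  · simp only [map_sub, map_neg, map_add, map_mul, constantCoeff_genAt, constantCoeff_slopeAt,
      PowerSeries.constantCoeff_C, hα, mul_one]
    simp only [← map_add, ← map_mul, ← map_neg, ← map_sub]
    rw [← map_zero (algebraMap 𝕜 B)]
    congr 1
    field_simp
    ring

theorem isUnit_genAt (φ : CalA g₂ g₃ →ₐ[𝕜] B) (e : 𝕜) : IsUnit (genAt φ e) :=
  isUnit_of_constantCoeff_algebraMap (one_ne_zero (α := 𝕜)) (by
    rw [constantCoeff_genAt, map_one])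

theorem exists_isChord_pt (g₂ g₃ : 𝕜) (B : Type*) [CommRing B] [Algebra 𝕜 B] {a b : 𝕜}
    (ha : a ≠ 0) (hb : b ≠ 0) (hab : a + b ≠ 0) (h : a ^ 2 ≠ b ^ 2) : ∃ α : PowerSeries B,
      IsChord (homG g₂ B) (ptX g₂ g₃ B a) (ptY g₂ g₃ B a) (ptX g₂ g₃ B b) (ptY g₂ g₃ B b)
        (ptX g₂ g₃ B (a + b)) (ptY g₂ g₃ B (a + b)) α ∧
      PowerSeries.constantCoeff α = algebraMap 𝕜 B ((a + b)⁻¹ - a⁻¹ - b⁻¹) := by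
  obtain ⟨α, h1, h2⟩ := exists_isChord_wp g₂ g₃ ha hb hab h
  refine ⟨PowerSeries.map (algebraMap 𝕜 B) α, ?_, ?_⟩
  · have := h1.map (PowerSeries.map (algebraMap 𝕜 B))
    rwa [map_mul, map_pow, PowerSeries.map_C, PowerSeries.map_X] at this
  · rw [← PowerSeries.coeff_zero_eq_constantCoeff_apply, PowerSeries.coeff_map,
      PowerSeries.coeff_zero_eq_constantCoeff_apply, h2]

/-- The Fay identity for `z = aT` and `z' = T`, multiplied by `z z' (z + z') / T²`. -/
theorem fay_one_variable (h : IsSum φ₁ φ₂ φ₃ b) {a : 𝕜} (h0 : a ≠ 0) (h1 : a + 1 ≠ 0)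
    (h2 : a ^ 2 ≠ 1 ^ 2) (h3 : (-a) ^ 2 ≠ (a + 1) ^ 2) (h4 : (a + 1) ^ 2 ≠ 1 ^ 2) :
    PowerSeries.C (algebraMap 𝕜 B (a + 1)) * (genAt φ₁ a * genAt φ₃ 1) =
      PowerSeries.C (algebraMap 𝕜 B a) * (genAt φ₁ (a + 1) * genAt φ₂ 1) +
        genAt φ₂ (-a) * genAt φ₃ (a + 1) := by
  have one : (1 : 𝕜) ≠ 0 := one_ne_zero
  have hone : -a + (a + 1) = 1 := by ring
  have isU2 := isUnit_two 𝕜 (PowerSeries B)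
  obtain ⟨α, hα, hα0⟩ := exists_isChord_pt g₂ g₃ B h0 one h1 h2
  obtain ⟨β, hβ, hβ0⟩ := exists_isChord_pt g₂ g₃ B (neg_ne_zero.2 h0) h1
    (by rw [hone]; exact one) h3
  have m₁ := genAt_mul_genAt_of_isChord φ₁ h0 one h1 h2 hα hα0
  have m₂ := genAt_mul_genAt_of_isChord φ₂ (neg_ne_zero.2 h0) h1 (by rw [hone]; exact one) h3 hβ hβ0
  rw [hone] at hβ m₂
  have n₁ := genAt_mul_genAt_of_isSum h one
  have n₂ := genAt_mul_genAt_of_isSum h h1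
  have hs : IsUnit (ptX g₂ g₃ B (a + 1) - ptX g₂ g₃ B 1) := isUnit_ptX_sub_ptX h4
  have hα1 : 2 * α * (ptX g₂ g₃ B (a + 1) - ptX g₂ g₃ B 1) =
      -(ptY g₂ g₃ B (a + 1) + ptY g₂ g₃ B 1) := by
    linear_combination hα.symm.y_eq
  -- the chord through the points at `-z` and `z + z'` is the one through `z` and `z'`, reflected
  have hαβ : β = -α := hs.mul_left_cancel (isU2.mul_left_cancel (by
    linear_combination hα1 - hβ.symm.y_eq))
  have hunit : ∀ (φ : CalA g₂ g₃ →ₐ[𝕜] B) (c : B) {e : 𝕜} (_ : e ≠ 0),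
      IsUnit (slopeAt φ e + PowerSeries.C c * PowerSeries.X) :=
    fun φ c e he => isUnit_of_constantCoeff_algebraMap (a := -e⁻¹)
      (neg_ne_zero.2 (inv_ne_zero he)) (by
        rw [map_add, constantCoeff_slopeAt, map_mul, PowerSeries.constantCoeff_X]; simp)
  have hm : ∀ (φ : CalA g₂ g₃ →ₐ[𝕜] B) {e : 𝕜} (_ : e ≠ 0),
      IsUnit (slopeAt φ e - PowerSeries.C b * PowerSeries.X) := fun φ e he => by
    have := hunit φ (-b) he
    rwa [map_neg, neg_mul, ← sub_eq_add_neg] at this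
  -- the tautological points at `z + z'` and `z'` take the places of `(x₀, y₀)` and `(x', y')`
  have key := three_term_slopes h.hom_chord isU2 (pt_curve h1) (pt_curve one) (hom_curve φ₁)
    (hom_curve φ₂) hs (isUnit_ptX_sub_homX φ₁ h1) (isUnit_ptX_sub_homX φ₂ one)
    (isUnit_ptX_sub_homX φ₃ h1) (isUnit_ptX_sub_homX φ₃ one) (hm φ₁ h1) (hm φ₂ one) hα1
    (slopeAt_mul φ₁ h1) (slopeAt_mul φ₂ one) (slopeAt_mul φ₃ h1) (slopeAt_mul φ₃ one)
  rw [hαβ] at m₂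
  rw [mul_one] at m₁
  rw [map_one, map_one, one_mul, map_mul, map_mul, map_neg, map_neg] at m₂
  rw [map_one, map_one, one_mul] at n₁
  -- multiplied by these units, the three products can be evaluated by the product formulas
  have wu : IsUnit (PowerSeries.C (algebraMap 𝕜 B (a + 1))) :=
    ((IsUnit.mk0 (a + 1) h1).map (algebraMap 𝕜 B)).map PowerSeries.C
  have F₁u := isUnit_genAt φ₁ (1 : 𝕜)
  have F₂u := isUnit_genAt φ₂ (a + 1)
  have pu := hunit φ₃ b one
  have qu := hunit φ₃ b h1
  refine wu.mul_left_cancel (F₁u.mul_left_cancel (F₂u.mul_left_cancel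
    (pu.mul_left_cancel (qu.mul_left_cancel ?_))))
  clear hunit hm
  generalize PowerSeries.C (algebraMap 𝕜 B (a + 1)) = w at *
  generalize PowerSeries.C (algebraMap 𝕜 B a) = v at *
  generalize slopeAt φ₃ (1 : 𝕜) = p at *
  generalize slopeAt φ₃ (a + 1) = q at *
  generalize slopeAt φ₁ (a + 1) = s at *
  generalize slopeAt φ₂ (1 : 𝕜) = t at *
  generalize genAt φ₁ a = A1 at *
  generalize genAt φ₁ (1 : 𝕜) = A2 at *
  generalize genAt φ₁ (a + 1) = A3 at *
  generalize genAt φ₂ (-a) = B1 at *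
  generalize genAt φ₂ (1 : 𝕜) = B2 at *
  generalize genAt φ₂ (a + 1) = B3 at *
  generalize genAt φ₃ (1 : 𝕜) = C1 at *
  generalize genAt φ₃ (a + 1) = C2 at *
  generalize PowerSeries.C b * PowerSeries.X = r at *
  linear_combination (w * B3 * C1 * (p + r) * (q + r)) * m₁ -
    (w * v * (s + α) * A3 * B3 * (q + r)) * n₁ -
    (w * A2 * C2 * (p + r) * (q + r)) * m₂ - (w * v * A2 * B2 * (t - α) * (p + r)) * n₂ +
    (w * v * A2 * B2 * A3 * B3) * key

end OneVariable

/-! ### The Fay identity in two variables -/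

section TwoVariables

variable {B : Type*} [CommRing B]

theorem hasSubst_line (a : B) : MvPowerSeries.HasSubst
    ![PowerSeries.C a * PowerSeries.X, (PowerSeries.X : PowerSeries B)] :=
  MvPowerSeries.hasSubst_of_constantCoeff_zero (by
    intro i
    fin_cases i
    · exact (map_mul PowerSeries.constantCoeff _ _).trans (by simp)
    · exact PowerSeries.constantCoeff_X)

/-- The restriction `z ↦ aT, z' ↦ T` of a series in `z, z'` to a line through the origin. -/
def lineEval (a : B) : MvPowerSeries (Fin 2) B →ₐ[B] PowerSeries B :=
  MvPowerSeries.substAlgHom (hasSubst_line a)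

theorem lineEval_zVar (a : B) : lineEval a (zVar B) = PowerSeries.C a * PowerSeries.X := by
  rw [lineEval, zVar, MvPowerSeries.substAlgHom_X]; rfl

theorem lineEval_zVar' (a : B) : lineEval a (zVar' B) = PowerSeries.X := by
  rw [lineEval, zVar', MvPowerSeries.substAlgHom_X]; rfl

theorem lineEval_subst (a : B) {w : MvPowerSeries (Fin 2) B} {e : B}
    (hw : MvPowerSeries.constantCoeff w = 0)
    (h : lineEval a w = PowerSeries.C e * PowerSeries.X) (F : PowerSeries B) :
    lineEval a (PowerSeries.subst w F) = PowerSeries.rescale e F := by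
  have hs : PowerSeries.HasSubst w := PowerSeries.HasSubst.of_constantCoeff_zero hw
  rw [lineEval, MvPowerSeries.substAlgHom_apply] at h
  rw [lineEval, MvPowerSeries.substAlgHom_apply, PowerSeries.subst,
    MvPowerSeries.subst_comp_subst_apply hs.const (hasSubst_line a), h,
    PowerSeries.rescale_eq_subst, PowerSeries.smul_eq_C_mul]
  rfl

theorem coeff_lineEval (a : B) (L : MvPowerSeries (Fin 2) B) (k : ℕ) :
    PowerSeries.coeff k (lineEval a L) = ∑ p ∈ Finset.HasAntidiagonal.antidiagonal k,
      MvPowerSeries.coeff (Finsupp.single 0 p.1 + Finsupp.single 1 p.2) L * a ^ p.1 := by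
  rw [lineEval, MvPowerSeries.substAlgHom_apply]
  have key := MvPowerSeries.coeff_subst (hasSubst_line a) L (Finsupp.single () k)
  refine key.trans ?_
  have hterm : ∀ d : Fin 2 →₀ ℕ, MvPowerSeries.coeff d L • MvPowerSeries.coeff (Finsupp.single () k)
      (d.prod fun s e => (![PowerSeries.C a * PowerSeries.X, (PowerSeries.X : PowerSeries B)] s :
        MvPowerSeries Unit B) ^ e) =
      if d 0 + d 1 = k then MvPowerSeries.coeff d L * a ^ d 0 else 0 := by
    intro d
    rw [Finsupp.prod_fintype _ _ (fun _ => pow_zero _), Fin.prod_univ_two]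
    change _ • PowerSeries.coeff k ((PowerSeries.C a * PowerSeries.X) ^ d 0 *
      (PowerSeries.X : PowerSeries B) ^ d 1) = _
    rw [mul_pow, mul_assoc, ← pow_add, ← map_pow, PowerSeries.coeff_C_mul, PowerSeries.coeff_X_pow,
      smul_eq_mul]
    split_ifs with h₁ h₂ h₂
    · rw [mul_one]
    · exact absurd h₁.symm h₂
    · exact absurd h₂.symm h₁
    · rw [mul_zero, mul_zero]
  rw [finsum_congr hterm, finsum_eq_sum_of_support_subset (s :=
    (Finset.HasAntidiagonal.antidiagonal k).image fun p : ℕ × ℕ =>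
      (Finsupp.single 0 p.1 + Finsupp.single 1 p.2 : Fin 2 →₀ ℕ))]
  · rw [Finset.sum_image]
    · refine Finset.sum_congr rfl fun p hp => ?_
      rw [Finset.HasAntidiagonal.mem_antidiagonal] at hp
      simp [hp]
    · intro p _ q _ h
      have h₀ := DFunLike.congr_fun h 0
      have h₁ := DFunLike.congr_fun h 1
      simp at h₀ h₁
      exact Prod.ext h₀ h₁
  · intro d hd
    have hk : d 0 + d 1 = k := by
      by_contra hne
      exact hd (if_neg hne)
    rw [Finset.coe_image]
    refine ⟨(d 0, d 1), Finset.HasAntidiagonal.mem_antidiagonal.2 hk, ?_⟩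
    ext i
    fin_cases i <;> simp

/-- A polynomial function with coefficients in an algebra over a field of characteristic zero that
vanishes at almost all natural numbers is zero. -/
theorem eq_zero_of_sum_pow_eq_zero (𝕜 : Type*) [Field 𝕜] [CharZero 𝕜] [Algebra 𝕜 B] {k : ℕ}
    {f : ℕ × ℕ → B} (h : ∀ n : ℕ, 2 ≤ n →
      ∑ p ∈ Finset.HasAntidiagonal.antidiagonal k, f p * (n : B) ^ p.1 = 0) :
    ∀ p ∈ Finset.HasAntidiagonal.antidiagonal k, f p = 0 := by
  intro p hp
  -- linear forms on `B` reduce the claim to polynomials over the field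
  rw [← Module.forall_dual_apply_eq_zero_iff 𝕜]
  intro l
  let q : Polynomial 𝕜 := ∑ p ∈ Finset.HasAntidiagonal.antidiagonal k,
    Polynomial.C (l (f p)) * Polynomial.X ^ p.1
  have hq : q = 0 := by
    apply Polynomial.eq_zero_of_infinite_isRoot
    refine Set.Infinite.mono ?_ ((Set.Ici_infinite 2).image
      (Nat.cast_injective (R := 𝕜)).injOn)
    rintro _ ⟨n, hn, rfl⟩
    have := congrArg l (h n hn)
    rw [map_sum, map_zero] at this
    rw [Set.mem_ofPred_eq, Polynomial.IsRoot, Polynomial.eval_finsetSum, ← this]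
    refine Finset.sum_congr rfl fun p _ => ?_
    rw [Polynomial.eval_mul, Polynomial.eval_pow, Polynomial.eval_X, Polynomial.eval_C,
      ← Nat.cast_pow, ← Nat.cast_pow, mul_comm (f p), ← nsmul_eq_mul, map_nsmul, nsmul_eq_mul,
      mul_comm]
  have := congrArg (Polynomial.coeff · p.1) hq
  simp only [q, Polynomial.finsetSum_coeff, Polynomial.coeff_C_mul, Polynomial.coeff_X_pow,
    Polynomial.coeff_zero] at this
  rw [Finset.sum_eq_single p] at this
  · simpa using this
  · rintro ⟨i, j⟩ hij hne
    rw [if_neg, mul_zero]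
    rintro rfl
    rw [Finset.HasAntidiagonal.mem_antidiagonal] at hij hp
    exact hne (Prod.ext rfl (by dsimp only at hij ⊢; omega))
  · exact fun h => absurd hp h

/-- A power series in two variables is zero if its restrictions to the lines `z = n z'` are. -/
theorem eq_zero_of_lineEval (𝕜 : Type*) [Field 𝕜] [CharZero 𝕜] [Algebra 𝕜 B]
    {L : MvPowerSeries (Fin 2) B} (h : ∀ n : ℕ, 2 ≤ n → lineEval (n : B) L = 0) : L = 0 := by
  ext d
  rw [map_zero]
  have hd : d = Finsupp.single 0 (d 0) + Finsupp.single 1 (d 1) := by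
    ext i; fin_cases i <;> simp
  rw [hd]
  refine eq_zero_of_sum_pow_eq_zero 𝕜 (k := d 0 + d 1)
    (f := fun p => MvPowerSeries.coeff (Finsupp.single 0 p.1 + Finsupp.single 1 p.2) L) ?_
    (d 0, d 1) (Finset.HasAntidiagonal.mem_antidiagonal.2 rfl)
  intro n hn
  rw [← coeff_lineEval, h n hn, map_zero]

variable {𝕜 : Type u} [Field 𝕜] [CharZero 𝕜] {g₂ g₃ : 𝕜} [Algebra 𝕜 B]
  {φ₁ φ₂ φ₃ : CalA g₂ g₃ →ₐ[𝕜] B} {b : B}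

/-- The power series `w f(w)` at the point `φ`, for `w ∈ B⟦z, z'⟧`. -/
def genSubst (φ : CalA g₂ g₃ →ₐ[𝕜] B) (w : MvPowerSeries (Fin 2) B) : MvPowerSeries (Fin 2) B :=
  PowerSeries.subst w (PowerSeries.map (φ : CalA g₂ g₃ →+* B) (genSeries g₂ g₃))

theorem constantCoeff_zVar : MvPowerSeries.constantCoeff (zVar B) = 0 :=
  MvPowerSeries.constantCoeff_X _

theorem constantCoeff_zVar' : MvPowerSeries.constantCoeff (zVar' B) = 0 :=
  MvPowerSeries.constantCoeff_X _

/-- The Fay identity, multiplied by `z z' (z + z')`. -/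
theorem fay_two_variables (h : IsSum φ₁ φ₂ φ₃ b) :
    (zVar B + zVar' B) * (genSubst φ₁ (zVar B) * genSubst φ₃ (zVar' B)) -
      zVar B * (genSubst φ₁ (zVar B + zVar' B) * genSubst φ₂ (zVar' B)) -
      zVar' B * (genSubst φ₂ (-zVar B) * genSubst φ₃ (zVar B + zVar' B)) = 0 := by
  refine eq_zero_of_lineEval 𝕜 fun n hn => ?_
  have hz := constantCoeff_zVar (B := B)
  have hz' := constantCoeff_zVar' (B := B)
  have e₁ := lineEval_zVar (n : B)
  have e₂ := lineEval_zVar' (n : B)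
  have ev : ∀ (φ : CalA g₂ g₃ →ₐ[𝕜] B) {w : MvPowerSeries (Fin 2) B} (e : 𝕜)
      (_ : MvPowerSeries.constantCoeff w = 0)
      (_ : lineEval (n : B) w = PowerSeries.C (algebraMap 𝕜 B e) * PowerSeries.X),
      lineEval (n : B) (genSubst φ w) = genAt φ e := fun φ w e hw he =>
    lineEval_subst _ hw he _
  -- `n ≥ 2` excludes the slopes `0, ±1, -1/2, -2` for which two tautological points agree up to
  -- sign or one is the origin
  have key := fay_one_variable h (a := (n : 𝕜)) (by norm_cast; omega) (by norm_cast)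
    (by norm_cast; nlinarith) (by rw [neg_sq]; norm_cast; nlinarith) (by norm_cast; nlinarith)
  have w₁ : lineEval (n : B) (zVar B) =
    PowerSeries.C (algebraMap 𝕜 B (n : 𝕜)) * PowerSeries.X := by
    rw [e₁, map_natCast (algebraMap 𝕜 B)]
  have w₂ : lineEval (n : B) (zVar' B) =
    PowerSeries.C (algebraMap 𝕜 B 1) * PowerSeries.X := by rw [e₂, map_one, map_one, one_mul]
  have w₃ : lineEval (n : B) (zVar B + zVar' B) =
      PowerSeries.C (algebraMap 𝕜 B (n + 1)) * PowerSeries.X := by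
    rw [map_add, w₁, w₂, C_algebraMap_add, add_mul]
  have w₄ : lineEval (n : B) (-zVar B) =
      PowerSeries.C (algebraMap 𝕜 B (-n)) * PowerSeries.X := by
    rw [map_neg, w₁, map_neg, map_neg, neg_mul]
  have hs : MvPowerSeries.constantCoeff (zVar B + zVar' B) = 0 := by rw [map_add, hz, hz', add_zero]
  have hm : MvPowerSeries.constantCoeff (-zVar B) = 0 := by rw [map_neg, hz, neg_zero]
  rw [map_sub, map_sub, map_mul, map_mul, map_mul, map_mul, map_mul, map_mul, ev φ₁ _ hz w₁,
    ev φ₃ _ hz' w₂, ev φ₁ _ hs w₃, ev φ₂ _ hz' w₂, ev φ₂ _ hm w₄, ev φ₃ _ hs w₃, w₃, w₁, e₂]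
  linear_combination PowerSeries.X * key

theorem genSubst_eq (φ : CalA g₂ g₃ →ₐ[𝕜] B) {w : MvPowerSeries (Fin 2) B}
    (hw : MvPowerSeries.constantCoeff w = 0) : genSubst φ w =
      1 + w * PowerSeries.subst w (PowerSeries.mk fun α => φ (fCoeff g₂ g₃ α)) := by
  have hs : PowerSeries.HasSubst w := PowerSeries.HasSubst.of_constantCoeff_zero hw
  have h : PowerSeries.map (φ : CalA g₂ g₃ →+* B) (genSeries g₂ g₃) =
      1 + PowerSeries.X * PowerSeries.mk fun α => φ (fCoeff g₂ g₃ α) := by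
    ext n
    rw [PowerSeries.coeff_map]
    cases n with
    | zero =>
      rw [PowerSeries.coeff_zero_eq_constantCoeff_apply, constantCoeff_genSeries]
      simp
    | succ n =>
      rw [map_add, PowerSeries.coeff_succ_X_mul, PowerSeries.coeff_mk, PowerSeries.coeff_one,
        if_neg n.succ_ne_zero, zero_add]
      rfl
  have h1 : (1 : PowerSeries B).subst w = 1 := by rw [← PowerSeries.coe_substAlgHom hs, map_one]
  rw [genSubst]
  change PowerSeries.subst w (PowerSeries.map (φ : CalA g₂ g₃ →+* B) (genSeries g₂ g₃)) = _
  rw [h, PowerSeries.subst_add hs, PowerSeries.subst_mul hs, PowerSeries.subst_X hs, h1]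

theorem mul_fAt (φ : CalA g₂ g₃ →ₐ[𝕜] B) {w : MvPowerSeries (Fin 2) B}
    (hw : MvPowerSeries.constantCoeff w = 0) (hu : IsUnit (algebraMap _ (PolarSeries B) w)) :
    algebraMap _ (PolarSeries B) w * fAt φ w = algebraMap _ (PolarSeries B) (genSubst φ w) := by
  rw [fAt, genSubst_eq φ hw, mul_add, Ring.mul_inverse_cancel _ hu, map_add, map_mul, map_one]

/-- The algebraic Fay identity for three points of `E^♯` with values in a ring `B`, one of which is
the sum of the others. -/
theorem fay_polar (h : IsSum φ₁ φ₂ φ₃ b) :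
    fAt φ₁ (zVar B) * fAt φ₃ (zVar' B) - fAt φ₁ (zVar B + zVar' B) * fAt φ₂ (zVar' B) +
      fAt φ₂ (-zVar B) * fAt φ₃ (zVar B + zVar' B) = 0 := by
  have hu : IsUnit (algebraMap _ (PolarSeries B)
      (zVar B * zVar' B * (zVar B + zVar' B))) :=
    IsLocalization.Away.algebraMap_isUnit _
  have hu' := hu
  rw [map_mul, IsUnit.mul_iff, map_mul, IsUnit.mul_iff] at hu'
  obtain ⟨⟨u₁, u₂⟩, u₃⟩ := hu'
  have u₄ : IsUnit (algebraMap _ (PolarSeries B) (-zVar B)) := by rw [map_neg]; exact u₁.neg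
  have hz := constantCoeff_zVar (B := B)
  have hz' := constantCoeff_zVar' (B := B)
  have hs : MvPowerSeries.constantCoeff (zVar B + zVar' B) = 0 := by rw [map_add, hz, hz', add_zero]
  have hm : MvPowerSeries.constantCoeff (-zVar B) = 0 := by rw [map_neg, hz, neg_zero]
  have a₁ := mul_fAt φ₁ hz u₁
  have a₂ := mul_fAt φ₃ hz' u₂
  have a₃ := mul_fAt φ₁ hs u₃
  have a₄ := mul_fAt φ₂ hz' u₂
  have a₅ := mul_fAt φ₂ hm u₄
  have a₆ := mul_fAt φ₃ hs u₃
  have key := congrArg (algebraMap _ (PolarSeries B)) (fay_two_variables h)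
  rw [map_sub, map_sub, map_zero, map_mul, map_mul, map_mul, map_mul, map_mul, map_mul, ← a₁, ← a₂,
    ← a₃, ← a₄, ← a₅, ← a₆, map_neg] at key
  refine hu.mul_left_cancel ?_
  rw [map_mul, map_mul]
  linear_combination key

end TwoVariables

/-! ### Addition of line bundles with connection -/

section GroupLaw

/-- The partial fraction expansion of the logarithmic derivative of the quotient of the equation of
a chord by that of a vertical line. -/
theorem IsChord.partial_fractions {F : Type*} [Field F] [CharZero F]
    {G H x₁ y₁ x₂ y₂ x₃ y₃ b x y : F} (h : IsChord G x₁ y₁ x₂ y₂ x₃ y₃ b)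
    (h₁ : y₁ ^ 2 = 4 * x₁ ^ 3 - G * x₁ - H) (hxy : y ^ 2 = 4 * x ^ 3 - G * x - H)
    (n₁ : x - x₁ ≠ 0) (n₂ : x - x₂ ≠ 0) (n₃ : x - x₃ ≠ 0)
    (hN : y - y₁ - 2 * b * (x - x₁) ≠ 0) :
    (y + y₁) / (2 * (x - x₁)) + (y + y₂) / (2 * (x - x₂)) - (y + y₃) / (2 * (x - x₃)) + b =
      (y - y₁ - 2 * b * (x - x₁))⁻¹ * (6 * x ^ 2 - G / 2 - 2 * b * y) - (x - x₃)⁻¹ * y := by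
  have hprod := h.mul_eq h₁ hxy
  have e : (y - y₁ - 2 * b * (x - x₁))⁻¹ =
      (y - y₃ + 2 * b * (x - x₃)) / (4 * (x - x₁) * (x - x₂) * (x - x₃)) := by
    rw [inv_eq_one_div, div_eq_div_iff hN (by simp [n₁, n₂, n₃])]
    linear_combination -hprod
  rw [e]
  obtain rfl : y₂ = y₁ - 2 * b * (x₁ - x₂) := by linear_combination h.slope
  obtain rfl : G = 4 * (x₁ ^ 2 + x₁ * x₂ + x₂ ^ 2) - 2 * b * (y₁ + (y₁ - 2 * b * (x₁ - x₂))) := by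
    linear_combination h.slope'
  obtain rfl := h.y_eq
  field_simp
  obtain rfl := h.x_eq
  linear_combination 4 * b * hxy - 4 * b * h₁

variable {K F : Type*} [Field K] [Field F] [Algebra K F]

theorem connForm_eq_smul (x y : F) (a b c : K) : connForm x y a b c =
    ((y + algebraMap K F b) / (2 * (x - algebraMap K F a)) + algebraMap K F c) •
      (y⁻¹ • KaehlerDifferential.D K F x) := by
  rw [connForm, smul_smul]

/-- `dy = (6x² - g₂/2) dx/y`. -/
theorem D_eq_smul_of_curve [CharZero K] {x y : F} {g₂ g₃ : K}
    (hxy : y ^ 2 = 4 * x ^ 3 - algebraMap K F g₂ * x - algebraMap K F g₃) (hy : y ≠ 0) :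
    KaehlerDifferential.D K F y =
      (6 * x ^ 2 - algebraMap K F g₂ / 2) • (y⁻¹ • KaehlerDifferential.D K F x) := by
  have : CharZero F := charZero_of_injective_algebraMap (algebraMap K F).injective
  have h := congrArg (KaehlerDifferential.D K F) hxy
  have d4 : KaehlerDifferential.D K F (4 : F) = 0 := (KaehlerDifferential.D K F).map_natCast 4
  simp only [map_sub, Derivation.leibniz, Derivation.leibniz_pow, d4,
    Derivation.map_algebraMap, smul_zero, add_zero, sub_zero, ← Nat.cast_smul_eq_nsmul F,
    smul_smul, ← sub_smul] at h
  refine smul_right_injective _ (mul_ne_zero two_ne_zero hy : (2 : F) * y ≠ 0) ?_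
  dsimp only
  rw [smul_smul, smul_smul]
  convert h using 2
  · norm_num
  · field_simp
    norm_num

theorem dlog_mk0 {g : F} (hg : g ≠ 0) :
    dlog K F (Additive.ofMul (Units.mk0 g hg)) = g⁻¹ • KaehlerDifferential.D K F g := by
  change ((Units.mk0 g hg)⁻¹ : Fˣ).val • KaehlerDifferential.D K F (Units.mk0 g hg).val = _
  rw [Units.val_inv_eq_inv_val, Units.val_mk0]

/-- The connections on `𝒪(P - 0)` and `𝒪(-P - 0)` with opposite parameters are inverse to each
other: in the section `(x - x_P)⁻¹` of the tensor product the connection is the trivial one. -/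
theorem connForm_add_connForm_neg [CharZero K] {x y : F} (a b c : K)
    (hxa : x ≠ algebraMap K F a) (hy : y ≠ 0) :
    connForm x y a b c + connForm x y a (-b) (-c) =
      dlog K F (Additive.ofMul (Units.mk0 _ (sub_ne_zero.2 hxa))) := by
  have : CharZero F := charZero_of_injective_algebraMap (algebraMap K F).injective
  have h := sub_ne_zero.2 hxa
  rw [dlog_mk0, connForm, connForm, ← add_smul, map_sub, Derivation.map_algebraMap, sub_zero]
  congr 1
  rw [map_neg, map_neg]
  field_simp
  ring

/-- The connections on `𝒪(P₁ - 0)` and `𝒪(P₂ - 0)` add up to a connection on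
`𝒪(P₁ + P₂ - 0)`: the two bundles are identified by the function with divisor
`(P₁) + (P₂) - (P₁ + P₂) - (0)`, the equation of the chord divided by that of a vertical line. -/
theorem connForm_add_connForm [CharZero K] {x y : F} {g₂ g₃ a₁ b₁ a₂ b₂ a₃ b₃ b : K} (c₁ c₂ : K)
    (hxy : y ^ 2 = 4 * x ^ 3 - algebraMap K F g₂ * x - algebraMap K F g₃)
    (hx : ∀ a : K, x ≠ algebraMap K F a) (hy : y ≠ 0)
    (h : IsChord g₂ a₁ b₁ a₂ b₂ a₃ b₃ b) (h₁ : b₁ ^ 2 = 4 * a₁ ^ 3 - g₂ * a₁ - g₃) :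
    ∃ g, connForm x y a₁ b₁ c₁ + connForm x y a₂ b₂ c₂ - connForm x y a₃ b₃ (c₁ + c₂ - b) =
      dlog K F g := by
  have : CharZero F := charZero_of_injective_algebraMap (algebraMap K F).injective
  have hm := h.map (algebraMap K F)
  have h₁' := congrArg (algebraMap K F) h₁
  simp only [map_sub, map_mul, map_pow, map_ofNat] at h₁'
  have n₁ := sub_ne_zero.2 (hx a₁)
  have n₂ := sub_ne_zero.2 (hx a₂)
  have n₃ := sub_ne_zero.2 (hx a₃)
  set A₁ := algebraMap K F a₁
  set A₂ := algebraMap K F a₂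
  set A₃ := algebraMap K F a₃
  set B₁ := algebraMap K F b₁ with hB₁
  set β := algebraMap K F b with hβ
  have hprod : (y - B₁ - 2 * β * (x - A₁)) * (y + B₁ + 2 * β * (x - A₁)) =
      4 * (x - A₁) * (x - A₂) * (x - A₃) := by
    linear_combination hm.mul_eq h₁' hxy +
      (y - B₁ - 2 * β * (x - A₁)) * hm.y_eq
  have hN : y - B₁ - 2 * β * (x - A₁) ≠ 0 := by
    intro h0
    rw [h0, zero_mul] at hprod
    exact mul_ne_zero (mul_ne_zero (mul_ne_zero (by norm_num) n₁) n₂) n₃ hprod.symm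
  refine ⟨Additive.ofMul (Units.mk0 _ hN) - Additive.ofMul (Units.mk0 _ n₃), ?_⟩
  obtain ⟨ω, hω⟩ : ∃ ω, y⁻¹ • KaehlerDifferential.D K F x = ω := ⟨_, rfl⟩
  have hDx : KaehlerDifferential.D K F x = y • ω := by
    rw [← hω, smul_smul, mul_inv_cancel₀ hy, one_smul]
  have hDN : KaehlerDifferential.D K F (y - B₁ - 2 * β * (x - A₁)) =
      (6 * x ^ 2 - algebraMap K F g₂ / 2 - 2 * β * y) • ω := by
    have d : KaehlerDifferential.D K F (2 * β) = 0 := by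
      rw [hβ, ← map_ofNat (algebraMap K F) 2, ← map_mul, Derivation.map_algebraMap]
    rw [map_sub, map_sub, Derivation.leibniz, d, smul_zero, add_zero, map_sub,
      Derivation.map_algebraMap, Derivation.map_algebraMap, sub_zero, sub_zero,
      D_eq_smul_of_curve hxy hy, hω, hDx, smul_smul, ← sub_smul]
  rw [map_sub, dlog_mk0, dlog_mk0, hDN, map_sub (KaehlerDifferential.D K F),
    Derivation.map_algebraMap, sub_zero, connForm_eq_smul, connForm_eq_smul, connForm_eq_smul, hω,
    hDx, smul_smul, smul_smul, ← add_smul, ← sub_smul, ← sub_smul, map_sub, map_add]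
  congr 1
  have := hm.partial_fractions h₁' hxy n₁ n₂ n₃ hN
  linear_combination this

end GroupLaw

/-! ### Sums and differences of points -/

section Sums

variable {𝕜 : Type u} [Field 𝕜] {g₂ g₃ : 𝕜} {R : Type*} [CommRing R] [Algebra 𝕜 R]

theorem liftA_mkA {a b c : R}
    (h : b ^ 2 = 4 * a ^ 3 - algebraMap 𝕜 R g₂ * a - algebraMap 𝕜 R g₃)
    (p : MvPolynomial (Fin 3) 𝕜) :
    liftA a b c h (mkA g₂ g₃ p) = MvPolynomial.aeval ![a, b, c] p := rfl

theorem liftA_xA {a b c : R}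
    (h : b ^ 2 = 4 * a ^ 3 - algebraMap 𝕜 R g₂ * a - algebraMap 𝕜 R g₃) :
    liftA a b c h (xA g₂ g₃) = a := by
  rw [xA, liftA_mkA, MvPolynomial.aeval_X]; rfl

theorem liftA_yA {a b c : R}
    (h : b ^ 2 = 4 * a ^ 3 - algebraMap 𝕜 R g₂ * a - algebraMap 𝕜 R g₃) :
    liftA a b c h (yA g₂ g₃) = b := by
  rw [yA, liftA_mkA, MvPolynomial.aeval_X]; rfl

theorem liftA_cA {a b c : R}
    (h : b ^ 2 = 4 * a ^ 3 - algebraMap 𝕜 R g₂ * a - algebraMap 𝕜 R g₃) :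
    liftA a b c h (cA g₂ g₃) = c := by
  rw [cA, liftA_mkA, MvPolynomial.aeval_X]; rfl

theorem antipode_y : antipode g₂ g₃ (yA g₂ g₃) = -yA g₂ g₃ := liftA_yA _

theorem antipode_c : antipode g₂ g₃ (cA g₂ g₃) = -cA g₂ g₃ := liftA_cA _

theorem IsSum.comp {φ₁ φ₂ φ₃ : CalA g₂ g₃ →ₐ[𝕜] R} {b : R} (h : IsSum φ₁ φ₂ φ₃ b) {B : Type*}
    [CommRing B] [Algebra 𝕜 B] (Φ : R →ₐ[𝕜] B) :
    IsSum (Φ.comp φ₁) (Φ.comp φ₂) (Φ.comp φ₃) (Φ b) where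
  chord := by
    have := h.chord.map (Φ : R →+* B)
    simpa using this
  c_eq := by simp [h.c_eq]

variable [CharZero 𝕜]

theorem two_mul_half_smul (l : R) : 2 * ((1 / 2 : 𝕜) • l) = l := by
  rw [← Nat.cast_ofNat, ← nsmul_eq_mul, ← Nat.cast_smul_eq_nsmul 𝕜, smul_smul]
  norm_num

theorem isSum_addHom (φ₁ φ₂ : CalA g₂ g₃ →ₐ[𝕜] R) (l : R)
    (h₁ : l * (φ₁ (xA g₂ g₃) - φ₂ (xA g₂ g₃)) = φ₁ (yA g₂ g₃) - φ₂ (yA g₂ g₃))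
    (h₂ : l * (φ₁ (yA g₂ g₃) + φ₂ (yA g₂ g₃)) =
      4 * (φ₁ (xA g₂ g₃) ^ 2 + φ₁ (xA g₂ g₃) * φ₂ (xA g₂ g₃) + φ₂ (xA g₂ g₃) ^ 2)
        - algebraMap 𝕜 R g₂) :
    IsSum φ₁ φ₂ (addHom φ₁ φ₂ l h₁ h₂) ((1 / 2 : 𝕜) • l) := by
  have hl := two_mul_half_smul (𝕜 := 𝕜) l
  have e₂ : ∀ r : R, (1 / 2 : 𝕜) • r = algebraMap 𝕜 R (1 / 2) * r := fun r => Algebra.smul_def _ _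
  have e₄ : ∀ r : R, (1 / 4 : 𝕜) • r = algebraMap 𝕜 R (1 / 2) ^ 2 * r := fun r => by
    rw [Algebra.smul_def, ← map_pow]; norm_num
  have e₃ : ∀ r : R, (3 / 2 : 𝕜) • r = 3 * algebraMap 𝕜 R (1 / 2) * r := fun r => by
    rw [Algebra.smul_def, ← map_ofNat (algebraMap 𝕜 R), ← map_mul]; norm_num
  have hh : algebraMap 𝕜 R (1 / 2) * 2 = 1 := by
    rw [← map_ofNat (algebraMap 𝕜 R), ← map_mul]; norm_num
  refine ⟨⟨by rw [hl, h₁], by rw [hl, h₂], ?_, ?_⟩, liftA_cA _⟩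
  · rw [addHom, liftA_xA, e₄, e₂]
    ring
  · rw [addHom, liftA_xA, liftA_yA, hl, e₄, e₂, e₃, e₄]
    linear_combination (-algebraMap 𝕜 R (1 / 2)) * h₁ +
      (-φ₁ (yA g₂ g₃) + l * (2 * φ₁ (xA g₂ g₃) + φ₂ (xA g₂ g₃))) * hh

theorem sTilde_add (hE : g₂ ^ 3 - 27 * g₃ ^ 2 ≠ 0) {K : Type*} [Field K] [Algebra 𝕜 K]
    {φ₁ φ₂ φ₃ : CalA g₂ g₃ →ₐ[𝕜] K} {b : K} (h : IsSum φ₁ φ₂ φ₃ b) :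
    sTilde hE φ₃ = sTilde hE φ₁ + sTilde hE φ₂ := by
  have : CharZero K := charZero_of_injective_algebraMap (algebraMap 𝕜 K).injective
  obtain ⟨g, hg⟩ := connForm_add_connForm (φ₁ (cA g₂ g₃)) (φ₂ (cA g₂ g₃))
    (xyF_eq (algebraMap 𝕜 K g₂) (algebraMap 𝕜 K g₃)) (xF_ne _ _) (yF_ne _ _) h.chord
    (hom_curve_eq φ₁)
  rw [← h.c_eq] at hg
  refine Subtype.ext (Eq.symm ?_)
  refine (QuotientAddGroup.eq_iff_sub_mem).2 ?_
  exact ⟨g, hg.symm⟩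

theorem sTilde_comp_antipode (hE : g₂ ^ 3 - 27 * g₃ ^ 2 ≠ 0) {K : Type*} [Field K] [Algebra 𝕜 K]
    (φ : CalA g₂ g₃ →ₐ[𝕜] K) : sTilde hE (φ.comp (antipode g₂ g₃)) = -sTilde hE φ := by
  have : CharZero K := charZero_of_injective_algebraMap (algebraMap 𝕜 K).injective
  have hg := connForm_add_connForm_neg (x := xF (algebraMap 𝕜 K g₂) (algebraMap 𝕜 K g₃))
    (φ (xA g₂ g₃)) (φ (yA g₂ g₃)) (φ (cA g₂ g₃)) (xF_ne _ _ _)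
    (yF_ne (algebraMap 𝕜 K g₂) (algebraMap 𝕜 K g₃))
  rw [eq_neg_iff_add_eq_zero, add_comm]
  refine Subtype.ext ?_
  refine (QuotientAddGroup.eq_zero_iff _).2 ?_
  refine ⟨_, hg.symm.trans ?_⟩
  simp only [AlgHom.comp_apply, antipode_x, antipode_y, antipode_c, map_neg]

theorem isSum_addIn {A L : Type*} [CommRing A] [CommRing L] [Algebra 𝕜 A] [Algebra A L]
    [Algebra 𝕜 L] [IsScalarTower 𝕜 A L] (T : Subalgebra A L) (φ₁ φ₂ : CalA g₂ g₃ →ₐ[𝕜] A)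
    (hu : IsUnit (algebraMap A L (φ₁ (xA g₂ g₃)) - algebraMap A L (φ₂ (xA g₂ g₃))))
    (hl : slopeOf ((IsScalarTower.toAlgHom 𝕜 A L).comp φ₁)
      ((IsScalarTower.toAlgHom 𝕜 A L).comp φ₂) ∈ T) :
    IsSum ((IsScalarTower.toAlgHom 𝕜 A T).comp φ₁) ((IsScalarTower.toAlgHom 𝕜 A T).comp φ₂)
      (addIn T φ₁ φ₂ hu hl) ((1 / 2 : 𝕜) • (⟨_, hl⟩ : T)) := by
  unfold addIn
  exact isSum_addHom _ _ _ _ _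

theorem sTilde_sub (hE : g₂ ^ 3 - 27 * g₃ ^ 2 ≠ 0) {φ₁ φ₂ φ₃ : CalA g₂ g₃ →ₐ[𝕜] R} {b : R}
    (h : IsSum φ₁ (φ₂.comp (antipode g₂ g₃)) φ₃ b) {K : Type*} [Field K] [Algebra 𝕜 K]
    (Φ : R →ₐ[𝕜] K) :
    sTilde hE (Φ.comp φ₃) = sTilde hE (Φ.comp φ₁) - sTilde hE (Φ.comp φ₂) := by
  rw [sTilde_add hE (h.comp Φ), ← AlgHom.comp_assoc, sTilde_comp_antipode, sub_eq_add_neg]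

/-- The three differences of three points: if `φ₁₂ = φ₁ - φ₂`, `φ₂₃ = φ₂ - φ₃` and
`φ₁₃ = φ₁ - φ₃`, then `φ₁₃ = φ₁₂ + φ₂₃`, and the half slope for the latter sum is `c - a - b`. All
this follows from the relation `ca + cb - ab = x₁ + x₂ + x₃` of the half slopes. -/
theorem isSum_of_differences {φ₁ φ₂ φ₃ φ₁₂ φ₂₃ φ₁₃ : CalA g₂ g₃ →ₐ[𝕜] R} {a b c : R}
    (h₁₂ : IsSum φ₁ (φ₂.comp (antipode g₂ g₃)) φ₁₂ a)
    (h₂₃ : IsSum φ₂ (φ₃.comp (antipode g₂ g₃)) φ₂₃ b)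
    (h₁₃ : IsSum φ₁ (φ₃.comp (antipode g₂ g₃)) φ₁₃ c)
    (hr : IsLeftRegular (φ₁ (xA g₂ g₃) - φ₂ (xA g₂ g₃))) :
    IsSum φ₁₂ φ₂₃ φ₁₃ (c - a - b) := by
  obtain ⟨⟨s₁, t₁, ex₁, ey₁⟩, c₁⟩ := h₁₂
  obtain ⟨⟨s₂, t₂, ex₂, ey₂⟩, c₂⟩ := h₂₃
  obtain ⟨⟨s₃, t₃, ex₃, ey₃⟩, c₃⟩ := h₁₃
  simp only [AlgHom.comp_apply, antipode_x, antipode_y, antipode_c, map_neg] at *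
  generalize φ₁ (xA g₂ g₃) = x₁, φ₂ (xA g₂ g₃) = x₂, φ₃ (xA g₂ g₃) = x₃ at *
  generalize φ₁ (yA g₂ g₃) = y₁, φ₂ (yA g₂ g₃) = y₂, φ₃ (yA g₂ g₃) = y₃ at *
  have hK : c * a + c * b - a * b = x₁ + x₂ + x₃ := by
    refine hr ((isUnit_two 𝕜 R).mul_left_cancel ((isUnit_two 𝕜 R).mul_left_cancel ?_))
    dsimp only
    linear_combination (-2 * b + 2 * c) * s₁ - 2 * c * s₂ - t₂ + 2 * b * s₃ + t₃
  refine ⟨⟨?_, ?_, ?_, ?_⟩, by rw [c₁, c₂, c₃]; ring⟩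
  · rw [ey₁, ey₂, ex₁, ex₂]
    linear_combination (2 * a - 2 * b) * hK + s₂ - s₃
  · rw [ey₁, ey₂, ex₁, ex₂]
    linear_combination (4 * x₁ + 8 * x₂ - 4 * a ^ 2 + 4 * a * b - 4 * b ^ 2) * hK +
      (2 * c - 2 * a) * s₁ + t₂ - 2 * b * s₃
  · rw [ex₁, ex₂, ex₃]
    linear_combination 2 * hK
  · rw [ey₁, ey₃, ex₁, ex₃]
    linear_combination (-2 * a - 2 * c) * hK + s₁ - s₂ + s₃

end Sums

/-! ### The coproduct and the differences on `(E^♯)ⁿ` -/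

section Instances

variable {𝕜 : Type u} [Field 𝕜] (g₂ g₃ : 𝕜) {n : ℕ} (i j k : Fin n)

/-- The difference of two coordinates is invertible in the localization, which contains the ring
generated by the slopes. -/
theorem isLeftRegular_tripleProj_sub : IsLeftRegular
    (tripleProj g₂ g₃ i j k i (xA g₂ g₃) - tripleProj g₂ g₃ i j k j (xA g₂ g₃)) := by
  have hu : IsUnit (algebraMap _ (TripleLoc g₂ g₃ i j k)
      (proj g₂ g₃ i (xA g₂ g₃) - proj g₂ g₃ j (xA g₂ g₃))) :=
    isUnit_of_dvd_unit (map_dvd _ ⟨_, mul_assoc _ _ _⟩)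
      (IsLocalization.Away.algebraMap_isUnit (tripleDenom g₂ g₃ i j k))
  rw [map_sub] at hu
  intro r s h
  exact Subtype.ext (hu.mul_left_cancel (congrArg Subtype.val h))

variable [CharZero 𝕜]

theorem exists_isSum_comul : ∃ b, IsSum (inl g₂ g₃) (inr g₂ g₃) (comul g₂ g₃) b :=
  ⟨_, isSum_addIn _ _ _ _ _⟩

theorem exists_isSum_diffIJ : ∃ b, IsSum (tripleProj g₂ g₃ i j k i)
    ((tripleProj g₂ g₃ i j k j).comp (antipode g₂ g₃)) (diffIJ g₂ g₃ i j k) b :=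
  ⟨_, isSum_addIn _ _ ((proj g₂ g₃ j).comp (antipode g₂ g₃)) _ _⟩

theorem exists_isSum_diffIK : ∃ b, IsSum (tripleProj g₂ g₃ i j k i)
    ((tripleProj g₂ g₃ i j k k).comp (antipode g₂ g₃)) (diffIK g₂ g₃ i j k) b :=
  ⟨_, isSum_addIn _ _ ((proj g₂ g₃ k).comp (antipode g₂ g₃)) _ _⟩

theorem exists_isSum_diffJK : ∃ b, IsSum (tripleProj g₂ g₃ i j k j)
    ((tripleProj g₂ g₃ i j k k).comp (antipode g₂ g₃)) (diffJK g₂ g₃ i j k) b :=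
  ⟨_, isSum_addIn _ _ ((proj g₂ g₃ k).comp (antipode g₂ g₃)) _ _⟩

theorem exists_isSum_diff :
    ∃ b, IsSum (diffIJ g₂ g₃ i j k) (diffJK g₂ g₃ i j k) (diffIK g₂ g₃ i j k) b := by
  obtain ⟨a, h₁⟩ := exists_isSum_diffIJ g₂ g₃ i j k
  obtain ⟨b, h₂⟩ := exists_isSum_diffJK g₂ g₃ i j k
  obtain ⟨c, h₃⟩ := exists_isSum_diffIK g₂ g₃ i j k
  exact ⟨_, isSum_of_differences h₁ h₂ h₃ (isLeftRegular_tripleProj_sub g₂ g₃ i j k)⟩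

theorem fay_comul :
    fAt (inl g₂ g₃) (zVar (PairRing g₂ g₃)) * fAt (comul g₂ g₃) (zVar' (PairRing g₂ g₃)) -
      fAt (inl g₂ g₃) (zVar (PairRing g₂ g₃) + zVar' (PairRing g₂ g₃)) *
        fAt (inr g₂ g₃) (zVar' (PairRing g₂ g₃)) +
      fAt (inr g₂ g₃) (-zVar (PairRing g₂ g₃)) *
        fAt (comul g₂ g₃) (zVar (PairRing g₂ g₃) + zVar' (PairRing g₂ g₃)) = 0 := by
  obtain ⟨b, h⟩ := exists_isSum_comul g₂ g₃
  exact fay_polar h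

theorem fay_diff :
    fAt (diffIJ g₂ g₃ i j k) (zVar (TripleRing g₂ g₃ i j k)) *
        fAt (diffIK g₂ g₃ i j k) (zVar' (TripleRing g₂ g₃ i j k)) -
      fAt (diffIJ g₂ g₃ i j k) (zVar (TripleRing g₂ g₃ i j k) + zVar' (TripleRing g₂ g₃ i j k)) *
        fAt (diffJK g₂ g₃ i j k) (zVar' (TripleRing g₂ g₃ i j k)) +
      fAt (diffJK g₂ g₃ i j k) (-zVar (TripleRing g₂ g₃ i j k)) *
        fAt (diffIK g₂ g₃ i j k)
          (zVar (TripleRing g₂ g₃ i j k) + zVar' (TripleRing g₂ g₃ i j k)) = 0 := by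
  obtain ⟨b, h⟩ := exists_isSum_diff g₂ g₃ i j k
  exact fay_polar h

end Instances

end FayAlg

end

theorem mainTheorem8 {𝕜 : Type u} [Field 𝕜] [CharZero 𝕜] (g₂ g₃ : 𝕜)
    (hE : g₂ ^ 3 - 27 * g₃ ^ 2 ≠ 0) :
    -- `Δ` is the coproduct given by the group law of `E^♯`
    (∀ (K : Type v) [Field K] [Algebra 𝕜 K] (Φ : FayAlg.PairRing g₂ g₃ →ₐ[𝕜] K),
      FayAlg.sTilde hE (Φ.comp (FayAlg.comul g₂ g₃)) =
        FayAlg.sTilde hE (Φ.comp (FayAlg.inl g₂ g₃)) +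
          FayAlg.sTilde hE (Φ.comp (FayAlg.inr g₂ g₃))) ∧
    -- the algebraic Fay identity on `(E^♯)²`
    (let z := FayAlg.zVar (FayAlg.PairRing g₂ g₃)
     let z' := FayAlg.zVar' (FayAlg.PairRing g₂ g₃)
     FayAlg.fAt (FayAlg.inl g₂ g₃) z * FayAlg.fAt (FayAlg.comul g₂ g₃) z'
       - FayAlg.fAt (FayAlg.inl g₂ g₃) (z + z') * FayAlg.fAt (FayAlg.inr g₂ g₃) z'
       + FayAlg.fAt (FayAlg.inr g₂ g₃) (-z) * FayAlg.fAt (FayAlg.comul g₂ g₃) (z + z') = 0) ∧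
    ∀ (n : ℕ) (i j k : Fin n), i < j → j < k →
      -- the morphisms `𝒜 → 𝒪((E^♯)ⁿ ∖ …)` are dual to the differences of two points
      (∀ (K : Type v) [Field K] [Algebra 𝕜 K] (Φ : FayAlg.TripleRing g₂ g₃ i j k →ₐ[𝕜] K),
        FayAlg.sTilde hE (Φ.comp (FayAlg.diffIJ g₂ g₃ i j k)) =
          FayAlg.sTilde hE (Φ.comp (FayAlg.tripleProj g₂ g₃ i j k i)) -
            FayAlg.sTilde hE (Φ.comp (FayAlg.tripleProj g₂ g₃ i j k j)) ∧
        FayAlg.sTilde hE (Φ.comp (FayAlg.diffIK g₂ g₃ i j k)) =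
          FayAlg.sTilde hE (Φ.comp (FayAlg.tripleProj g₂ g₃ i j k i)) -
            FayAlg.sTilde hE (Φ.comp (FayAlg.tripleProj g₂ g₃ i j k k)) ∧
        FayAlg.sTilde hE (Φ.comp (FayAlg.diffJK g₂ g₃ i j k)) =
          FayAlg.sTilde hE (Φ.comp (FayAlg.tripleProj g₂ g₃ i j k j)) -
            FayAlg.sTilde hE (Φ.comp (FayAlg.tripleProj g₂ g₃ i j k k))) ∧
      -- the algebraic Fay identity on `(E^♯)ⁿ`
      (let z := FayAlg.zVar (FayAlg.TripleRing g₂ g₃ i j k)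
       let z' := FayAlg.zVar' (FayAlg.TripleRing g₂ g₃ i j k)
       FayAlg.fAt (FayAlg.diffIJ g₂ g₃ i j k) z * FayAlg.fAt (FayAlg.diffIK g₂ g₃ i j k) z'
         - FayAlg.fAt (FayAlg.diffIJ g₂ g₃ i j k) (z + z') *
            FayAlg.fAt (FayAlg.diffJK g₂ g₃ i j k) z'
         + FayAlg.fAt (FayAlg.diffJK g₂ g₃ i j k) (-z) *
            FayAlg.fAt (FayAlg.diffIK g₂ g₃ i j k) (z + z') = 0) := by
  refine ⟨fun K _ _ Φ => ?_, ?_, fun n i j k _ _ => ⟨fun K _ _ Φ => ⟨?_, ?_, ?_⟩, ?_⟩⟩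
  · obtain ⟨b, h⟩ := FayAlg.exists_isSum_comul g₂ g₃
    exact FayAlg.sTilde_add hE (h.comp Φ)
  · exact FayAlg.fay_comul g₂ g₃
  · obtain ⟨b, h⟩ := FayAlg.exists_isSum_diffIJ g₂ g₃ i j k
    exact FayAlg.sTilde_sub hE h Φ
  · obtain ⟨b, h⟩ := FayAlg.exists_isSum_diffIK g₂ g₃ i j k
    exact FayAlg.sTilde_sub hE h Φ
  · obtain ⟨b, h⟩ := FayAlg.exists_isSum_diffJK g₂ g₃ i j k
    exact FayAlg.sTilde_sub hE h Φ
  · exact FayAlg.fay_diff g₂ g₃ i j k
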